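/- In the problem 2-Disjoint Shortest Paths one is given a finite simple undirected graph $G=(V,E)$ with $n$ vertices and $m$ edges (as a list of its edges, $V=\{0,\dots,n-1\}$) and two pairs $(s_1,t_1)$, $(s_2,t_2)$ of vertices with $s_1\neq t_1$ and $s_2\neq t_2$; the task is to find vertex-disjoint paths $P_1,P_2$ such that $P_i$ is a shortest $s_i$-$t_i$-path in $G$ for $i=1,2$, or to report correctly that no such paths exist. This problem can be solved in $O(n^2m)$ time: there are a single program for a deterministic unit-cost random access machine with words of $O(\log n)$ bits and a constant $C$ such that on every instance the program halts with a correct answer after at most $C\cdot(n^2m+1)$ steps (the summand $1$ matters only for $m=0$). -/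

import Mathlib

/-! ## Disjoint shortest paths -/

/-- `p` is a shortest `u`-`v`-path of `G`. -/
def IsShortestPath {V : Type*} (G : SimpleGraph V) {u v : V} (p : G.Walk u v) : Prop :=
  p.IsPath ∧ p.length = G.dist u v

/-- The family `P` solves the instance `(G, (s i, t i))` of `k`-Disjoint Shortest Paths: every `P i`
is a shortest `s i`-`t i`-path, and the paths are pairwise vertex-disjoint. -/
def IsDSPSolution {V : Type*} (G : SimpleGraph V) {k : ℕ} (s t : Fin k → V)
    (P : ∀ i, G.Walk (s i) (t i)) : Prop :=
  (∀ i, IsShortestPath G (P i)) ∧ ∀ i j, i ≠ j → List.Disjoint (P i).support (P j).support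

/-! ## The machine model: a random access machine with unit cost and bounded words -/

namespace RAM

/-- A machine state: the contents of the registers and of the memory cells. -/
structure State where
  reg : ℕ → ℕ
  mem : ℕ → ℕ

/-- Elementary instructions; `x`, `y`, `z` are register numbers, `a` is a numerical constant. -/
inductive Instr where
  /-- `reg x := a` -/
  | const (x a : ℕ)
  /-- `reg x := reg y` -/
  | copy (x y : ℕ)
  /-- `reg x := reg y + reg z` -/
  | add (x y z : ℕ)
  /-- `reg x := reg y - reg z` (or `0`, if `reg y < reg z`) -/
  | sub (x y z : ℕ)
  /-- `reg x := reg y * reg z` -/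
  | mul (x y z : ℕ)
  /-- `reg x := mem (reg y)` -/
  | load (x y : ℕ)
  /-- `mem (reg x) := reg y` -/
  | store (x y : ℕ)

/-- The number that an instruction writes. -/
def Instr.val : Instr → State → ℕ
  | const _ a, _ => a
  | copy _ y, σ => σ.reg y
  | add _ y z, σ => σ.reg y + σ.reg z
  | sub _ y z, σ => σ.reg y - σ.reg z
  | mul _ y z, σ => σ.reg y * σ.reg z
  | load _ y, σ => σ.mem (σ.reg y)
  | store _ y, σ => σ.reg y

/-- The effect of an instruction: the number `i.val σ` is written to its target. -/
def Instr.run (i : Instr) (σ : State) : State :=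
  match i with
  | const x _ | copy x _ | add x _ _ | sub x _ _ | mul x _ _ | load x _ =>
      { σ with reg := Function.update σ.reg x (i.val σ) }
  | store x _ => { σ with mem := Function.update σ.mem (σ.reg x) (i.val σ) }

/-- Elementary tests of two registers. -/
inductive Test where
  | eq (x y : ℕ)
  | lt (x y : ℕ)

/-- The test succeeds in the state `σ`. -/
def Test.Holds : Test → State → Prop
  | eq x y, σ => σ.reg x = σ.reg y
  | lt x y, σ => σ.reg x < σ.reg y

/-- Programs: finite objects that do not depend on the input. -/
inductive Prog where
  | skip
  | instr (i : Instr)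
  | seq (P Q : Prog)
  /-- if `c` then `P` else `Q` -/
  | branch (c : Test) (P Q : Prog)
  /-- while `c` do `P` -/
  | loop (c : Test) (P : Prog)

/-- `Exec W P σ σ' τ`: started in the state `σ`, the program `P` halts in the state `σ'` after
exactly `τ` steps, and all numbers that it writes are smaller than `W`. Every instruction and every
evaluation of a test is one step. An instruction that would write a number `≥ W` cannot be
executed. -/
inductive Exec (W : ℕ) : Prog → State → State → ℕ → Prop where
  | skip (σ : State) : Exec W .skip σ σ 1
  | instr (i : Instr) (σ : State) (h : i.val σ < W) : Exec W (.instr i) σ (i.run σ) 1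
  | seq {P Q : Prog} {σ₁ σ₂ σ₃ : State} {τ₁ τ₂ : ℕ}
      (h₁ : Exec W P σ₁ σ₂ τ₁) (h₂ : Exec W Q σ₂ σ₃ τ₂) : Exec W (.seq P Q) σ₁ σ₃ (τ₁ + τ₂)
  | branchTrue {c : Test} {P Q : Prog} {σ₁ σ₂ : State} {τ : ℕ}
      (hc : c.Holds σ₁) (h : Exec W P σ₁ σ₂ τ) : Exec W (.branch c P Q) σ₁ σ₂ (1 + τ)
  | branchFalse {c : Test} {P Q : Prog} {σ₁ σ₂ : State} {τ : ℕ}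
      (hc : ¬ c.Holds σ₁) (h : Exec W Q σ₁ σ₂ τ) : Exec W (.branch c P Q) σ₁ σ₂ (1 + τ)
  | loopTrue {c : Test} {P : Prog} {σ₁ σ₂ σ₃ : State} {τ₁ τ₂ : ℕ}
      (hc : c.Holds σ₁) (h₁ : Exec W P σ₁ σ₂ τ₁) (h₂ : Exec W (.loop c P) σ₂ σ₃ τ₂) :
      Exec W (.loop c P) σ₁ σ₃ (1 + τ₁ + τ₂)
  | loopFalse {c : Test} {P : Prog} {σ : State} (hc : ¬ c.Holds σ) : Exec W (.loop c P) σ σ 1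

/-- The machine is deterministic: the final state and the number of steps are unique. -/
theorem Exec.deterministic {W : ℕ} {P : Prog} {σ σ₁ σ₂ : State} {τ₁ τ₂ : ℕ}
    (h₁ : Exec W P σ σ₁ τ₁) (h₂ : Exec W P σ σ₂ τ₂) : σ₁ = σ₂ ∧ τ₁ = τ₂ := by
  induction h₁ generalizing σ₂ τ₂ with
  | skip => cases h₂; exact ⟨rfl, rfl⟩
  | instr => cases h₂; exact ⟨rfl, rfl⟩
  | seq _ _ ih₁ ih₂ =>
    cases h₂ with
    | seq k₁ k₂ =>
      obtain ⟨rfl, rfl⟩ := ih₁ k₁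
      obtain ⟨rfl, rfl⟩ := ih₂ k₂
      exact ⟨rfl, rfl⟩
  | branchTrue hc _ ih =>
    cases h₂ with
    | branchTrue _ k => obtain ⟨rfl, rfl⟩ := ih k; exact ⟨rfl, rfl⟩
    | branchFalse hc' _ => exact absurd hc hc'
  | branchFalse hc _ ih =>
    cases h₂ with
    | branchTrue hc' _ => exact absurd hc' hc
    | branchFalse _ k => obtain ⟨rfl, rfl⟩ := ih k; exact ⟨rfl, rfl⟩
  | loopTrue hc _ _ ih₁ ih₂ =>
    cases h₂ with
    | loopTrue _ k₁ k₂ =>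
      obtain ⟨rfl, rfl⟩ := ih₁ k₁
      obtain ⟨rfl, rfl⟩ := ih₂ k₂
      exact ⟨rfl, rfl⟩
    | loopFalse hc' => exact absurd hc hc'
  | loopFalse hc =>
    cases h₂ with
    | loopTrue hc' _ _ => exact absurd hc' hc
    | loopFalse _ => exact ⟨rfl, rfl⟩

end RAM

/-! ## Input and output conventions -/

/-- The arrays `src`, `dst` list every edge of `G` exactly once, in any order and with the two ends
of each edge in any order. In particular `m` is the number of edges of `G`. -/
def IsEdgeList {n m : ℕ} (G : SimpleGraph (Fin n)) (src dst : Fin m → Fin n) : Prop :=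
  Function.Injective (fun j => s(src j, dst j)) ∧
    Set.range (fun j => s(src j, dst j)) = G.edgeSet

/-- The initial state for an instance of `k`-Disjoint Shortest Paths. Registers `0` and `1` hold the
numbers of vertices and edges, the registers `2 + 2 * i` and `3 + 2 * i` hold `s i` and `t i`. The
memory cells `2 * j` and `2 * j + 1` hold the ends of the `j`-th edge. All else is `0`. -/
def inputState {n m k : ℕ} (src dst : Fin m → Fin n) (s t : Fin k → Fin n) : RAM.State where
  reg r :=
    if r = 0 then n
    else if r = 1 then m
    else if h : (r - 2) / 2 < k then
      (if r % 2 = 0 then (s ⟨(r - 2) / 2, h⟩ : ℕ) else (t ⟨(r - 2) / 2, h⟩ : ℕ))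
    else 0
  mem a :=
    if h : a / 2 < m then
      (if a % 2 = 0 then (src ⟨a / 2, h⟩ : ℕ) else (dst ⟨a / 2, h⟩ : ℕ))
    else 0

/-- The vertices of the path `p` are written in this order in the memory cells `a, a + 1, …` -/
def IsWrittenAt {n : ℕ} {G : SimpleGraph (Fin n)} {u v : Fin n} (p : G.Walk u v)
    (mem : ℕ → ℕ) (a : ℕ) : Prop :=
  ∀ i ≤ p.length, mem (a + i) = (p.getVert i : ℕ)

/-- The final state `σ` answers the instance correctly: either register `0` holds `1` and for some
solution `P` the registers `1 + 2 * i` and `2 + 2 * i` hold the address at which `P i` is written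
and the length of `P i`, or register `0` holds `0` and there is no solution. -/
def IsCorrectAnswer {n k : ℕ} (G : SimpleGraph (Fin n)) (s t : Fin k → Fin n)
    (σ : RAM.State) : Prop :=
  (σ.reg 0 = 1 ∧ ∃ P : ∀ i, G.Walk (s i) (t i), IsDSPSolution G s t P ∧
      ∀ i : Fin k, IsWrittenAt (P i) σ.mem (σ.reg (1 + 2 * i)) ∧
        σ.reg (2 + 2 * i) = (P i).length) ∨
    (σ.reg 0 = 0 ∧ ¬ ∃ P : ∀ i, G.Walk (s i) (t i), IsDSPSolution G s t P)

/-! Let `x` and `y` be the distances from `s₁` and `s₂`. Along the first path `x` grows by one per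
step while `y` drops by at most one, so the level `x + y` never decreases; the same holds along the
second path. The two paths are grown together, and a configuration keeps only the two heads and two
bits. The path whose head has the lower level moves, and a completed path counts as lying above all
levels. Hence the vertices that a path has left behind lie at most on the level of the other head,
and a forgotten vertex can be hit only on a common level. There `x + y` is constant: the first path
walks towards larger `x`, the second towards smaller `x`. At a tie the second path walks its stretch
of the level first, then the first path moves. The bit `l` keeps the second path from continuing on
the level after that. The bit `k` records that the second path has walked there towards the first
one from the right, in which case the first path must not go beyond the head of the second. With
these rules every run yields disjoint paths (`Inst.RunInv.move₁`, `Inst.RunInv.move₂`).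

Conversely, the search can follow any two disjoint paths unless they pass each other, that is,
traverse the same pair of neighbouring coordinates on one level in opposite directions
(`Inst.Sol.not_overtake`, `Inst.Sol.exists_conf`). Reversing the second path replaces `y` by `n -
y`, so that levels become those of `x - y`. Passing cannot occur for both directions
(`not_both_pass`), so one of two searches succeeds whenever a solution exists (`exists_sol`).

There are `4 * n ^ 2` configurations, and each is treated once by a scan of all edges, which gives
`O(n ^ 2 * m)`. The distances come from `n` rounds of Bellman-Ford in `O(n * m)`; marks, output and
reversal cost `O(n ^ 2)`. The case `m = 0` is answered at once, which is why `n ^ 2 * (m + 1)` is an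
admissible bound for the rest. Correctness and cost of the program are proved together: weakest
preconditions for loop-free parts, and two rules for loops. -/

namespace TwoDSP

open RAM

/-! ### The pair search: coordinates, configurations, steps -/

/-- A search problem on the vertices `0, …, n - 1`, with two integer coordinates `x`, `y` for every
vertex. The first path leads from `s₁` to `t₁` and increases `x` in every step, the second one leads
from `s₂` to `t₂` and increases `y` in every step. -/
structure Inst where
  n : ℕ
  m : ℕ
  src : ℕ → ℕ
  dst : ℕ → ℕ
  x : ℕ → ℕ
  y : ℕ → ℕ
  s₁ : ℕ
  t₁ : ℕ
  s₂ : ℕ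
  t₂ : ℕ

/-- A configuration of the search: the heads of the two partial paths, and two flags. If `l = 1`,
the second path must leave its level in the next step. If `k = 1`, the first path must not overtake
the second one on their common level. -/
@[ext] structure Conf where
  u : ℕ
  v : ℕ
  l : ℕ
  k : ℕ

namespace Inst

variable (I : Inst)

def Adj (a b : ℕ) : Prop :=
  ∃ j < I.m, (I.src j = a ∧ I.dst j = b) ∨ (I.src j = b ∧ I.dst j = a)

variable {I} in
theorem Adj.symm {a b : ℕ} (h : I.Adj a b) : I.Adj b a := by
  obtain ⟨j, hj, h⟩ := h
  exact ⟨j, hj, h.symm⟩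

/-- The level of a vertex. -/
def g (v : ℕ) : ℕ := I.x v + I.y v

/-- The level of the head of the first path, or `4 * n` if the path is complete. -/
def h₁ (u : ℕ) : ℕ := if u = I.t₁ then 4 * I.n else I.g u

/-- The level of the head of the second path, or `4 * n` if the path is complete. -/
def h₂ (v : ℕ) : ℕ := if v = I.t₂ then 4 * I.n else I.g v

/-- The first path may be extended to the neighbour `b` of its head. -/
def Move₁ (s : Conf) (b : ℕ) : Prop :=
  s.u ≠ I.t₁ ∧ b ≠ s.v ∧ I.h₁ s.u ≤ I.h₂ s.v ∧ I.x b = I.x s.u + 1 ∧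
    (I.g b = I.g s.u → s.k = 0 ∨ I.x b ≤ I.x s.v)

/-- After a move at a tie the first path leaves a vertex behind on the level of the second head,
which the second path could hit if it went on along that level; hence `l`. The restriction `k`
concerns one level only and lapses when that level is left. -/
def next₁ (s : Conf) (b : ℕ) : Conf where
  u := b
  v := s.v
  l := if I.h₁ s.u = I.h₂ s.v then 1 else 0
  k := if I.g b = I.g s.u then s.k else 0

/-- The second path may be extended to the neighbour `b` of its head. -/
def Move₂ (s : Conf) (b : ℕ) : Prop :=
  s.v ≠ I.t₂ ∧ b ≠ s.u ∧ I.h₂ s.v ≤ I.h₁ s.u ∧ I.y b = I.y s.v + 1 ∧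
    (if I.g b = I.g s.v then s.l = 0 else I.h₁ s.u ≠ I.h₂ s.v)

/-- The bit `k` is switched on when, at a tie, the second path steps along the level towards the
first head from its right: the vertices it leaves there are ahead of the first path. -/
def next₂ (s : Conf) (b : ℕ) : Conf where
  u := s.u
  v := b
  l := 0
  k := if I.g b = I.g s.v then
    (if I.h₁ s.u = I.h₂ s.v then if I.x s.u < I.x s.v then 1 else s.k else s.k) else 0

/-- One of the two paths is extended by one vertex. -/
def Step (s s' : Conf) : Prop :=
  (∃ b, I.Adj s.u b ∧ I.Move₁ s b ∧ s' = I.next₁ s b) ∨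
    ∃ b, I.Adj s.v b ∧ I.Move₂ s b ∧ s' = I.next₂ s b

def start : Conf := ⟨I.s₁, I.s₂, 0, 0⟩

/-- `Chain C s` means that `C` lists the configurations of a run of the search from the start to
`s`, the last one first. -/
inductive Chain : List Conf → Conf → Prop
  | nil : Chain [I.start] I.start
  | cons {C : List Conf} {s s' : Conf} : Chain C s → I.Step s s' → Chain (s' :: C) s'

/-- Nothing is asked of the coordinates but range and Lipschitz conditions, so that reversed
coordinates qualify as well as distances. That `s₁` and `t₁` differ makes the start incomplete. -/
structure Valid : Prop where
  src_lt : ∀ j < I.m, I.src j < I.n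
  dst_lt : ∀ j < I.m, I.dst j < I.n
  x_le : ∀ v < I.n, I.x v ≤ I.n
  y_le : ∀ v < I.n, I.y v ≤ I.n
  x_lip : ∀ a b, I.Adj a b → I.x b ≤ I.x a + 1
  y_lip : ∀ a b, I.Adj a b → I.y b ≤ I.y a + 1
  s₁_lt : I.s₁ < I.n
  t₁_lt : I.t₁ < I.n
  s₂_lt : I.s₂ < I.n
  t₂_lt : I.t₂ < I.n
  s₁_ne_t₁ : I.s₁ ≠ I.t₁
  s₁_ne_s₂ : I.s₁ ≠ I.s₂

variable {I}

theorem Valid.adj_lt (hI : I.Valid) {a b : ℕ} (h : I.Adj a b) : a < I.n ∧ b < I.n := by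
  obtain ⟨j, hj, ⟨rfl, rfl⟩ | ⟨rfl, rfl⟩⟩ := h
  · exact ⟨hI.src_lt j hj, hI.dst_lt j hj⟩
  · exact ⟨hI.dst_lt j hj, hI.src_lt j hj⟩

theorem Valid.g_le_h₁ (hI : I.Valid) {v : ℕ} (h : v < I.n) : I.g v ≤ I.h₁ v := by
  have := hI.x_le v h
  have := hI.y_le v h
  unfold h₁ g
  split_ifs <;> omega

theorem Valid.g_le_h₂ (hI : I.Valid) {v : ℕ} (h : v < I.n) : I.g v ≤ I.h₂ v := by
  have := hI.x_le v h
  have := hI.y_le v h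
  unfold h₂ g
  split_ifs <;> omega

theorem Valid.g_lt (hI : I.Valid) {v : ℕ} (h : v < I.n) : I.g v < 4 * I.n := by
  have := hI.x_le v h
  have := hI.y_le v h
  unfold g
  omega

/-! ### Soundness: runs of the search give disjoint paths -/

/-- What holds for the configurations `C` of a run of the search that has led to `s`. -/
structure RunInv (C : List Conf) (s : Conf) : Prop where
  mem : s ∈ C
  lt : ∀ r ∈ C, r.u < I.n ∧ r.v < I.n
  x_le : ∀ r ∈ C, I.x r.u ≤ I.x s.u
  y_le : ∀ r ∈ C, I.y r.v ≤ I.y s.v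
  x_inj : ∀ r ∈ C, ∀ r' ∈ C, I.x r.u = I.x r'.u → r.u = r'.u
  y_inj : ∀ r ∈ C, ∀ r' ∈ C, I.y r.v = I.y r'.v → r.v = r'.v
  x_cov : ∀ i, I.x I.s₁ ≤ i → i < I.x s.u →
    ∃ r ∈ C, ∃ r' ∈ C, I.x r.u = i ∧ I.x r'.u = i + 1 ∧ I.Adj r.u r'.u
  y_cov : ∀ i, I.y I.s₂ ≤ i → i < I.y s.v →
    ∃ r ∈ C, ∃ r' ∈ C, I.y r.v = i ∧ I.y r'.v = i + 1 ∧ I.Adj r.v r'.v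
  g_le₁ : ∀ r ∈ C, I.g r.u ≤ I.g s.u
  g_le₂ : ∀ r ∈ C, I.g r.v ≤ I.g s.v
  disj : ∀ r ∈ C, ∀ r' ∈ C, r.u ≠ r'.v
  past₁ : ∀ r ∈ C, r.u = s.u ∨ I.g r.u < I.h₂ s.v ∨ (I.g r.u = I.h₂ s.v ∧ s.l = 1)
  past₂ : ∀ r ∈ C, r.v = s.v ∨ I.g r.v < I.h₁ s.u ∨
    (I.g r.v = I.h₁ s.u ∧ (I.x r.v ≤ I.x s.u ∨ (s.k = 1 ∧ I.x s.v < I.x r.v)))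

/-- A vertex left behind by the second path can equal `b` only on the level of the first head. By
`past₂` it would then satisfy `k = 1` and lie to the right of the second head, and this is what the
last condition of `Move₁` excludes. -/
theorem RunInv.move₁ (hI : I.Valid) {C : List Conf} {s : Conf} (h : I.RunInv C s) {b : ℕ}
    (hadj : I.Adj s.u b) (hm : I.Move₁ s b) : I.RunInv (I.next₁ s b :: C) (I.next₁ s b) := by
  obtain ⟨ht, hbv, hle, hx, hk⟩ := hm
  have hb := (hI.adj_lt hadj).2
  have hy := hI.y_lip _ _ hadj.symm
  have hgb : I.g s.u ≤ I.g b := by unfold g; omega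
  have hgb' := hI.g_le_h₁ hb
  have hu : I.h₁ s.u = I.g s.u := if_neg ht
  have hs := h.lt s h.mem
  have key : ∀ r ∈ C, r.v ≠ b ∧ (r.v = s.v ∨ I.g r.v < I.h₁ b ∨
      (I.g r.v = I.h₁ b ∧
        (I.x r.v ≤ I.x b ∨ (I.g b = I.g s.u ∧ s.k = 1 ∧ I.x s.v < I.x r.v)))) := by
    intro r hr
    have h3 := h.past₂ r hr
    rw [hu] at h3
    refine ⟨?_, ?_⟩
    · rintro rfl
      rcases h3 with h3 | h3 | ⟨h3, h4⟩ <;> omega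
    · rcases h3 with h3 | h3 | ⟨h3, h4⟩ <;> omega
  have hl : (I.next₁ s b).l = 1 ↔ I.h₁ s.u = I.h₂ s.v := by
    simp [next₁]
  have hkk : I.g b = I.g s.u → (I.next₁ s b).k = s.k := fun h => by simp [next₁, h]
  have hU : (I.next₁ s b).u = b := rfl
  have hV : (I.next₁ s b).v = s.v := rfl
  have hx1 : ∀ r ∈ C, I.x r.u < I.x b := fun r hr => by have := h.x_le r hr; omega
  constructor
  · simp
  · simp only [List.forall_mem_cons, hU, hV]
    exact ⟨⟨hb, hs.2⟩, h.lt⟩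
  · simp only [List.forall_mem_cons, hU, le_refl, true_and]
    exact fun r hr => (hx1 r hr).le
  · simp only [List.forall_mem_cons, hV, le_refl, true_and]
    exact h.y_le
  · simp only [List.forall_mem_cons, hU, true_and, implies_true]
    exact ⟨fun r hr h => absurd h (hx1 r hr).ne', fun r hr =>
      ⟨fun h => absurd h (hx1 r hr).ne, h.x_inj r hr⟩⟩
  · simp only [List.forall_mem_cons, hV, true_and, implies_true]
    exact ⟨h.y_inj s h.mem, fun r hr => ⟨h.y_inj r hr s h.mem, h.y_inj r hr⟩⟩
  · intro i hi hi'
    rw [hU] at hi'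
    rcases Nat.lt_or_ge i (I.x s.u) with h1 | h1
    · obtain ⟨r, hr, r', hr', h2⟩ := h.x_cov i hi h1
      exact ⟨r, by simp [hr], r', by simp [hr'], h2⟩
    · exact ⟨s, by simp [h.mem], I.next₁ s b, by simp, by omega, by rw [hU]; omega, hadj⟩
  · intro i hi hi'
    obtain ⟨r, hr, r', hr', h2⟩ := h.y_cov i hi hi'
    exact ⟨r, by simp [hr], r', by simp [hr'], h2⟩
  · simp only [List.forall_mem_cons, hU, le_refl, true_and]
    exact fun r hr => (h.g_le₁ r hr).trans hgb
  · simp only [List.forall_mem_cons, hV, le_refl, true_and]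
    exact h.g_le₂
  · simp only [List.forall_mem_cons, hU, hV]
    exact ⟨⟨hbv, fun r hr => (key r hr).1.symm⟩, fun r hr => ⟨h.disj r hr s h.mem, h.disj r hr⟩⟩
  · simp only [List.forall_mem_cons, hU, hV, true_or, true_and, hl]
    intro r hr
    have h2 := h.past₁ r hr
    have h3 := h.g_le₁ r hr
    omega
  · simp only [List.forall_mem_cons, hU, hV, true_or, true_and]
    intro r hr
    rcases (key r hr).2 with h3 | h3 | ⟨h3, h4 | ⟨h4, h5⟩⟩
    · exact Or.inl h3
    · exact Or.inr (Or.inl h3)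
    · exact Or.inr (Or.inr ⟨h3, Or.inl h4⟩)
    · exact Or.inr (Or.inr ⟨h3, Or.inr (by rw [hkk h4]; exact h5)⟩)

/-- By `past₁`, vertices left behind by the first path are strictly below the second head, or on its
level with `l = 1`. In the latter case `Move₂` forces the second path up, so `b` is new in either
case. -/
theorem RunInv.move₂ (hI : I.Valid) {C : List Conf} {s : Conf} (h : I.RunInv C s) {b : ℕ}
    (hadj : I.Adj s.v b) (hm : I.Move₂ s b) : I.RunInv (I.next₂ s b :: C) (I.next₂ s b) := by
  obtain ⟨ht, hbv, hle, hy, hk⟩ := hm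
  have hb := (hI.adj_lt hadj).2
  have hx := hI.x_lip _ _ hadj.symm
  have hgb : I.g s.v ≤ I.g b := by unfold g; omega
  have hgx : I.g b = I.g s.v → I.x s.v = I.x b + 1 := by unfold g; omega
  have hgb' := hI.g_le_h₂ hb
  have hv : I.h₂ s.v = I.g s.v := if_neg ht
  have hs := h.lt s h.mem
  have hl0 : I.g b = I.g s.v → s.l = 0 := fun h => by simpa [h] using hk
  have htie : I.g b ≠ I.g s.v → I.h₁ s.u ≠ I.h₂ s.v := fun h => by simpa [h] using hk
  have hU : (I.next₂ s b).u = s.u := rfl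
  have hV : (I.next₂ s b).v = b := rfl
  have hy1 : ∀ r ∈ C, I.y r.v < I.y b := fun r hr => by have := h.y_le r hr; omega
  have key : ∀ r ∈ C, r.u ≠ b ∧ (r.u = s.u ∨ I.g r.u < I.h₂ b) := by
    intro r hr
    have h3 := h.past₁ r hr
    rw [hv] at h3
    refine ⟨?_, ?_⟩
    · rintro rfl
      omega
    · rcases h3 with h3 | h3 | ⟨h3, h4⟩ <;> omega
  constructor
  · simp
  · simp only [List.forall_mem_cons, hU, hV]
    exact ⟨⟨hs.1, hb⟩, h.lt⟩
  · simp only [List.forall_mem_cons, hU, le_refl, true_and]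
    exact h.x_le
  · simp only [List.forall_mem_cons, hV, le_refl, true_and]
    exact fun r hr => (hy1 r hr).le
  · simp only [List.forall_mem_cons, hU, true_and, implies_true]
    exact ⟨h.x_inj s h.mem, fun r hr => ⟨h.x_inj r hr s h.mem, h.x_inj r hr⟩⟩
  · simp only [List.forall_mem_cons, hV, true_and, implies_true]
    exact ⟨fun r hr h => absurd h (hy1 r hr).ne', fun r hr =>
      ⟨fun h => absurd h (hy1 r hr).ne, h.y_inj r hr⟩⟩
  · intro i hi hi'
    obtain ⟨r, hr, r', hr', h2⟩ := h.x_cov i hi hi'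
    exact ⟨r, by simp [hr], r', by simp [hr'], h2⟩
  · intro i hi hi'
    rw [hV] at hi'
    rcases Nat.lt_or_ge i (I.y s.v) with h1 | h1
    · obtain ⟨r, hr, r', hr', h2⟩ := h.y_cov i hi h1
      exact ⟨r, by simp [hr], r', by simp [hr'], h2⟩
    · exact ⟨s, by simp [h.mem], I.next₂ s b, by simp, by omega, by rw [hV]; omega, hadj⟩
  · simp only [List.forall_mem_cons, hU, le_refl, true_and]
    exact h.g_le₁
  · simp only [List.forall_mem_cons, hV, le_refl, true_and]
    exact fun r hr => (h.g_le₂ r hr).trans hgb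
  · simp only [List.forall_mem_cons, hU, hV]
    exact ⟨⟨hbv.symm, h.disj s h.mem⟩, fun r hr => ⟨(key r hr).1, h.disj r hr⟩⟩
  · simp only [List.forall_mem_cons, hU, hV, true_or, true_and]
    intro r hr
    have := (key r hr).2
    tauto
  · simp only [List.forall_mem_cons, hU, hV, true_or, true_and]
    intro r hr
    have h3 := h.past₂ r hr
    have h4 := h.g_le₂ r hr
    right
    -- Along a level, the old head becomes a past vertex: at a tie it is either not to the right of
    -- the first head, or `k` becomes `1` and the new head is further left. A move off the level is
    -- allowed only without a tie, so then all past vertices are strictly below the first head.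
    by_cases hg : I.g b = I.g s.v
    · have := hgx hg
      simp only [next₂, hg, if_true]
      rcases h3 with h3 | h3 | ⟨h3, h5⟩
      · rw [h3]
        split_ifs <;> omega
      · exact Or.inl h3
      · split_ifs <;> omega
    · have := htie hg
      omega

theorem Chain.runInv (hI : I.Valid) {C : List Conf} {s : Conf} (h : I.Chain C s) :
    I.RunInv C s := by
  induction h with
  | nil =>
    constructor <;> simp [start]
    · exact ⟨hI.s₁_lt, hI.s₂_lt⟩
    · omega
    · omega
    · exact hI.s₁_ne_s₂
  | cons h hs ih =>
    obtain ⟨b, hadj, hm, rfl⟩ | ⟨b, hadj, hm, rfl⟩ := hs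
    · exact ih.move₁ hI hadj hm
    · exact ih.move₂ hI hadj hm

end Inst

/-! ### Completeness: the search can follow two paths that do not pass -/

namespace Inst

variable (I : Inst)

/-- The sequences `p` and `q` are the vertices of two disjoint paths that increase `x` and `y`,
respectively, in every step, and never pass each other along a common level. -/
structure Sol (p q : ℕ → ℕ) (K L : ℕ) : Prop where
  p_zero : p 0 = I.s₁
  p_last : p K = I.t₁
  q_zero : q 0 = I.s₂
  q_last : q L = I.t₂
  p_adj : ∀ i < K, I.Adj (p i) (p (i + 1))
  q_adj : ∀ j < L, I.Adj (q j) (q (j + 1))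
  p_x : ∀ i ≤ K, I.x (p i) = I.x I.s₁ + i
  q_y : ∀ j ≤ L, I.y (q j) = I.y I.s₂ + j
  disj : ∀ i ≤ K, ∀ j ≤ L, p i ≠ q j
  no_pass : ∀ i < K, ∀ j < L, ¬ (I.x (p i) = I.x (q (j + 1)) ∧ I.y (p i) = I.y (q (j + 1)) ∧
    I.x (p (i + 1)) = I.x (q j) ∧ I.y (p (i + 1)) = I.y (q j))

variable {I}

section

variable {p q : ℕ → ℕ} {K L : ℕ}

theorem Sol.p_g_mono (hI : I.Valid) (h : I.Sol p q K L) {i i' : ℕ} (hi : i ≤ i') (hi' : i' ≤ K) :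
    I.g (p i) ≤ I.g (p i') := by
  induction i', hi using Nat.le_induction with
  | base => exact le_rfl
  | succ k hk ih =>
    have h2 := h.p_x k (by omega)
    have h3 := h.p_x (k + 1) (by omega)
    have h4 := hI.y_lip _ _ (h.p_adj k (by omega)).symm
    have h5 := ih (by omega)
    unfold g at *
    omega

theorem Sol.q_g_mono (hI : I.Valid) (h : I.Sol p q K L) {j j' : ℕ} (hj : j ≤ j') (hj' : j' ≤ L) :
    I.g (q j) ≤ I.g (q j') := by
  induction j', hj using Nat.le_induction with
  | base => exact le_rfl
  | succ k hk ih =>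
    have h2 := h.q_y k (by omega)
    have h3 := h.q_y (k + 1) (by omega)
    have h4 := hI.x_lip _ _ (h.q_adj k (by omega)).symm
    have h5 := ih (by omega)
    unfold g at *
    omega

theorem Sol.p_eq_t₁ (h : I.Sol p q K L) {i : ℕ} (hi : i ≤ K) (he : p i = I.t₁) : i = K := by
  have h1 := h.p_x i hi
  have h2 := h.p_x K le_rfl
  rw [he] at h1
  rw [h.p_last] at h2
  omega

theorem Sol.q_eq_t₂ (h : I.Sol p q K L) {j : ℕ} (hj : j ≤ L) (he : q j = I.t₂) : j = L := by
  have h1 := h.q_y j hj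
  have h2 := h.q_y L le_rfl
  rw [he] at h1
  rw [h.q_last] at h2
  omega

/-- On a common level, the first path does not overtake the second one if the latter has turned
towards it. -/
theorem Sol.not_overtake (hI : I.Valid) (h : I.Sol p q K L) {i₀ i j₀ j : ℕ} (hi : i₀ < i)
    (hiK : i ≤ K) (hj : j₀ < j) (hjL : j ≤ L) (h1 : I.g (p i₀) = I.g (q j₀))
    (h2 : I.g (p i) = I.g (p i₀)) (h3 : I.g (q j) = I.g (q j₀)) (h4 : I.x (p i₀) < I.x (q j₀)) :
    I.x (p i) ≤ I.x (q j) := by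
  by_contra! hlt
  have hp : ∀ k, i₀ ≤ k → k ≤ i → I.g (p k) = I.g (p i₀) := fun k hk hk' =>
    le_antisymm (h2 ▸ h.p_g_mono hI hk' hiK) (h.p_g_mono hI hk (hk'.trans hiK))
  have hq : ∀ k, j₀ ≤ k → k ≤ j → I.g (q k) = I.g (q j₀) := fun k hk hk' =>
    le_antisymm (h3 ▸ h.q_g_mono hI hk' hjL) (h.q_g_mono hI hk (hk'.trans hjL))
  have a1 := h.p_x i₀ (by omega)
  have a2 := h.p_x i hiK
  have b1 := h.q_y j₀ (by omega)
  have b2 := h.q_y j hjL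
  have c1 : I.x (q j₀) + I.y (q j₀) = I.x (p i₀) + I.y (p i₀) := h1.symm
  have c2 : I.x (q j) + I.y (q j) = I.x (q j₀) + I.y (q j₀) := h3
  have c3 : I.x (p i) + I.y (p i) = I.x (p i₀) + I.y (p i₀) := h2
  -- On the level the first path covers all `x` from `x (p i₀)` to `x (p i)`, the second all from `x
  -- (q j₀)` down to `x (q j)`. If the claim fails, both ranges contain `c` and `c + 1`; step `k` of
  -- the first path goes from `c` to `c + 1`, step `l` of the second from `c + 1` to `c`, so they
  -- pass.
  obtain ⟨c, hc⟩ : ∃ c, c = max (I.x (p i₀)) (I.x (q j)) := ⟨_, rfl⟩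
  obtain ⟨k, hk⟩ : ∃ k, k = c - I.x I.s₁ := ⟨_, rfl⟩
  obtain ⟨l, hl⟩ : ∃ l, l + (c + 1) + I.y I.s₂ = I.x (q j₀) + I.y (q j₀) :=
    ⟨I.x (q j₀) + I.y (q j₀) - (c + 1) - I.y I.s₂, by omega⟩
  have d1 := h.p_x k (by omega)
  have d2 := h.p_x (k + 1) (by omega)
  have d3 := h.q_y l (by omega)
  have d4 := h.q_y (l + 1) (by omega)
  have e1 := hp k (by omega) (by omega)
  have e2 := hp (k + 1) (by omega) (by omega)
  have e3 := hq l (by omega) (by omega)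
  have e4 := hq (l + 1) (by omega) (by omega)
  unfold g at e1 e2 e3 e4
  exact h.no_pass k (by omega) l (by omega) (by omega)

variable (I) in
/-- The situation after the first `i` steps of the path `p` and the first `j` steps of the path `q`
if these steps have been made in a suitable order. -/
structure Follows (p q : ℕ → ℕ) (K L i j : ℕ) (s : Conf) : Prop where
  le₁ : i ≤ K
  le₂ : j ≤ L
  u : s.u = p i
  v : s.v = q j
  leave : s.l = 0 ∨ (j < L ∧ I.g (q j) < I.g (q (j + 1)))
  turned : s.k = 0 ∨ ∃ i₀ ≤ i, ∃ j₀ < j, I.g (p i₀) = I.g (q j₀) ∧ I.g (p i) = I.g (p i₀) ∧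
    I.g (q j) = I.g (q j₀) ∧ I.x (p i₀) < I.x (q j₀)

/-- At a tie the first path waits until the next step of the second one leaves the level; this is
the promise that `leave` must keep for `l = 1`. The condition on `k` is met because of
`not_overtake`, applied to the indices stored in `turned`. -/
theorem Follows.step₁ (hI : I.Valid) (h : I.Sol p q K L) {i j : ℕ} {s : Conf}
    (hs : I.Follows p q K L i j s) (hi : i < K) (hle : I.h₁ (p i) ≤ I.h₂ (q j))
    (hl : I.h₁ (p i) = I.h₂ (q j) → j < L ∧ I.g (q j) < I.g (q (j + 1))) :
    ∃ s', I.Step s s' ∧ I.Follows p q K L (i + 1) j s' := by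
  have hu := hs.u
  have hv := hs.v
  have h1 := h.p_x i hi.le
  have h2 := h.p_x (i + 1) hi
  refine ⟨I.next₁ s (p (i + 1)), Or.inl ⟨_, hu ▸ h.p_adj i hi, ?_, rfl⟩, ?_⟩
  · unfold Move₁
    rw [hu, hv]
    refine ⟨fun he => hi.ne (h.p_eq_t₁ hi.le he), h.disj _ hi _ hs.le₂, hle, by omega, fun hg => ?_⟩
    refine hs.turned.imp_right ?_
    rintro ⟨i₀, hi₀, j₀, hj₀, e1, e2, e3, e4⟩
    exact h.not_overtake hI (by omega) hi hj₀ hs.le₂ e1 (hg.trans e2) e3 e4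
  · constructor
    · exact hi
    · exact hs.le₂
    · rfl
    · exact hv
    · simp only [next₁, hu, hv]
      split_ifs with ht
      · exact Or.inr (hl ht)
      · exact Or.inl rfl
    · simp only [next₁, hu]
      split_ifs with hg
      · refine hs.turned.imp_right ?_
        rintro ⟨i₀, hi₀, j₀, hj₀, e1, e2, e3, e4⟩
        exact ⟨i₀, by omega, j₀, hj₀, e1, hg.trans e2, e3, e4⟩
      · exact Or.inl rfl

/-- When `k` is switched on, the current indices `i`, `j` become the witnesses for `turned`;
otherwise the old ones persist as long as the level does. -/
theorem Follows.step₂ (hI : I.Valid) (h : I.Sol p q K L) {i j : ℕ} {s : Conf}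
    (hs : I.Follows p q K L i j s) (hj : j < L) (hle : I.h₂ (q j) ≤ I.h₁ (p i))
    (hl : I.h₁ (p i) = I.h₂ (q j) → I.g (q (j + 1)) = I.g (q j)) :
    ∃ s', I.Step s s' ∧ I.Follows p q K L i (j + 1) s' := by
  have hu := hs.u
  have hv := hs.v
  have h1 := h.q_y j hj.le
  have h2 := h.q_y (j + 1) hj
  have hvt : q j ≠ I.t₂ := fun he => hj.ne (h.q_eq_t₂ hj.le he)
  refine ⟨I.next₂ s (q (j + 1)), Or.inr ⟨_, hv ▸ h.q_adj j hj, ?_, rfl⟩, ?_⟩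
  · unfold Move₂
    rw [hu, hv]
    refine ⟨hvt, (h.disj _ hs.le₁ _ hj).symm, hle, by omega, ?_⟩
    split_ifs with hg
    · rcases hs.leave with h3 | h3
      · exact h3
      · omega
    · exact fun he => hg (hl he)
  · constructor
    · exact hs.le₁
    · exact hj
    · exact hu
    · rfl
    · exact Or.inl rfl
    · simp only [next₂, hu, hv]
      have old : I.g (q (j + 1)) = I.g (q j) → s.k = 0 ∨ ∃ i₀ ≤ i, ∃ j₀ < j + 1,
          I.g (p i₀) = I.g (q j₀) ∧ I.g (p i) = I.g (p i₀) ∧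
          I.g (q (j + 1)) = I.g (q j₀) ∧ I.x (p i₀) < I.x (q j₀) := by
        intro hg
        refine hs.turned.imp_right ?_
        rintro ⟨i₀, hi₀, j₀, hj₀, e1, e2, e3, e4⟩
        exact ⟨i₀, hi₀, j₀, by omega, e1, e2, hg.trans e3, e4⟩
      split_ifs with hg ht hx
      · refine Or.inr ⟨i, le_rfl, j, by omega, ?_, rfl, hg, hx⟩
        -- The value `4 * n` of a completed path exceeds all levels, so a tie with an incomplete
        -- second path is a tie of true levels.
        have h5 := hI.g_lt (hI.adj_lt (h.q_adj j hj)).1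
        unfold h₁ h₂ at ht
        rw [if_neg hvt] at ht
        split_ifs at ht
        · omega
        · exact ht
      · exact old hg
      · exact old hg
      · exact Or.inl rfl

/-- The schedule: the lower head moves; at a tie the second path moves as long as it stays on the
level, and otherwise the first path does. -/
theorem Follows.step (hI : I.Valid) (h : I.Sol p q K L) {i j : ℕ} {s : Conf}
    (hs : I.Follows p q K L i j s) (hij : i < K ∨ j < L) :
    ∃ s' i' j', I.Step s s' ∧ I.Follows p q K L i' j' s' ∧ i' + j' = i + j + 1 := by
  have hpn : p i < I.n := by
    rcases Nat.lt_or_ge i K with hi | hi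
    · exact (hI.adj_lt (h.p_adj i hi)).1
    · rw [le_antisymm hs.le₁ hi, h.p_last]
      exact hI.t₁_lt
  have hqn : q j < I.n := by
    rcases Nat.lt_or_ge j L with hj | hj
    · exact (hI.adj_lt (h.q_adj j hj)).1
    · rw [le_antisymm hs.le₂ hj, h.q_last]
      exact hI.t₂_lt
  have hp4 := hI.g_lt hpn
  have hq4 := hI.g_lt hqn
  have hp : (i < K ∧ I.h₁ (p i) = I.g (p i)) ∨ (i = K ∧ I.h₁ (p i) = 4 * I.n) := by
    rcases Nat.lt_or_ge i K with hi | hi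
    · exact Or.inl ⟨hi, if_neg fun he => hi.ne (h.p_eq_t₁ hi.le he)⟩
    · have := le_antisymm hs.le₁ hi
      exact Or.inr ⟨this, if_pos (this ▸ h.p_last)⟩
  have hq : (j < L ∧ I.h₂ (q j) = I.g (q j)) ∨ (j = L ∧ I.h₂ (q j) = 4 * I.n) := by
    rcases Nat.lt_or_ge j L with hj | hj
    · exact Or.inl ⟨hj, if_neg fun he => hj.ne (h.q_eq_t₂ hj.le he)⟩
    · have := le_antisymm hs.le₂ hj
      exact Or.inr ⟨this, if_pos (this ▸ h.q_last)⟩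
  rcases lt_trichotomy (I.h₁ (p i)) (I.h₂ (q j)) with hlt | heq | hlt
  · obtain ⟨s', h1, h2⟩ := hs.step₁ hI h (by omega) hlt.le (fun he => absurd he hlt.ne)
    exact ⟨s', _, _, h1, h2, by omega⟩
  -- A tie with a completed second path would have value `4 * n`, and then the first path would be
  -- complete too.
  · have hj : j < L := by omega
    by_cases hg : I.g (q (j + 1)) = I.g (q j)
    · obtain ⟨s', h1, h2⟩ := hs.step₂ hI h hj heq.ge (fun _ => hg)
      exact ⟨s', _, _, h1, h2, by omega⟩
    · have := h.q_g_mono hI (Nat.le_succ j) hj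
      obtain ⟨s', h1, h2⟩ := hs.step₁ hI h (by omega) heq.le
        (fun _ => ⟨hj, lt_of_le_of_ne this (Ne.symm hg)⟩)
      exact ⟨s', _, _, h1, h2, by omega⟩
  · obtain ⟨s', h1, h2⟩ := hs.step₂ hI h (by omega) hlt.le (fun he => absurd he hlt.ne')
    exact ⟨s', _, _, h1, h2, by omega⟩

/-- Every set of configurations that contains the start and is closed under steps contains a
complete configuration if there are two paths as in `Inst.Sol`. -/
theorem Sol.exists_conf (hI : I.Valid) (h : I.Sol p q K L) (S : Conf → Prop) (h0 : S I.start)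
    (hS : ∀ s s', S s → I.Step s s' → S s') : ∃ s, S s ∧ s.u = I.t₁ ∧ s.v = I.t₂ := by
  have key : ∀ d i j s, S s → I.Follows p q K L i j s → d + i + j = K + L →
      ∃ s, S s ∧ s.u = I.t₁ ∧ s.v = I.t₂ := by
    intro d
    induction d with
    | zero =>
      intro i j s hs hf hd
      have h1 := hf.le₁
      have h2 := hf.le₂
      obtain rfl : i = K := by omega
      obtain rfl : j = L := by omega
      exact ⟨s, hs, hf.u.trans h.p_last, hf.v.trans h.q_last⟩
    | succ d ih =>
      intro i j s hs hf hd
      obtain ⟨s', i', j', h1, h2, h3⟩ := hf.step hI h (by omega)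
      exact ih i' j' s' (hS s s' hs h1) h2 (by omega)
  exact key (K + L) 0 0 I.start h0
    ⟨Nat.zero_le _, Nat.zero_le _, h.p_zero.symm, h.q_zero.symm, Or.inl rfl, Or.inl rfl⟩ rfl

end

end Inst

/-! ### A program logic with running times -/

/-- A bound for the number of steps of a program without loops. -/
def cost : Prog → ℕ
  | .skip => 1
  | .instr _ => 1
  | .seq P Q => cost P + cost Q
  | .branch _ P Q => 1 + (cost P + cost Q)
  | .loop _ _ => 0

/-- The weakest precondition of a program without loops. -/
def wp (W : ℕ) : Prog → (State → Prop) → State → Prop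
  | .skip, Q, σ => Q σ
  | .instr i, Q, σ => i.val σ < W ∧ Q (i.run σ)
  | .seq P R, Q, σ => wp W P (wp W R Q) σ
  | .branch c P R, Q, σ => (c.Holds σ → wp W P Q σ) ∧ (¬ c.Holds σ → wp W R Q σ)
  | .loop _ _, _, _ => False

/-- Started in `σ`, the program `P` halts after at most `T` steps in a state with the property
`Q`. -/
def Spec (W : ℕ) (P : Prog) (σ : State) (T : ℕ) (Q : State → Prop) : Prop :=
  ∃ σ' τ, Exec W P σ σ' τ ∧ τ ≤ T ∧ Q σ'

section

variable {W : ℕ}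

theorem Spec.of_wp {P : Prog} {σ : State} {Q : State → Prop} (h : wp W P Q σ) :
    Spec W P σ (cost P) Q := by
  induction P generalizing σ Q with
  | skip => exact ⟨σ, 1, .skip σ, le_rfl, h⟩
  | instr i => exact ⟨i.run σ, 1, .instr i σ h.1, le_rfl, h.2⟩
  | seq P R ih₁ ih₂ =>
    obtain ⟨σ₁, τ₁, h₁, l₁, h⟩ := ih₁ h
    obtain ⟨σ₂, τ₂, h₂, l₂, h⟩ := ih₂ h
    exact ⟨σ₂, _, .seq h₁ h₂, add_le_add l₁ l₂, h⟩
  | branch c P R ih₁ ih₂ =>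
    by_cases hc : c.Holds σ
    · obtain ⟨σ₁, τ₁, h₁, l₁, h⟩ := ih₁ (h.1 hc)
      exact ⟨σ₁, _, .branchTrue hc h₁, by simp only [cost]; omega, h⟩
    · obtain ⟨σ₁, τ₁, h₁, l₁, h⟩ := ih₂ (h.2 hc)
      exact ⟨σ₁, _, .branchFalse hc h₁, by simp only [cost]; omega, h⟩
  | loop => exact h.elim

theorem wp_mono {P : Prog} {σ : State} {Q R : State → Prop} (h : wp W P Q σ)
    (hQR : ∀ σ, Q σ → R σ) : wp W P R σ := by
  induction P generalizing σ Q R with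
  | skip => exact hQR _ h
  | instr i => exact ⟨h.1, hQR _ h.2⟩
  | seq P S ih₁ ih₂ => exact ih₁ h fun _ h' => ih₂ h' hQR
  | branch c P S ih₁ ih₂ => exact ⟨fun hc => ih₁ (h.1 hc) hQR, fun hc => ih₂ (h.2 hc) hQR⟩
  | loop => exact h

theorem Spec.mono {P : Prog} {σ : State} {T T' : ℕ} {Q R : State → Prop} (h : Spec W P σ T Q)
    (hT : T ≤ T') (hQR : ∀ σ, Q σ → R σ) : Spec W P σ T' R := by
  obtain ⟨σ', τ, h1, h2, h3⟩ := h
  exact ⟨σ', τ, h1, h2.trans hT, hQR _ h3⟩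

theorem Spec.seq {P S : Prog} {σ : State} {T T' : ℕ} {Q R : State → Prop} (h : Spec W P σ T Q)
    (h' : ∀ σ, Q σ → Spec W S σ T' R) : Spec W (.seq P S) σ (T + T') R := by
  obtain ⟨σ₁, τ₁, h1, h2, h3⟩ := h
  obtain ⟨σ₂, τ₂, k1, k2, k3⟩ := h' σ₁ h3
  exact ⟨σ₂, _, .seq h1 k1, add_le_add h2 k2, k3⟩

theorem Spec.branch {c : Test} {P S : Prog} {σ : State} {T : ℕ} {R : State → Prop}
    (h : c.Holds σ → Spec W P σ T R) (h' : ¬ c.Holds σ → Spec W S σ T R) :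
    Spec W (.branch c P S) σ (1 + T) R := by
  by_cases hc : c.Holds σ
  · obtain ⟨σ₁, τ₁, h1, h2, h3⟩ := h hc
    exact ⟨σ₁, _, .branchTrue hc h1, by omega, h3⟩
  · obtain ⟨σ₁, τ₁, h1, h2, h3⟩ := h' hc
    exact ⟨σ₁, _, .branchFalse hc h1, by omega, h3⟩

/-- The rule for loops whose number of rounds is bounded by a variant `k`. -/
theorem Spec.loop {c : Test} {P : Prog} {T : ℕ} (Inv : ℕ → State → Prop)
    (h : ∀ k σ, Inv k σ → c.Holds σ → Spec W P σ T fun σ' => ∃ k' < k, Inv k' σ') (k : ℕ)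
    (σ : State) (hσ : Inv k σ) :
    Spec W (.loop c P) σ (k * (T + 1) + 1) fun σ' => ¬ c.Holds σ' ∧ ∃ k' ≤ k, Inv k' σ' := by
  induction k using Nat.strong_induction_on generalizing σ with
  | _ k ih =>
    by_cases hc : c.Holds σ
    · obtain ⟨σ₁, τ₁, h1, h2, k', hk, h3⟩ := h k σ hσ hc
      obtain ⟨σ₂, τ₂, e1, e2, e3, k'', hk'', e4⟩ := ih k' hk σ₁ h3
      refine ⟨σ₂, _, .loopTrue hc h1 e1, ?_, e3, k'', hk''.trans hk.le, e4⟩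
      have : (k' + 1) * (T + 1) ≤ k * (T + 1) := Nat.mul_le_mul_right _ hk
      rw [Nat.succ_mul] at this
      omega
    · exact ⟨σ, 1, .loopFalse hc, by omega, hc, k, le_rfl, hσ⟩

/-- The rule for loops with `N` rounds. -/
theorem Spec.for {c : Test} {P : Prog} {T N : ℕ} (Inv : ℕ → State → Prop)
    (hc : ∀ i ≤ N, ∀ σ, Inv i σ → (c.Holds σ ↔ i < N))
    (h : ∀ i < N, ∀ σ, Inv i σ → Spec W P σ T (Inv (i + 1))) {σ : State} (hσ : Inv 0 σ) :
    Spec W (.loop c P) σ (N * (T + 1) + 1) (Inv N) := by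
  -- The variant is the number of rounds left.
  refine (Spec.loop (fun k σ => k ≤ N ∧ Inv (N - k) σ) ?_ N σ ⟨le_rfl, by simpa using hσ⟩).mono
    le_rfl ?_
  · rintro k σ ⟨hk, hi⟩ hh
    have h1 := (hc _ (Nat.sub_le _ _) σ hi).1 hh
    refine (h _ h1 σ hi).mono le_rfl fun σ' h' => ⟨k - 1, by omega, by omega, ?_⟩
    rwa [show N - (k - 1) = N - k + 1 by omega]
  · rintro σ ⟨h1, k, hk, -, h2⟩
    have : ¬ N - k < N := fun h => h1 ((hc _ (Nat.sub_le _ _) σ h2).2 h)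
    rcases Nat.eq_zero_or_pos k with rfl | h0
    · exact h2
    · rwa [show N - k = N by omega] at h2

@[simp] theorem wp_skip {Q : State → Prop} {σ : State} : wp W .skip Q σ ↔ Q σ := Iff.rfl

@[simp] theorem wp_instr {i : Instr} {Q : State → Prop} {σ : State} :
    wp W (.instr i) Q σ ↔ i.val σ < W ∧ Q (i.run σ) := Iff.rfl

@[simp] theorem wp_seq {P R : Prog} {Q : State → Prop} {σ : State} :
    wp W (.seq P R) Q σ ↔ wp W P (wp W R Q) σ := Iff.rfl

@[simp] theorem wp_branch {c : Test} {P R : Prog} {Q : State → Prop} {σ : State} :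
    wp W (.branch c P R) Q σ ↔ (c.Holds σ → wp W P Q σ) ∧ (¬ c.Holds σ → wp W R Q σ) := Iff.rfl

/-- The instructions of a list, one after the other. -/
def block : List Instr → Prog
  | [] => .skip
  | i :: l => .seq (.instr i) (block l)

@[simp] theorem wp_block_nil {Q : State → Prop} {σ : State} : wp W (block []) Q σ ↔ Q σ := Iff.rfl

@[simp] theorem wp_block_cons {i : Instr} {l : List Instr} {Q : State → Prop} {σ : State} :
    wp W (block (i :: l)) Q σ ↔ i.val σ < W ∧ wp W (block l) Q (i.run σ) := Iff.rfl

end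

/-- A sequence of programs. -/
def progs : List Prog → Prog
  | [] => .skip
  | P :: l => .seq P (progs l)

@[simp] theorem wp_progs_nil {W : ℕ} {Q : State → Prop} {σ : State} :
    wp W (progs []) Q σ ↔ Q σ := Iff.rfl

@[simp] theorem wp_progs_cons {W : ℕ} {P : Prog} {l : List Prog} {Q : State → Prop} {σ : State} :
    wp W (progs (P :: l)) Q σ ↔ wp W P (wp W (progs l) Q) σ := Iff.rfl

/-! ### Layout of registers and memory -/

/-- The registers below `16` hold the parameters of the instance and the addresses of the arrays:
the coordinates, the two paths of the output, the marks of the configurations, the queue. -/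
structure Ctx (I : Inst) (ρ : ℕ → ℕ) : Prop where
  r0 : ρ 0 = I.n
  r1 : ρ 1 = I.m
  r2 : ρ 2 = I.s₁
  r3 : ρ 3 = I.t₁
  r4 : ρ 4 = I.s₂
  r5 : ρ 5 = I.t₂
  r6 : ρ 6 = 0
  r7 : ρ 7 = 1
  r8 : ρ 8 = 2 * I.m
  r9 : ρ 9 = 2 * I.m + I.n
  r10 : ρ 10 = 2 * I.m + 2 * I.n
  r11 : ρ 11 = 2 * I.m + 4 * I.n
  r12 : ρ 12 = 2 * I.m + 6 * I.n
  r13 : ρ 13 = 2 * I.m + 6 * I.n + 4 * (I.n * I.n)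
  r14 : ρ 14 = 4 * I.n
  r15 : ρ 15 = 4 * (I.n * I.n)

theorem Ctx.congr {I : Inst} {ρ ρ' : ℕ → ℕ} (h : Ctx I ρ) (h' : ∀ r < 16, ρ' r = ρ r) :
    Ctx I ρ' := by
  constructor <;> rw [h' _ (by norm_num)]
  exacts [h.r0, h.r1, h.r2, h.r3, h.r4, h.r5, h.r6, h.r7, h.r8, h.r9, h.r10, h.r11, h.r12, h.r13,
    h.r14, h.r15]

/-- The edges are stored in the first memory cells. -/
def Edges (I : Inst) (μ : ℕ → ℕ) : Prop :=
  ∀ j < I.m, μ (2 * j) = I.src j ∧ μ (2 * j + 1) = I.dst j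

/-- The sizes of the numbers that occur in an instance. -/
structure Bounds (I : Inst) (W : ℕ) : Prop where
  two_le : 2 ≤ I.n
  m_le : I.m ≤ I.n * I.n
  le_W : 64 * (I.n * I.n) ≤ W
  src_lt : ∀ j < I.m, I.src j < I.n
  dst_lt : ∀ j < I.m, I.dst j < I.n

theorem Bounds.n_le {I : Inst} {W : ℕ} (h : Bounds I W) : 2 * I.n ≤ I.n * I.n :=
  Nat.mul_le_mul_right _ h.two_le

/-! ### Distances -/

/-- `b` is reachable from `a` by a walk of length `k`. -/
inductive HasWalk (I : Inst) (a : ℕ) : ℕ → ℕ → Prop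
  | nil : HasWalk I a a 0
  | snoc {b c k : ℕ} : HasWalk I a b k → I.Adj b c → HasWalk I a c (k + 1)

/-- `d` has the values computed from the walks of length at most `r` and, for the first `j` edges,
from those of length `r + 1` that end with such an edge. -/
structure DistInv (I : Inst) (s r j : ℕ) (d : ℕ → ℕ) : Prop where
  zero : d s = 0
  le : ∀ v < I.n, d v ≤ I.n
  walk : ∀ v < I.n, d v < I.n → HasWalk I s v (d v)
  low : ∀ v k, HasWalk I s v k → k ≤ r → d v ≤ k
  edge : ∀ i < j, ∀ k ≤ r, (HasWalk I s (I.src i) k → d (I.dst i) ≤ k + 1) ∧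
    (HasWalk I s (I.dst i) k → d (I.src i) ≤ k + 1)

/-- The relaxation step of Bellman and Ford. -/
def relaxed (d : ℕ → ℕ) (a b : ℕ) : ℕ → ℕ :=
  if d a + 1 < d b then Function.update d b (d a + 1) else d

theorem relaxed_le (d : ℕ → ℕ) (a b v : ℕ) : relaxed d a b v ≤ d v := by
  unfold relaxed
  split_ifs with h
  · by_cases hv : v = b
    · subst hv; simpa using h.le
    · simp [hv]
  · exact le_rfl

theorem relaxed_self_le (d : ℕ → ℕ) (a b : ℕ) : relaxed d a b b ≤ d a + 1 := by
  unfold relaxed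
  split_ifs with h
  · simp
  · omega

theorem DistInv.relaxed {I : Inst} {s r j : ℕ} {d : ℕ → ℕ} (h : DistInv I s r j d) {a b : ℕ}
    (ha : a < I.n) (hab : I.Adj a b) : DistInv I s r j (relaxed d a b) := by
  have hle := relaxed_le d a b
  refine ⟨by have := hle s; have := h.zero; omega, fun v hv => (hle v).trans (h.le v hv), ?_,
    fun v k hw hk => (hle v).trans (h.low v k hw hk), fun i hi k hk =>
    ⟨fun hw => (hle _).trans ((h.edge i hi k hk).1 hw),
      fun hw => (hle _).trans ((h.edge i hi k hk).2 hw)⟩⟩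
  intro v hv
  unfold TwoDSP.relaxed
  split_ifs with hlt
  · by_cases hvb : v = b
    · subst hvb
      simp only [Function.update_self]
      intro h1
      exact .snoc (h.walk a ha (by omega)) hab
    · simpa [hvb] using h.walk v hv
  · exact h.walk v hv

theorem DistInv.next_edge {I : Inst} {s r j : ℕ} {d : ℕ → ℕ} (h : DistInv I s r j d) (hj : j < I.m)
    (hs : I.src j < I.n) (hd : I.dst j < I.n) :
    DistInv I s r (j + 1)
      (TwoDSP.relaxed (TwoDSP.relaxed d (I.src j) (I.dst j)) (I.dst j) (I.src j)) := by
  have h1 : I.Adj (I.src j) (I.dst j) := ⟨j, hj, Or.inl ⟨rfl, rfl⟩⟩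
  have h2 := (h.relaxed hs h1).relaxed hd h1.symm
  refine ⟨h2.zero, h2.le, h2.walk, h2.low, fun i hi k hk => ?_⟩
  rcases Nat.lt_succ_iff_lt_or_eq.1 hi with hi | rfl
  · exact h2.edge i hi k hk
  · refine ⟨fun hw => ?_, fun hw => ?_⟩
    · have := h.low _ _ hw hk
      have := relaxed_self_le d (I.src i) (I.dst i)
      have := relaxed_le (TwoDSP.relaxed d (I.src i) (I.dst i)) (I.dst i) (I.src i) (I.dst i)
      omega
    · have := h.low _ _ hw hk
      have := relaxed_le d (I.src i) (I.dst i) (I.dst i)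
      have := relaxed_self_le (TwoDSP.relaxed d (I.src i) (I.dst i)) (I.dst i) (I.src i)
      omega

/-- The last edge of a nontrivial walk is in the list, in one of its two orientations, and has been
relaxed in this round. -/
theorem DistInv.next_round {I : Inst} {s r : ℕ} {d : ℕ → ℕ} (h : DistInv I s r I.m d) :
    DistInv I s (r + 1) 0 d := by
  refine ⟨h.zero, h.le, h.walk, fun v k hw hk => ?_, fun i hi => absurd hi (Nat.not_lt_zero i)⟩
  cases hw with
  | nil => exact h.zero.le
  | snoc hw hadj =>
    obtain ⟨i, hi, ⟨rfl, rfl⟩ | ⟨rfl, rfl⟩⟩ := hadj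
    · exact (h.edge i hi _ (by omega)).1 hw
    · exact (h.edge i hi _ (by omega)).2 hw

theorem DistInv.init {I : Inst} {s : ℕ} {d : ℕ → ℕ} (h0 : d s = 0)
    (h1 : ∀ v < I.n, v ≠ s → d v = I.n) : DistInv I s 0 0 d := by
  refine ⟨h0, fun v hv => ?_, fun v hv hlt => ?_, fun v k hw hk => ?_,
    fun i hi => absurd hi (Nat.not_lt_zero i)⟩
  · by_cases h : v = s
    · rw [h, h0]; omega
    · rw [h1 v hv h]
  · by_cases h : v = s
    · subst h; rw [h0]; exact .nil
    · rw [h1 v hv h] at hlt; omega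
  · cases hw with
    | nil => exact h0.le
    | snoc => omega

/-- The default `n` of unreached vertices does no harm: a value below `n` at `a` comes from a walk,
whose extension to `b` has length at most `n` and has been accounted for. -/
theorem DistInv.lip {I : Inst} {s : ℕ} {d : ℕ → ℕ} (h : DistInv I s I.n 0 d) {a b : ℕ}
    (ha : a < I.n) (hb : b < I.n) (hab : I.Adj a b) : d b ≤ d a + 1 := by
  by_cases hlt : d a < I.n
  · exact h.low b _ (.snoc (h.walk a ha hlt) hab) hlt
  · have := h.le b hb; omega

/-- `d b := min (d b) (d a + 1)`, where the registers `16`, `20`, `21` hold the address of `d` and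
`a`, `b`. -/
def relaxP : Prog := progs [
  block [.add 40 16 20, .load 41 40, .add 41 41 7, .add 40 16 21, .load 42 40],
  .branch (.lt 41 42) (.instr (.store 40 41)) .skip]

theorem wp_relaxP {W a b base : ℕ} {σ : State} {Q : State → Prop} (h7 : σ.reg 7 = 1)
    (h16 : σ.reg 16 = base) (ha : σ.reg 20 = a) (hb : σ.reg 21 = b) (haW : base + a < W)
    (hbW : base + b < W) (hd : σ.mem (base + a) + 1 < W) (hd' : σ.mem (base + b) < W)
    (hQ : ∀ σ', (∀ r < 40, σ'.reg r = σ.reg r) →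
      (fun v => σ'.mem (base + v)) = relaxed (fun v => σ.mem (base + v)) a b →
      (∀ c, c ≠ base + b → σ'.mem c = σ.mem c) → Q σ') : wp W relaxP Q σ := by
  have hd0 : σ.mem (base + a) < W := by omega
  simp [relaxP, Instr.val, Instr.run, Test.Holds, *]
  refine ⟨fun h => hQ _ ?_ ?_ ?_, fun h => hQ _ ?_ ?_ ?_⟩
  · intro r hr
    simp [show r ≠ 40 by omega, show r ≠ 41 by omega, show r ≠ 42 by omega]
  · simp [relaxed, h]
    ext v
    simp [Function.update_apply]
  · intro c hc
    simp [hc]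
  · intro r hr
    simp [show r ≠ 40 by omega, show r ≠ 41 by omega, show r ≠ 42 by omega]
  · have : ¬ σ.mem (base + a) + 1 < σ.mem (base + b) := by omega
    simp [relaxed, this]
  · intro c hc
    rfl

/-- Load the ends of the edge whose number is in register `19`. -/
def loadEdgeP : Prog :=
  block [.add 40 19 19, .load 20 40, .add 40 40 7, .load 21 40]

def swapEdgeP : Prog := block [.copy 40 20, .copy 20 21, .copy 21 40]

/-- Writes to the array at the address in register `16` the distances from the vertex in register
`17`. -/
def distP : Prog := progs [
  block [.const 19 0],
  .loop (.lt 19 0) (block [.add 40 16 19, .store 40 0, .add 19 19 7]),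
  block [.add 40 16 17, .store 40 6, .const 18 0],
  .loop (.lt 18 0) (progs [
    block [.const 19 0],
    .loop (.lt 19 1) (progs [loadEdgeP, relaxP, swapEdgeP, relaxP, block [.add 19 19 7]]),
    block [.add 18 18 7]])]

/-- The distance array at the address `base` is being computed; other cells are unchanged. -/
structure DistState (I : Inst) (base s : ℕ) (μ : ℕ → ℕ) (σ : State) : Prop where
  ctx : Ctx I σ.reg
  r16 : σ.reg 16 = base
  r17 : σ.reg 17 = s
  frame : ∀ c, c < base ∨ base + I.n ≤ c → σ.mem c = μ c

theorem DistState.congr {I : Inst} {base s : ℕ} {μ : ℕ → ℕ} {σ σ' : State}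
    (h : DistState I base s μ σ) (hr : ∀ r < 18, σ'.reg r = σ.reg r)
    (hm : ∀ c, c < base ∨ base + I.n ≤ c → σ'.mem c = σ.mem c) : DistState I base s μ σ' :=
  ⟨h.ctx.congr fun r hr' => hr r (by omega), (hr 16 (by norm_num)).trans h.r16,
    (hr 17 (by norm_num)).trans h.r17, fun c hc => (hm c hc).trans (h.frame c hc)⟩

section

variable {I : Inst} {W base s : ℕ} {μ : ℕ → ℕ}

theorem wp_distP_edge (hB : Bounds I W) (hE : Edges I μ) (hb : 2 * I.m ≤ base)
    (hbW : base + 2 * I.n < W) {r j : ℕ} (hj : j < I.m) {σ : State} (h : DistState I base s μ σ)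
    (hd : DistInv I s r j fun v => σ.mem (base + v)) (h18 : σ.reg 18 = r) (h19 : σ.reg 19 = j) :
    wp W (progs [loadEdgeP, relaxP, swapEdgeP, relaxP, block [.add 19 19 7]]) (fun σ' =>
      DistState I base s μ σ' ∧ (DistInv I s r (j + 1) fun v => σ'.mem (base + v)) ∧
      σ'.reg 18 = r ∧ σ'.reg 19 = j + 1) σ := by
  obtain ⟨e1, e2⟩ := hE j hj
  have hs := hB.src_lt j hj
  have ht := hB.dst_lt j hj
  rw [← h.frame _ (by omega)] at e1 e2
  have e2' : σ.mem (j + j + 1) = I.dst j := by rw [← two_mul]; exact e2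
  have e1' : σ.mem (j + j) = I.src j := by rw [← two_mul]; exact e1
  have h7 := h.ctx.r7
  have h16 := h.r16
  have l1 := hd.le _ hs
  have l2 := hd.le _ ht
  simp only [wp_progs_cons, loadEdgeP]
  simp [Instr.val, Instr.run, h7, h19, e1', e2']
  refine ⟨by omega, by omega, by omega, by omega, ?_⟩
  refine wp_relaxP (a := I.src j) (b := I.dst j) (base := base) ?_ ?_ ?_ ?_ ?_ ?_ ?_ ?_ ?_
    <;> (try simp [*]) <;> (try omega)
  intro σ₁ hr₁ hm₁ hf₁
  have f1 : ∀ v, σ₁.mem (base + v) ≤ σ.mem (base + v) := fun v => by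
    have := congrFun hm₁ v
    exact this.trans_le (relaxed_le _ _ _ v)
  have g1 := f1 (I.src j)
  have g2 := f1 (I.dst j)
  have k7 := hr₁ 7 (by norm_num)
  have k16 := hr₁ 16 (by norm_num)
  have k18 := hr₁ 18 (by norm_num)
  have k19 := hr₁ 19 (by norm_num)
  have k20 := hr₁ 20 (by norm_num)
  have k21 := hr₁ 21 (by norm_num)
  simp at k7 k16 k18 k19 k20 k21
  simp [swapEdgeP, Instr.val, Instr.run, k20, k21]
  refine ⟨by omega, by omega, by omega, ?_⟩
  refine wp_relaxP (a := I.dst j) (b := I.src j) (base := base) ?_ ?_ ?_ ?_ ?_ ?_ ?_ ?_ ?_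
    <;> (try simp [*]) <;> (try omega)
  intro σ₂ hr₂ hm₂ hf₂
  have q7 := hr₂ 7 (by norm_num)
  have q18 := hr₂ 18 (by norm_num)
  have q19 := hr₂ 19 (by norm_num)
  simp only [Function.update_apply] at q7 q18 q19
  norm_num at q7 q18 q19
  simp [Instr.val, Instr.run, q7, q18, q19, k7, k18, k19, h18, h19, h7]
  refine ⟨by omega, h.congr ?_ ?_, ?_⟩
  · intro r hr
    have a1 := hr₁ r (by omega)
    have a2 := hr₂ r (by omega)
    simp only [Function.update_of_ne (show r ≠ 40 by omega),
      Function.update_of_ne (show r ≠ 20 by omega),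
      Function.update_of_ne (show r ≠ 21 by omega)] at a1 a2
    simp only
    rw [Function.update_of_ne (by omega), a2, a1]
  · intro c hc
    simp only
    rw [hf₂ c (by omega), hf₁ c (by omega)]
  · rw [hm₂]
    exact hd.next_edge hj hs ht

theorem spec_distP (hB : Bounds I W) (hb : 2 * I.m ≤ base)
    (hbW : base + 2 * I.n < W) (hs : s < I.n) {σ : State} (hE : Edges I σ.mem)
    (hctx : Ctx I σ.reg) (h16 : σ.reg 16 = base) (h17 : σ.reg 17 = s) :
    Spec W distP σ (100 * (I.n * (I.m + 1))) fun σ' => Ctx I σ'.reg ∧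
      (DistInv I s I.n 0 fun v => σ'.mem (base + v)) ∧
      ∀ c, c < base ∨ base + I.n ≤ c → σ'.mem c = σ.mem c := by
  have hn := hB.two_le
  have hW := hB.le_W
  have hn2 := hB.n_le
  obtain ⟨μ, hμ⟩ : ∃ μ, μ = σ.mem := ⟨_, rfl⟩
  have hEμ : Edges I μ := hμ ▸ hE
  have h0 : DistState I base s μ σ := ⟨hctx, h16, h17, fun c _ => by rw [hμ]⟩
  rw [← hμ]
  unfold distP
  have e : Spec W (block [.const 19 0]) σ 2 (fun σ => DistState I base s μ σ ∧ σ.reg 19 = 0) := by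
    refine Spec.of_wp ?_
    simp [Instr.val, Instr.run]
    exact ⟨by omega, h0.congr (fun r hr => by simp [show r ≠ 19 by omega]) (by simp)⟩
  refine Spec.mono
    (T := 2 + (I.n * 5 + 1 + (4 + ((I.n * ((2 + ((I.m * 41 + 1) + 3)) + 1) + 1) + 1))))
    (e.seq fun σ ⟨h, h19⟩ => Spec.seq (T := I.n * 5 + 1) (Q := fun σ => DistState I base s μ σ ∧
    ∀ v < I.n, σ.mem (base + v) = I.n) ?_ ?_) ?_ fun σ h => h
  · refine (Spec.for (N := I.n) (T := 4) (fun i σ => DistState I base s μ σ ∧ σ.reg 19 = i ∧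
      ∀ v < i, σ.mem (base + v) = I.n) ?_ ?_ ⟨h, h19, by simp⟩).mono le_rfl
      fun σ h => ⟨h.1, h.2.2⟩
    · rintro i - σ ⟨h, h19, -⟩
      simp [Test.Holds, h.ctx.r0, h19]
    · rintro i hi σ ⟨h, h19, h2⟩
      refine Spec.of_wp ?_
      simp [Instr.val, Instr.run, h.ctx.r0, h.ctx.r7, h.r16, h19]
      refine ⟨by omega, by omega, by omega, h.congr ?_ ?_, ?_⟩
      · intro r hr
        simp [show r ≠ 19 by omega, show r ≠ 40 by omega]
      · intro c hc
        simp only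
        rw [Function.update_of_ne (by omega)]
      · intro v hv
        by_cases hvi : v = i
        · simp [hvi]
        · rw [Function.update_of_ne (by omega), h2 v (by omega)]
  · rintro σ ⟨h, h2⟩
    have e : Spec W (block [.add 40 16 17, .store 40 6, .const 18 0]) σ 4 (fun σ =>
        DistState I base s μ σ ∧ (DistInv I s 0 0 fun v => σ.mem (base + v)) ∧ σ.reg 18 = 0) := by
      refine Spec.of_wp ?_
      simp [Instr.val, Instr.run, h.ctx.r6, h.r16, h.r17]
      refine ⟨by omega, by omega, h.congr ?_ ?_, .init (by simp) ?_⟩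
      · intro r hr
        simp [show r ≠ 18 by omega, show r ≠ 40 by omega]
      · intro c hc
        simp only
        rw [Function.update_of_ne (by omega)]
      · intro v hv hvs
        rw [Function.update_of_ne (by omega), h2 v hv]
    refine e.seq fun σ h3 => ?_
    refine Spec.seq (T' := 1) (Spec.for (N := I.n) (T := 2 + ((I.m * 41 + 1) + 3)) (fun r σ =>
      DistState I base s μ σ ∧ (DistInv I s r 0 fun v => σ.mem (base + v)) ∧ σ.reg 18 = r)
      ?_ ?_ h3) fun σ h => Spec.of_wp ?_
    · rintro i - σ ⟨h, -, h18⟩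
      simp [Test.Holds, h.ctx.r0, h18]
    · rintro r hr σ ⟨h, hd, h18⟩
      have e : Spec W (block [.const 19 0]) σ 2 (fun σ => DistState I base s μ σ ∧
          (DistInv I s r 0 fun v => σ.mem (base + v)) ∧ σ.reg 18 = r ∧ σ.reg 19 = 0) := by
        refine Spec.of_wp ?_
        simp [Instr.val, Instr.run, hd, h18]
        exact ⟨by omega, h.congr (fun r hr => by simp [show r ≠ 19 by omega]) (by simp)⟩
      refine e.seq fun σ h3 => ?_
      refine Spec.seq (Spec.for (N := I.m) (T := 40) (fun j σ => DistState I base s μ σ ∧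
        (DistInv I s r j fun v => σ.mem (base + v)) ∧ σ.reg 18 = r ∧ σ.reg 19 = j) ?_ ?_ h3)
        fun σ h => Spec.of_wp ?_
      · rintro i - σ ⟨h, -, -, h19⟩
        simp [Test.Holds, h.ctx.r1, h19]
      · rintro j hj σ ⟨h, hd, h18, h19⟩
        exact (Spec.of_wp (wp_distP_edge hB hEμ hb hbW hj h hd h18 h19)).mono (by decide)
          fun σ h => h
      · obtain ⟨h, hd, h18, -⟩ := h
        simp [Instr.val, Instr.run, h.ctx.r7, h18]
        exact ⟨by omega, h.congr (fun r hr => by simp [show r ≠ 18 by omega]) (by simp),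
          hd.next_round⟩
    · simp only [wp_progs_nil]
      exact ⟨h.1.ctx, h.2.1, h.1.frame⟩
  · nlinarith

end

/-! ### The search: data structures -/

/-- The number of a configuration. -/
def code (I : Inst) (s : Conf) : ℕ :=
  s.u * I.n + s.v + (s.u * I.n + s.v) + s.l + (s.u * I.n + s.v + (s.u * I.n + s.v) + s.l) + s.k

def Conf.Ok (I : Inst) (s : Conf) : Prop := s.u < I.n ∧ s.v < I.n ∧ s.l < 2 ∧ s.k < 2

theorem mul_add_lt {a b n : ℕ} (ha : a < n) (hb : b < n) : a * n + b < n * n := by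
  have : (a + 1) * n ≤ n * n := Nat.mul_le_mul_right _ ha
  rw [Nat.succ_mul] at this
  omega

theorem code_lt {I : Inst} {s : Conf} (h : s.Ok I) : code I s < 4 * (I.n * I.n) := by
  have := mul_add_lt h.1 h.2.1
  have := h.2.2
  unfold code
  omega

/-- The code is `4 * (u * n + v) + 2 * l + k`, spelled out with the doublings that the program
performs; its mixed-radix digits can be read off. -/
theorem code_inj {I : Inst} {s s' : Conf} (h : s.Ok I) (h' : s'.Ok I)
    (he : code I s = code I s') : s = s' := by
  obtain ⟨h1, h2, h3, h4⟩ := h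
  obtain ⟨k1, k2, k3, k4⟩ := h'
  unfold code at he
  have e1 : s.u * I.n + s.v = s'.u * I.n + s'.v := by omega
  have e2 : s.l = s'.l := by omega
  have e3 : s.k = s'.k := by omega
  have e4 : s.v = s'.v := by
    have := congrArg (· % I.n) e1
    simpa [Nat.mul_add_mod', Nat.mod_eq_of_lt h2, Nat.mod_eq_of_lt k2] using this
  have e5 : s.u * I.n = s'.u * I.n := by omega
  have e6 : s.u = s'.u := Nat.eq_of_mul_eq_mul_right (by omega) e5
  ext <;> assumption

/-- Edges and coordinates are stored in memory. -/
structure Arrays (I : Inst) (μ : ℕ → ℕ) : Prop where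
  edges : Edges I μ
  x : ∀ v < I.n, μ (2 * I.m + v) = I.x v
  y : ∀ v < I.n, μ (2 * I.m + I.n + v) = I.y v

theorem Arrays.congr {I : Inst} {μ μ' : ℕ → ℕ} (h : Arrays I μ)
    (h' : ∀ c < 2 * I.m + 2 * I.n, μ' c = μ c) : Arrays I μ' := by
  refine ⟨fun j hj => ?_, fun v hv => ?_, fun v hv => ?_⟩
  · rw [h' _ (by omega), h' _ (by omega)]
    exact h.edges j hj
  · rw [h' _ (by omega)]
    exact h.x v hv
  · rw [h' _ (by omega)]
    exact h.y v hv

/-- The queue `L` of configurations and numbers of their predecessors is stored in memory. -/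
def Queue (I : Inst) (L : List (Conf × ℕ)) (μ : ℕ → ℕ) : Prop :=
  ∀ h s p, L[h]? = some (s, p) →
    μ (5 * h + (2 * I.m + 6 * I.n + 4 * (I.n * I.n))) = s.u ∧
    μ (5 * h + (2 * I.m + 6 * I.n + 4 * (I.n * I.n)) + 1) = s.v ∧
    μ (5 * h + (2 * I.m + 6 * I.n + 4 * (I.n * I.n)) + 2) = s.l ∧
    μ (5 * h + (2 * I.m + 6 * I.n + 4 * (I.n * I.n)) + 3) = s.k ∧
    μ (5 * h + (2 * I.m + 6 * I.n + 4 * (I.n * I.n)) + 4) = p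

/-- The configurations in the queue `L` are marked. -/
def Marks (I : Inst) (L : List (Conf × ℕ)) (μ : ℕ → ℕ) : Prop :=
  ∀ s : Conf, s.Ok I → (s ∈ L.map Prod.fst ∧ μ (code I s + (2 * I.m + 6 * I.n)) = 1) ∨
    (s ∉ L.map Prod.fst ∧ μ (code I s + (2 * I.m + 6 * I.n)) = 0)

/-- The queue consists of configurations that can be reached from the start. -/
structure Run (I : Inst) (L : List (Conf × ℕ)) : Prop where
  ok : ∀ e ∈ L, e.1.Ok I
  nodup : (L.map Prod.fst).Nodup
  parent : ∀ h s p, L[h]? = some (s, p) → (h = 0 ∧ s = I.start) ∨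
    (p < h ∧ ∃ s₀ p₀, L[p]? = some (s₀, p₀) ∧ I.Step s₀ s)

/-- Number `0` can mean failure because entry `0` of the queue is the start, which is never
complete. -/
def Found (I : Inst) (L : List (Conf × ℕ)) (f : ℕ) : Prop :=
  (f = 0 ∧ ∀ e ∈ L, ¬ (e.1.u = I.t₁ ∧ e.1.v = I.t₂)) ∨
    (0 < f ∧ ∃ s p, L[f]? = some (s, p) ∧ s.u = I.t₁ ∧ s.v = I.t₂)

structure Search (I : Inst) (L : List (Conf × ℕ)) (head : ℕ) (σ : State) : Prop where
  ctx : Ctx I σ.reg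
  arrays : Arrays I σ.mem
  queue : Queue I L σ.mem
  marks : Marks I L σ.mem
  run : Run I L
  r16 : σ.reg 16 = head
  r17 : σ.reg 17 = L.length
  found : Found I L (σ.reg 18)

theorem Search.congr {I : Inst} {L : List (Conf × ℕ)} {head : ℕ} {σ σ' : State}
    (h : Search I L head σ) (hr : ∀ r < 19, σ'.reg r = σ.reg r) (hm : σ'.mem = σ.mem) :
    Search I L head σ' := by
  refine ⟨h.ctx.congr fun r hr' => hr r (by omega), hm ▸ h.arrays, hm ▸ h.queue, hm ▸ h.marks,
    h.run, ?_, ?_, ?_⟩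
  · rw [hr _ (by norm_num), h.r16]
  · rw [hr _ (by norm_num), h.r17]
  · rw [hr _ (by norm_num)]; exact h.found

section

variable {I : Inst} {L : List (Conf × ℕ)}

/-- Entries have distinct codes below `4 * n ^ 2`. This bounds the rounds of the search, the memory
and the size of addresses. -/
theorem Run.length_le (h : Run I L) : L.length ≤ 4 * (I.n * I.n) := by
  have h1 : (L.map fun e => code I e.1).Nodup := by
    have h2 := h.nodup
    rw [List.nodup_map_iff_inj_on (List.Nodup.of_map _ h2)]
    intro e he e' he' hee
    exact List.inj_on_of_nodup_map h2 he he' (code_inj (h.ok e he) (h.ok e' he') hee)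
  have h3 : (L.map fun e => code I e.1).toFinset ⊆ Finset.range (4 * (I.n * I.n)) := by
    intro c hc
    simp only [List.mem_toFinset, List.mem_map] at hc
    obtain ⟨e, he, rfl⟩ := hc
    exact Finset.mem_range.2 (code_lt (h.ok e he))
  have h4 := Finset.card_le_card h3
  rwa [List.toFinset_card_of_nodup h1, List.length_map, Finset.card_range] at h4

theorem getElem?_snoc {α : Type*} {L : List α} {e e' : α} {h : ℕ}
    (he : (L ++ [e])[h]? = some e') : L[h]? = some e' ∨ (h = L.length ∧ e' = e) := by
  rcases Nat.lt_or_ge h L.length with hlt | hge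
  · rw [List.getElem?_append_left hlt] at he
    exact Or.inl he
  · rw [List.getElem?_append_right hge] at he
    rcases Nat.eq_zero_or_pos (h - L.length) with h0 | h0
    · rw [h0] at he
      simp at he
      exact Or.inr ⟨by omega, he.symm⟩
    · rw [List.getElem?_eq_none (by simp; omega)] at he
      simp at he

theorem Run.snoc (h : Run I L) {s : Conf} {p : ℕ} (hs : s.Ok I) (hn : s ∉ L.map Prod.fst)
    (hp : (L = [] ∧ s = I.start) ∨ ∃ s₀ p₀, L[p]? = some (s₀, p₀) ∧ I.Step s₀ s) :
    Run I (L ++ [(s, p)]) := by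
  refine ⟨?_, ?_, ?_⟩
  · intro e he
    rcases List.mem_append.1 he with he | he
    · exact h.ok e he
    · rw [List.mem_singleton.1 he]; exact hs
  · rw [List.map_append, List.nodup_append]
    refine ⟨h.nodup, by simp, ?_⟩
    simp only [List.map_cons, List.map_nil, List.mem_singleton, forall_eq]
    rintro a ha rfl
    exact hn ha
  · intro i s' p' he
    have lift : ∀ {j : ℕ} {e : Conf × ℕ}, L[j]? = some e → (L ++ [(s, p)])[j]? = some e := by
      intro j e hj
      rw [List.getElem?_append_left (List.getElem?_eq_some_iff.1 hj).1, hj]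
    rcases getElem?_snoc he with he | ⟨rfl, hsp⟩
    · refine (h.parent i s' p' he).imp_right ?_
      rintro ⟨h1, s₀, p₀, h2, h3⟩
      exact ⟨h1, s₀, p₀, lift h2, h3⟩
    · obtain ⟨rfl, rfl⟩ := Prod.mk.inj hsp
      rcases hp with ⟨rfl, rfl⟩ | ⟨s₀, p₀, h2, h3⟩
      · exact Or.inl ⟨rfl, rfl⟩
      · exact Or.inr ⟨(List.getElem?_eq_some_iff.1 h2).1, s₀, p₀, lift h2, h3⟩

theorem Queue.snoc {μ μ' : ℕ → ℕ} (h : Queue I L μ) {s : Conf} {p : ℕ}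
    (h0 : μ' (5 * L.length + (2 * I.m + 6 * I.n + 4 * (I.n * I.n))) = s.u)
    (h1 : μ' (5 * L.length + (2 * I.m + 6 * I.n + 4 * (I.n * I.n)) + 1) = s.v)
    (h2 : μ' (5 * L.length + (2 * I.m + 6 * I.n + 4 * (I.n * I.n)) + 2) = s.l)
    (h3 : μ' (5 * L.length + (2 * I.m + 6 * I.n + 4 * (I.n * I.n)) + 3) = s.k)
    (h4 : μ' (5 * L.length + (2 * I.m + 6 * I.n + 4 * (I.n * I.n)) + 4) = p)
    (hf : ∀ c, 2 * I.m + 6 * I.n + 4 * (I.n * I.n) ≤ c →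
      c < 5 * L.length + (2 * I.m + 6 * I.n + 4 * (I.n * I.n)) → μ' c = μ c) :
    Queue I (L ++ [(s, p)]) μ' := by
  intro i s' p' he
  rcases getElem?_snoc he with he | ⟨rfl, hsp⟩
  · have hi := (List.getElem?_eq_some_iff.1 he).1
    rw [hf _ (by omega) (by omega), hf _ (by omega) (by omega), hf _ (by omega) (by omega),
      hf _ (by omega) (by omega), hf _ (by omega) (by omega)]
    exact h i s' p' he
  · obtain ⟨rfl, rfl⟩ := Prod.mk.inj hsp
    exact ⟨h0, h1, h2, h3, h4⟩

theorem Marks.snoc {μ μ' : ℕ → ℕ} (h : Marks I L μ) {s : Conf} {p : ℕ} (hs : s.Ok I)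
    (h0 : μ' (code I s + (2 * I.m + 6 * I.n)) = 1)
    (hf : ∀ c, c ≠ code I s → c < 4 * (I.n * I.n) →
      μ' (c + (2 * I.m + 6 * I.n)) = μ (c + (2 * I.m + 6 * I.n))) :
    Marks I (L ++ [(s, p)]) μ' := by
  intro s' hs'
  by_cases hss : s' = s
  · subst hss
    exact Or.inl ⟨by simp, h0⟩
  · have h1 := h s' hs'
    rw [← hf _ (fun he => hss (code_inj hs' hs he)) (code_lt hs')] at h1
    have h2 : s' ∈ (L ++ [(s, p)]).map Prod.fst ↔ s' ∈ L.map Prod.fst := by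
      simp [List.map_append, hss]
    rwa [h2]

/-- The mark `0` shows that `s` is new. Marks and queue lie above the edges and coordinates, and the
new entry occupies five cells behind the old queue. -/
theorem Search.push {head : ℕ} {σ σ' : State} {s : Conf} {q : ℕ} (h : Search I L head σ)
    (hs : s.Ok I) (hL : L = [] → I.s₁ ≠ I.t₁)
    (hp : (L = [] ∧ s = I.start) ∨ ∃ s₀ p₀, L[head]? = some (s₀, p₀) ∧ I.Step s₀ s)
    (hq : q = 5 * L.length + (2 * I.m + 6 * I.n + 4 * (I.n * I.n)))
    (h0 : σ.mem (code I s + (2 * I.m + 6 * I.n)) = 0)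
    (hr : ∀ r < 17, σ'.reg r = σ.reg r) (h17 : σ'.reg 17 = L.length + 1)
    (h18 : (s.u = I.t₁ ∧ s.v = I.t₂ ∧ σ'.reg 18 = L.length) ∨
      (¬ (s.u = I.t₁ ∧ s.v = I.t₂) ∧ σ'.reg 18 = σ.reg 18))
    (hm : σ'.mem = Function.update (Function.update (Function.update (Function.update
      (Function.update (Function.update σ.mem (code I s + (2 * I.m + 6 * I.n)) 1) q s.u)
      (q + 1) s.v) (q + 1 + 1) s.l) (q + 1 + 1 + 1) s.k) (q + 1 + 1 + 1 + 1) head) :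
    Search I (L ++ [(s, head)]) head σ' := by
  have hcode := code_lt hs
  have hn : s ∉ L.map Prod.fst := by
    rcases h.marks s hs with h1 | h1
    · omega
    · exact h1.1
  have hf : ∀ c, c ≠ code I s + (2 * I.m + 6 * I.n) → c < q → σ'.mem c = σ.mem c := by
    intro c h1 h2
    rw [hm]
    iterate 6 rw [Function.update_of_ne (by omega)]
  refine ⟨h.ctx.congr fun r hr' => hr r (by omega), h.arrays.congr fun c hc =>
    hf c (by omega) (by omega), h.queue.snoc ?_ ?_ ?_ ?_ ?_ fun c h1 h2 =>
    hf c (by omega) (by omega),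
    h.marks.snoc hs ?_ fun c h1 h2 => hf _ (by omega) (by omega), h.run.snoc hs hn hp,
    (hr _ (by norm_num)).trans h.r16, by simp [h17], ?_⟩
  · rw [hm, ← hq]
    iterate 4 rw [Function.update_of_ne (by omega)]
    exact Function.update_self ..
  · rw [hm, ← hq]
    iterate 3 rw [Function.update_of_ne (by omega)]
    exact Function.update_self ..
  · rw [hm, ← hq]
    iterate 2 rw [Function.update_of_ne (by omega)]
    exact Function.update_self ..
  · rw [hm, ← hq]
    rw [Function.update_of_ne (by omega)]
    exact Function.update_self ..
  · rw [hm, ← hq]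
    exact Function.update_self ..
  · rw [hm]
    iterate 5 rw [Function.update_of_ne (by omega)]
    exact Function.update_self ..
  · rcases h18 with ⟨h1, h2, h3⟩ | ⟨h1, h3⟩
    · rw [h3]
      refine Or.inr ⟨?_, s, head, by simp, h1, h2⟩
      -- The recorded number is positive: only the start is put into an empty queue, and the start
      -- is not complete.
      rcases List.eq_nil_or_concat L with h4 | ⟨L', e, h4⟩
      · rcases hp with ⟨-, rfl⟩ | ⟨s₀, p₀, h5, -⟩
        · exact absurd h1 (hL h4)
        · simp [h4] at h5
      · simp [h4]
    · rw [h3]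
      rcases h.found with ⟨h4, h5⟩ | ⟨h4, s', p', h5, h6⟩
      · refine Or.inl ⟨h4, fun e he => ?_⟩
        rcases List.mem_append.1 he with he | he
        · exact h5 e he
        · rw [List.mem_singleton.1 he]; exact h1
      · refine Or.inr ⟨h4, s', p', ?_, h6⟩
        rw [List.getElem?_append_left (List.getElem?_eq_some_iff.1 h5).1, h5]

end

/-- Put the configuration in the registers `34`, …, `37` into the queue unless it is marked. -/
def pushP : Prog := progs [
  block [.mul 40 34 0, .add 40 40 35, .add 40 40 40, .add 40 40 36, .add 40 40 40, .add 40 40 37,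
    .add 40 40 12, .load 41 40],
  .branch (.eq 41 6)
    (progs [
      block [.store 40 7, .add 42 17 17, .add 42 42 42, .add 42 42 17, .add 42 42 13, .store 42 34,
        .add 42 42 7, .store 42 35, .add 42 42 7, .store 42 36, .add 42 42 7, .store 42 37,
        .add 42 42 7, .store 42 16],
      .branch (.eq 34 3) (.branch (.eq 35 5) (.instr (.copy 18 17)) .skip) .skip,
      block [.add 17 17 7]])
    .skip]

theorem wp_pushP {I : Inst} {L : List (Conf × ℕ)} {W head : ℕ} {σ : State} {s : Conf}
    (hB : Bounds I W) (hL : L = [] → I.s₁ ≠ I.t₁) (h : Search I L head σ) (hs : s.Ok I)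
    (hhead : head ≤ L.length) (h34 : σ.reg 34 = s.u) (h35 : σ.reg 35 = s.v)
    (h36 : σ.reg 36 = s.l) (h37 : σ.reg 37 = s.k)
    (hp : (L = [] ∧ s = I.start) ∨ ∃ s₀ p₀, L[head]? = some (s₀, p₀) ∧ I.Step s₀ s) :
    wp W pushP (fun σ' => ∃ L', L <+: L' ∧ Search I L' head σ' ∧ s ∈ L'.map Prod.fst ∧
      ∀ r, 19 ≤ r → r < 40 → σ'.reg r = σ.reg r) σ := by
  have hn := hB.two_le
  have hW := hB.le_W
  have hn2 := hB.n_le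
  have hm := hB.m_le
  have hlen := h.run.length_le
  have hcode := code_lt hs
  have hcode' := hcode
  have huv := mul_add_lt hs.1 hs.2.1
  obtain ⟨s1, s2, s3, s4⟩ := hs
  have hc := h.ctx
  have hc' : s.u * I.n + s.v + (s.u * I.n + s.v) + s.l + (s.u * I.n + s.v + (s.u * I.n + s.v) + s.l)
    + s.k = code I s := rfl
  unfold code at hcode'
  have hok : s.Ok I := ⟨s1, s2, s3, s4⟩
  have hT : L.length + L.length + (L.length + L.length) + L.length +
    (2 * I.m + 6 * I.n + 4 * (I.n * I.n)) =
    5 * L.length + (2 * I.m + 6 * I.n + 4 * (I.n * I.n)) := by omega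
  have hmark : σ.mem (code I s + (2 * I.m + 6 * I.n)) < W := by
    rcases h.marks s ⟨s1, s2, s3, s4⟩ with h | h <;> omega
  simp [pushP, Instr.val, Instr.run, Test.Holds, h34, h35, h36, h37, hc.r0, hc.r12, hc.r6, hc.r7,
    hc.r13, hc.r3, hc.r5, hc', h.r17, h.r16, hmark, hT]
  have key : σ.mem (code I s + (2 * I.m + 6 * I.n)) = 0 → ∀ σ', _ := fun h0 σ' =>
    h.push (σ' := σ') hok hL hp rfl h0
  have hs' : ∃ x, (s, x) ∈ L ++ [(s, head)] := ⟨head, by simp⟩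
  refine ⟨by omega, by omega, by omega, by omega, by omega, by omega, by omega, fun h0 =>
    ⟨by omega, by omega, by omega, by omega, by omega, by omega, by omega, by omega, by omega,
      by omega, by omega, by omega, by omega, by omega,
      fun h1 => ⟨fun h2 => ⟨by omega, by omega, ?_⟩,
      fun h2 => ⟨by omega, ?_⟩⟩, fun h1 => ⟨by omega, ?_⟩⟩, fun h0 => ?_⟩
  · refine ⟨L ++ [(s, head)], by simp,
      key h0 _ ?_ (by simp) (Or.inl ⟨h1, h2, by simp⟩) rfl, hs', ?_⟩
    · intro r hr
      simp only
      iterate 5 rw [Function.update_of_ne (by omega)]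
    · intro r hr hr'
      iterate 5 rw [Function.update_of_ne (by omega)]
  · refine ⟨L ++ [(s, head)], by simp,
      key h0 _ ?_ (by simp) (Or.inr ⟨fun h => h2 h.2, by simp⟩) rfl,
      hs', ?_⟩
    · intro r hr
      simp only
      iterate 4 rw [Function.update_of_ne (by omega)]
    · intro r hr hr'
      iterate 4 rw [Function.update_of_ne (by omega)]
  · refine ⟨L ++ [(s, head)], by simp,
      key h0 _ ?_ (by simp) (Or.inr ⟨fun h => h1 h.1, by simp⟩) rfl,
      hs', ?_⟩
    · intro r hr
      simp only
      iterate 4 rw [Function.update_of_ne (by omega)]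
    · intro r hr hr'
      iterate 4 rw [Function.update_of_ne (by omega)]
  · refine ⟨L, by simp, h.congr ?_ rfl, ?_, ?_⟩
    · intro r hr
      simp only
      iterate 2 rw [Function.update_of_ne (by omega)]
    · rcases h.marks s hok with h1 | h1
      · simpa using h1.1
      · exact absurd h1.2 h0
    · intro r hr hr'
      iterate 2 rw [Function.update_of_ne (by omega)]

/-! ### The search: moves -/

/-- The registers `22`, …, `30` describe the configuration `s`. -/
structure Head (I : Inst) (s : Conf) (ρ : ℕ → ℕ) : Prop where
  r22 : ρ 22 = s.u
  r23 : ρ 23 = s.v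
  r24 : ρ 24 = s.l
  r25 : ρ 25 = s.k
  r26 : ρ 26 = I.h₁ s.u
  r27 : ρ 27 = I.h₂ s.v
  r28 : ρ 28 = I.x s.u
  r29 : ρ 29 = I.x s.v
  r30 : ρ 30 = I.y s.v

theorem Head.congr {I : Inst} {s : Conf} {ρ ρ' : ℕ → ℕ} (h : Head I s ρ)
    (h' : ∀ r, 22 ≤ r → r < 31 → ρ' r = ρ r) : Head I s ρ' := by
  constructor <;> rw [h' _ (by norm_num) (by norm_num)]
  exacts [h.r22, h.r23, h.r24, h.r25, h.r26, h.r27, h.r28, h.r29, h.r30]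

/-- The edge from `a` to `b` is considered; the registers `31`, `32`, `33` hold the level and the
coordinates of `b`. -/
structure EdgeRegs (I : Inst) (a b : ℕ) (ρ : ℕ → ℕ) : Prop where
  r20 : ρ 20 = a
  r21 : ρ 21 = b
  r31 : ρ 31 = I.g b
  r32 : ρ 32 = I.x b
  r33 : ρ 33 = I.y b

theorem EdgeRegs.congr {I : Inst} {a b : ℕ} {ρ ρ' : ℕ → ℕ} (h : EdgeRegs I a b ρ)
    (h' : ∀ r, 19 ≤ r → r < 34 → ρ' r = ρ r) : EdgeRegs I a b ρ' := by
  constructor <;> rw [h' _ (by norm_num) (by norm_num)]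
  exacts [h.r20, h.r21, h.r31, h.r32, h.r33]

/-- Register `47` tells whether `C` holds; if so, then `s` is in the registers `34`, …, `37`. -/
def Decides (C : Prop) (s : Conf) (ρ : ℕ → ℕ) : Prop :=
  (ρ 47 = 1 ∧ C ∧ ρ 34 = s.u ∧ ρ 35 = s.v ∧ ρ 36 = s.l ∧ ρ 37 = s.k) ∨ (ρ 47 = 0 ∧ ¬ C)

/-- The candidate is assembled before the last tests are made; register `47` stays `0` until all of
them succeed. -/
def cond₁P : Prog := progs [
  block [.const 47 0, .add 46 28 7],
  .branch (.eq 22 20) (.branch (.eq 22 3) .skip (.branch (.eq 21 23) .skip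
    (.branch (.lt 27 26) .skip (.branch (.eq 32 46) (progs [
      block [.copy 34 21, .copy 35 23, .const 36 0, .const 37 0],
      .branch (.eq 26 27) (.instr (.copy 36 7)) .skip,
      .branch (.eq 31 26)
        (.seq (.instr (.copy 37 25)) (.branch (.eq 25 6) (.instr (.const 47 1))
          (.branch (.lt 29 32) .skip (.instr (.const 47 1)))))
        (.instr (.const 47 1))]) .skip)))) .skip]

def cond₂P : Prog := progs [
  block [.const 47 0, .add 46 30 7],
  .branch (.eq 23 20) (.branch (.eq 23 5) .skip (.branch (.eq 21 22) .skip
    (.branch (.lt 26 27) .skip (.branch (.eq 33 46) (progs [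
      block [.copy 34 22, .copy 35 21, .const 36 0, .const 37 0],
      .branch (.eq 31 27)
        (progs [
          block [.copy 37 25],
          .branch (.eq 26 27) (.branch (.lt 28 29) (.instr (.const 37 1)) .skip) .skip,
          .branch (.eq 24 6) (.instr (.const 47 1)) .skip])
        (.branch (.eq 26 27) .skip (.instr (.const 47 1)))]) .skip)))) .skip]

section

variable {I : Inst} {W : ℕ} {s : Conf} {a b : ℕ} {σ : State}

/-- Sizes of the numbers that occur in the tests. -/
structure Small (I : Inst) (W : ℕ) (s : Conf) (b : ℕ) : Prop where
  one_lt : 1 < W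
  x : I.x s.u + 1 < W
  y : I.y s.v + 1 < W
  u : s.u < W
  v : s.v < W
  k : s.k < W
  b : b < W

theorem wp_cond₁P (hW : Small I W s b) (hc : Ctx I σ.reg) (hs : Head I s σ.reg)
    (he : EdgeRegs I a b σ.reg) :
    wp W cond₁P (fun σ' => (∀ r < 34, σ'.reg r = σ.reg r) ∧ σ'.mem = σ.mem ∧
      Decides (s.u = a ∧ I.Move₁ s b) (I.next₁ s b) σ'.reg) σ := by
  obtain ⟨w1, w2, w3, w4, w5, w6, w7⟩ := hW
  have w0 : 0 < W := by omega
  have hr : ∀ r < 34, r ≠ 47 ∧ r ≠ 46 ∧ r ≠ 37 ∧ r ≠ 36 ∧ r ≠ 35 ∧ r ≠ 34 := fun r hr => by omega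
  simp +contextual [cond₁P, Instr.val, Instr.run, Test.Holds, hs.r22, hs.r23, hs.r25, hs.r26,
    hs.r27, hs.r28, hs.r29, he.r20, he.r21, he.r31, he.r32, hc.r3, hc.r6, hc.r7, w0, w1, w2,
    w5, w6, w7, hr, Decides, Inst.Move₁, Inst.next₁]
  intro h1 h2 h3 h4 h5
  -- The program compares the level of `b` with `h₁` of the head; for an incomplete path this is the
  -- level of the head.
  have h6 : I.h₁ a = I.g a := if_neg h2
  rw [h6]
  grind

theorem wp_cond₂P (hW : Small I W s b) (hc : Ctx I σ.reg) (hs : Head I s σ.reg)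
    (he : EdgeRegs I a b σ.reg) :
    wp W cond₂P (fun σ' => (∀ r < 34, σ'.reg r = σ.reg r) ∧ σ'.mem = σ.mem ∧
      Decides (s.v = a ∧ I.Move₂ s b) (I.next₂ s b) σ'.reg) σ := by
  obtain ⟨w1, w2, w3, w4, w5, w6, w7⟩ := hW
  have w0 : 0 < W := by omega
  have hr : ∀ r < 34, r ≠ 47 ∧ r ≠ 46 ∧ r ≠ 37 ∧ r ≠ 36 ∧ r ≠ 35 ∧ r ≠ 34 := fun r hr => by omega
  simp +contextual [cond₂P, Instr.val, Instr.run, Test.Holds, hs.r22, hs.r23, hs.r24, hs.r25,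
    hs.r26, hs.r27, hs.r28, hs.r29, hs.r30, he.r20, he.r21, he.r31, he.r33, hc.r5, hc.r6, hc.r7,
    w0, w1, w3, w4, w6, w7, hr, Decides, Inst.Move₂, Inst.next₂]
  intro h1 h2 h3 h4 h5
  have h6 : I.h₂ a = I.g a := if_neg h2
  rw [h6]
  grind

theorem Small.of_valid (hB : Bounds I W) (hI : I.Valid) (hs : s.Ok I)
    (hb : b < I.n) : Small I W s b := by
  have := hB.two_le
  have := hB.le_W
  have := hB.n_le
  have := hI.x_le _ hs.1
  have := hI.y_le _ hs.2.1
  obtain ⟨_, _, _, _⟩ := hs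
  constructor <;> omega

theorem next₁_ok (hs : s.Ok I) (hb : b < I.n) : (I.next₁ s b).Ok I := by
  refine ⟨hb, hs.2.1, ?_, ?_⟩
  · simp only [Inst.next₁]; split_ifs <;> omega
  · have := hs.2.2.2
    simp only [Inst.next₁]; split_ifs <;> omega

theorem next₂_ok (hs : s.Ok I) (hb : b < I.n) : (I.next₂ s b).Ok I := by
  refine ⟨hs.1, hb, ?_, ?_⟩
  · simp [Inst.next₂]
  · have := hs.2.2.2
    simp only [Inst.next₂]; split_ifs <;> omega

/-- The queue contains the configurations that arise from `s` by moves from `a` to `b`. -/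
def Explored (I : Inst) (L : List (Conf × ℕ)) (s : Conf) (a b : ℕ) : Prop :=
  (s.u = a → I.Move₁ s b → I.next₁ s b ∈ L.map Prod.fst) ∧
    (s.v = a → I.Move₂ s b → I.next₂ s b ∈ L.map Prod.fst)

theorem Explored.mono {L L' : List (Conf × ℕ)} (h : Explored I L s a b) (hL : L <+: L') :
    Explored I L' s a b :=
  ⟨fun h1 h2 => (hL.map Prod.fst).subset (h.1 h1 h2),
    fun h1 h2 => (hL.map Prod.fst).subset (h.2 h1 h2)⟩

theorem getElem?_of_prefix {α : Type*} {L L' : List α} (h : L <+: L') {i : ℕ} {e : α}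
    (he : L[i]? = some e) : L'[i]? = some e := by
  obtain ⟨M, rfl⟩ := h
  rw [List.getElem?_append_left (List.getElem?_eq_some_iff.1 he).1, he]

def condPushP : Prog := .branch (.eq 47 7) pushP .skip

theorem wp_condPushP {L : List (Conf × ℕ)} {head p : ℕ} {s' : Conf} {C : Prop}
    (hB : Bounds I W) (h : Search I L head σ) (hs' : s'.Ok I) (hL : L[head]? = some (s, p))
    (hd : Decides C s' σ.reg) (hC : C → I.Step s s') :
    wp W condPushP (fun σ' => ∃ L', L <+: L' ∧ Search I L' head σ' ∧ (C → s' ∈ L'.map Prod.fst) ∧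
      ∀ r, 19 ≤ r → r < 34 → σ'.reg r = σ.reg r) σ := by
  have h7 := h.ctx.r7
  have hlen := (List.getElem?_eq_some_iff.1 hL).1
  refine ⟨fun hc => ?_, fun hc => ?_⟩
  · have hc : σ.reg 47 = σ.reg 7 := hc
    rcases hd with ⟨h1, h2, h3, h4, h5, h6⟩ | ⟨h1, h2⟩
    · refine wp_mono (wp_pushP hB (fun he => by simp [he] at hL) h hs' hlen.le h3 h4 h5 h6
        (Or.inr ⟨s, p, hL, hC h2⟩)) ?_
      rintro σ' ⟨L', e1, e2, e3, e4⟩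
      exact ⟨L', e1, e2, fun _ => e3, fun r hr hr' => e4 r hr (by omega)⟩
    · omega
  · have hc : ¬ σ.reg 47 = σ.reg 7 := hc
    rcases hd with ⟨h1, h2, h3, h4, h5, h6⟩ | ⟨h1, h2⟩
    · omega
    · exact ⟨L, List.prefix_rfl, h, fun h3 => absurd h3 h2, fun r _ _ => rfl⟩

/-- Try both moves along the edge from `a` to `b`. -/
def exploreP : Prog := progs [
  block [.add 40 8 21, .load 32 40, .add 40 9 21, .load 33 40, .add 31 32 33],
  cond₁P, condPushP, cond₂P, condPushP]

theorem wp_exploreP {L : List (Conf × ℕ)} {head p : ℕ} (hB : Bounds I W) (hI : I.Valid)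
    (h : Search I L head σ) (hL : L[head]? = some (s, p)) (hs : Head I s σ.reg)
    (hab : I.Adj a b) (h20 : σ.reg 20 = a) (h21 : σ.reg 21 = b) :
    wp W exploreP (fun σ' => ∃ L', L <+: L' ∧ Search I L' head σ' ∧ Explored I L' s a b ∧
      ∀ r, 19 ≤ r → r < 31 → σ'.reg r = σ.reg r) σ := by
  have hb := (hI.adj_lt hab).2
  have hok : s.Ok I := h.run.ok _ (List.mem_of_getElem? hL)
  have hW := Small.of_valid hB hI hok hb
  have := hB.two_le
  have := hB.le_W
  have := hB.n_le
  have := hB.m_le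
  have hx := hI.x_le _ hb
  have hy := hI.y_le _ hb
  have l1 := h.arrays.x b hb
  have l2 := h.arrays.y b hb
  simp [exploreP, Instr.val, Instr.run, h21, h.ctx.r8, h.ctx.r9, l1, l2]
  refine ⟨by omega, by omega, by omega, by omega, by omega, ?_⟩
  obtain ⟨σ₀, hσ₀⟩ : ∃ σ₀ : State, σ₀ = ⟨(Function.update (Function.update (Function.update
    (Function.update (Function.update σ.reg 40 (2 * I.m + b)) 32 (I.x b)) 40 (2 * I.m + I.n + b)) 33
    (I.y b)) 31 (I.x b + I.y b)), σ.mem⟩ := ⟨_, rfl⟩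
  rw [← hσ₀]
  have hr₀ : ∀ r < 31, σ₀.reg r = σ.reg r := by
    intro r hr
    rw [hσ₀]
    simp only
    iterate 5 rw [Function.update_of_ne (by omega)]
  have h₀ : Search I L head σ₀ := h.congr (fun r hr => hr₀ r (by omega)) (by rw [hσ₀])
  have hs₀ : Head I s σ₀.reg := hs.congr fun r _ hr => hr₀ r hr
  have he₀ : EdgeRegs I a b σ₀.reg := ⟨(hr₀ _ (by norm_num)).trans h20,
    (hr₀ _ (by norm_num)).trans h21, by simp [hσ₀, Inst.g], by simp [hσ₀], by simp [hσ₀]⟩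
  refine wp_mono (wp_cond₁P hW h₀.ctx hs₀ he₀) ?_
  rintro σ₁ ⟨hr₁, hm₁, hd₁⟩
  have h₁ : Search I L head σ₁ := h₀.congr (fun r hr => hr₁ r (by omega)) hm₁
  rw [wp_progs_cons]
  refine wp_mono (wp_condPushP hB h₁ (next₁_ok hok hb) hL hd₁
    fun h => Or.inl ⟨b, h.1.symm ▸ hab, h.2, rfl⟩) ?_
  rintro σ₂ ⟨L₂, hL₂, h₂, hn₂, hr₂⟩
  have hs₂ : Head I s σ₂.reg := hs₀.congr fun r hr hr' => by
    rw [hr₂ r (by omega) (by omega), hr₁ r (by omega)]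
  have he₂ : EdgeRegs I a b σ₂.reg := he₀.congr fun r hr hr' => by
    rw [hr₂ r (by omega) (by omega), hr₁ r (by omega)]
  rw [wp_progs_cons]
  refine wp_mono (wp_cond₂P hW h₂.ctx hs₂ he₂) ?_
  rintro σ₃ ⟨hr₃, hm₃, hd₃⟩
  have h₃ : Search I L₂ head σ₃ := h₂.congr (fun r hr => hr₃ r (by omega)) hm₃
  rw [wp_progs_cons]
  refine wp_mono (wp_condPushP hB h₃ (next₂_ok hok hb) (getElem?_of_prefix hL₂ hL) hd₃
    fun h => Or.inr ⟨b, h.1.symm ▸ hab, h.2, rfl⟩) ?_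
  rintro σ₄ ⟨L₄, hL₄, h₄, hn₄, hr₄⟩
  rw [wp_progs_nil]
  refine ⟨L₄, hL₂.trans hL₄, h₄, ⟨fun e1 e2 => (hL₄.map Prod.fst).subset (hn₂ ⟨e1, e2⟩),
    fun e1 e2 => hn₄ ⟨e1, e2⟩⟩, fun r hr hr' => ?_⟩
  rw [hr₄ r hr (by omega), hr₃ r (by omega), hr₂ r hr (by omega), hr₁ r (by omega), hr₀ r hr']

/-- Try all moves along the edge whose number is in register `19`. -/
def edgeP : Prog := progs [loadEdgeP, exploreP, swapEdgeP, exploreP, block [.add 19 19 7]]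

theorem wp_edgeP {L : List (Conf × ℕ)} {head p j : ℕ} (hB : Bounds I W) (hI : I.Valid)
    (h : Search I L head σ) (hL : L[head]? = some (s, p)) (hs : Head I s σ.reg)
    (hj : j < I.m) (h19 : σ.reg 19 = j) :
    wp W edgeP (fun σ' => ∃ L', L <+: L' ∧ Search I L' head σ' ∧ Head I s σ'.reg ∧
      σ'.reg 19 = j + 1 ∧ Explored I L' s (I.src j) (I.dst j) ∧
      Explored I L' s (I.dst j) (I.src j)) σ := by
  have := hB.two_le
  have := hB.le_W
  have := hB.n_le
  have := hB.m_le
  have hsrc := hB.src_lt j hj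
  have hdst := hB.dst_lt j hj
  obtain ⟨e1, e2⟩ := h.arrays.edges j hj
  rw [two_mul] at e1 e2
  simp [edgeP, loadEdgeP, Instr.val, Instr.run, h19, h.ctx.r7, e1, e2]
  refine ⟨by omega, by omega, by omega, by omega, ?_⟩
  have hadj : I.Adj (I.src j) (I.dst j) := ⟨j, hj, Or.inl ⟨rfl, rfl⟩⟩
  obtain ⟨σ₀, hσ₀⟩ : ∃ σ₀ : State, σ₀ = ⟨(Function.update (Function.update (Function.update
    (Function.update σ.reg 40 (j + j)) 20 (I.src j)) 40 (j + j + 1)) 21 (I.dst j)),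
    σ.mem⟩ := ⟨_, rfl⟩
  rw [← hσ₀]
  have hr₀ : ∀ r < 40, r ≠ 20 → r ≠ 21 → σ₀.reg r = σ.reg r := by
    intro r hr h1 h2
    rw [hσ₀]
    simp only
    iterate 4 rw [Function.update_of_ne (by omega)]
  have h₀ : Search I L head σ₀ :=
    h.congr (fun r hr => hr₀ r (by omega) (by omega) (by omega)) (by rw [hσ₀])
  have hs₀ : Head I s σ₀.reg :=
    hs.congr fun r _ hr => hr₀ r (by omega) (by omega) (by omega)
  refine wp_mono (wp_exploreP hB hI h₀ hL hs₀ hadj (by simp [hσ₀]) (by simp [hσ₀])) ?_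
  rintro σ₁ ⟨L₁, hL₁, h₁, hx₁, hr₁⟩
  have k20 : σ₁.reg 20 = I.src j := (hr₁ 20 (by norm_num) (by norm_num)).trans (by simp [hσ₀])
  have k21 : σ₁.reg 21 = I.dst j := (hr₁ 21 (by norm_num) (by norm_num)).trans (by simp [hσ₀])
  simp [swapEdgeP, Instr.val, Instr.run, k20, k21]
  refine ⟨by omega, by omega, by omega, ?_⟩
  obtain ⟨σ₂, hσ₂⟩ : ∃ σ₂ : State, σ₂ = ⟨(Function.update (Function.update
    (Function.update σ₁.reg 40 (I.src j)) 20 (I.dst j)) 21 (I.src j)), σ₁.mem⟩ := ⟨_, rfl⟩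
  rw [← hσ₂]
  have hr₂ : ∀ r < 40, r ≠ 20 → r ≠ 21 → σ₂.reg r = σ₁.reg r := by
    intro r hr h1 h2
    rw [hσ₂]
    simp only
    iterate 3 rw [Function.update_of_ne (by omega)]
  have h₂ : Search I L₁ head σ₂ :=
    h₁.congr (fun r hr => hr₂ r (by omega) (by omega) (by omega)) (by rw [hσ₂])
  have hs₂ : Head I s σ₂.reg := hs₀.congr fun r hr hr' => by
    rw [hr₂ r (by omega) (by omega) (by omega), hr₁ r (by omega) hr']
  refine wp_mono (wp_exploreP hB hI h₂ (getElem?_of_prefix hL₁ hL) hs₂ hadj.symm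
    (by simp [hσ₂]) (by simp [hσ₂])) ?_
  rintro σ₃ ⟨L₃, hL₃, h₃, hx₃, hr₃⟩
  have k19 : σ₃.reg 19 = j := by
    rw [hr₃ _ (by norm_num) (by norm_num), hr₂ _ (by norm_num) (by norm_num) (by norm_num),
      hr₁ _ (by norm_num) (by norm_num), hr₀ _ (by norm_num) (by norm_num) (by norm_num), h19]
  simp [Instr.val, Instr.run, k19, h₃.ctx.r7]
  refine ⟨by omega, L₃, hL₁.trans hL₃, h₃.congr ?_ rfl, hs₂.congr ?_, hx₁.mono hL₃, hx₃⟩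
  · intro r hr
    simp only
    rw [Function.update_of_ne (by omega)]
  · intro r hr hr'
    rw [Function.update_of_ne (by omega), hr₃ r (by omega) hr']

end

/-! ### The search: main loop -/

/-- Load the configuration in the queue whose number is in register `16`. -/
def loadHeadP : Prog := progs [
  block [.add 40 16 16, .add 40 40 40, .add 40 40 16, .add 40 40 13, .load 22 40, .add 40 40 7,
    .load 23 40, .add 40 40 7, .load 24 40, .add 40 40 7, .load 25 40, .add 41 8 22, .load 28 41,
    .add 41 9 22, .load 42 41, .add 26 28 42, .add 41 8 23, .load 29 41, .add 41 9 23,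
    .load 30 41, .add 27 29 30],
  .branch (.eq 22 3) (.instr (.copy 26 14)) .skip,
  .branch (.eq 23 5) (.instr (.copy 27 14)) .skip]

/-- Explore the configurations that can be reached from the start. -/
def searchP : Prog := progs [
  block [.const 19 0],
  .loop (.lt 19 15) (block [.add 40 19 12, .store 40 6, .add 19 19 7]),
  block [.const 16 0, .const 17 0, .const 18 0, .copy 34 2, .copy 35 4, .const 36 0, .const 37 0],
  pushP,
  .loop (.lt 16 17) (progs [loadHeadP, block [.const 19 0], .loop (.lt 19 1) edgeP,
    block [.add 16 16 7]])]

section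

variable {I : Inst} {W : ℕ} {σ : State}

theorem wp_loadHeadP {L : List (Conf × ℕ)} {head p : ℕ} {s : Conf} (hB : Bounds I W)
    (hI : I.Valid) (h : Search I L head σ) (hL : L[head]? = some (s, p)) :
    wp W loadHeadP (fun σ' => Search I L head σ' ∧ Head I s σ'.reg) σ := by
  have := hB.two_le
  have := hB.le_W
  have := hB.n_le
  have := hB.m_le
  have hlen := h.run.length_le
  have hlt := (List.getElem?_eq_some_iff.1 hL).1
  obtain ⟨s1, s2, s3, s4⟩ := h.run.ok _ (List.mem_of_getElem? hL)
  obtain ⟨q1, q2, q3, q4, -⟩ := h.queue _ _ _ hL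
  have a1 := h.arrays.x _ s1
  have a2 := h.arrays.y _ s1
  have a3 := h.arrays.x _ s2
  have a4 := h.arrays.y _ s2
  have b1 := hI.x_le _ s1
  have b2 := hI.y_le _ s1
  have b3 := hI.x_le _ s2
  have b4 := hI.y_le _ s2
  simp only at s1 s2 s3 s4 a1 a2 a3 a4 b1 b2 b3 b4
  have hT : head + head + (head + head) + head + (2 * I.m + 6 * I.n + 4 * (I.n * I.n)) =
    5 * head + (2 * I.m + 6 * I.n + 4 * (I.n * I.n)) := by omega
  have hc := h.ctx
  obtain ⟨q, hq⟩ : ∃ q, q = 5 * head + (2 * I.m + 6 * I.n + 4 * (I.n * I.n)) := ⟨_, rfl⟩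
  rw [← hq] at hT q1 q2 q3 q4
  have q3' : σ.mem (q + 1 + 1) = s.l := q3
  have q4' : σ.mem (q + 1 + 1 + 1) = s.k := q4
  have key : ∀ σ' : State, (∀ r < 19, σ'.reg r = σ.reg r) → σ'.mem = σ.mem → Head I s σ'.reg →
      Search I L head σ' ∧ Head I s σ'.reg := fun σ' h1 h2 h3 => ⟨h.congr h1 h2, h3⟩
  simp [loadHeadP, Instr.val, Instr.run, Test.Holds, hc.r3, hc.r5, hc.r7, hc.r8, hc.r9, hc.r13,
    hc.r14, h.r16, hT, q1, q2, q3', q4', a1, a2, a3, a4]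
  refine ⟨by omega, by omega, by omega, by omega, by omega, by omega, by omega, by omega, by omega,
    by omega, by omega, by omega, by omega, by omega, by omega, by omega, by omega, by omega,
    by omega, by omega, by omega,
    fun h1 => ⟨by omega, fun h2 => ⟨by omega, ?_⟩, fun h2 => ?_⟩,
    fun h1 => ⟨fun h2 => ⟨by omega, ?_⟩, fun h2 => ?_⟩⟩
  all_goals
    refine key _ (fun r hr => ?_) rfl ?_
    · simp only
      repeat rw [Function.update_of_ne (by omega)]
    · constructor <;> simp [Inst.h₁, Inst.h₂, Inst.g, h1, h2]

/-- The state of the search when `head` configurations have been treated. -/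
def Searching (I : Inst) (L : List (Conf × ℕ)) (head : ℕ) : Prop :=
  head ≤ L.length ∧ I.start ∈ L.map Prod.fst ∧
    ∀ h < head, ∀ s p, L[h]? = some (s, p) → ∀ s', I.Step s s' → s' ∈ L.map Prod.fst

/-- The queue only grows at its end, so entry `head` and all facts of the form `Explored` survive
later insertions. Trying both orientations of all edges exhausts the steps from `s`. -/
theorem spec_searchP_body {L : List (Conf × ℕ)} {head : ℕ} (hB : Bounds I W) (hI : I.Valid)
    (h : Search I L head σ) (hS : Searching I L head) (hlt : head < L.length) :
    Spec W (progs [loadHeadP, block [.const 19 0], .loop (.lt 19 1) edgeP,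
      block [.add 16 16 7]]) σ (1000 * (I.m + 1)) fun σ' => ∃ L', Search I L' (head + 1) σ' ∧
        Searching I L' (head + 1) := by
  have := hB.two_le
  have := hB.le_W
  have := hB.n_le
  have hlen := h.run.length_le
  obtain ⟨⟨s, p⟩, hL⟩ : ∃ e, L[head]? = some e := ⟨_, List.getElem?_eq_getElem hlt⟩
  refine Spec.mono (T := cost loadHeadP + (2 + ((I.m * (499 + 1) + 1) + 3))) (Spec.seq
    (Q := fun σ => Search I L head σ ∧ Head I s σ.reg) (Spec.of_wp (wp_loadHeadP hB hI h hL))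
    fun σ ⟨h, hs⟩ => Spec.seq (T := 2)
    (Q := fun σ => Search I L head σ ∧ Head I s σ.reg ∧ σ.reg 19 = 0)
    (Spec.of_wp ?_) fun σ ⟨h, hs, h19⟩ => Spec.seq (Spec.for (N := I.m) (T := 499)
    (fun j σ => ∃ L', L <+: L' ∧ Search I L' head σ ∧ Head I s σ.reg ∧ σ.reg 19 = j ∧
      ∀ i < j, Explored I L' s (I.src i) (I.dst i) ∧ Explored I L' s (I.dst i) (I.src i)) ?_ ?_
      ⟨L, List.prefix_rfl, h, hs, h19, by simp⟩) ?_) ?_ fun σ h => h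
  · simp [Instr.val, Instr.run]
    refine ⟨by omega, h.congr (fun r hr => ?_) rfl, hs.congr fun r hr hr' => ?_⟩
    · simp only
      rw [Function.update_of_ne (by omega)]
    · rw [Function.update_of_ne (by omega)]
  · rintro j - σ ⟨L', -, h, -, h19, -⟩
    simp [Test.Holds, h.ctx.r1, h19]
  · rintro j hj σ ⟨L', hL', h, hs, h19, hx⟩
    refine (Spec.of_wp (wp_edgeP hB hI h (getElem?_of_prefix hL' hL) hs hj h19)).mono (by decide) ?_
    rintro σ₁ ⟨L₁, hL₁, h1, hs1, h191, hx1, hx2⟩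
    refine ⟨L₁, hL'.trans hL₁, h1, hs1, h191, fun i hi => ?_⟩
    rcases Nat.lt_succ_iff_lt_or_eq.1 hi with hi | rfl
    · exact ⟨(hx i hi).1.mono hL₁, (hx i hi).2.mono hL₁⟩
    · exact ⟨hx1, hx2⟩
  · rintro σ₁ ⟨L₁, hL₁, h1, -, -, hx⟩
    refine Spec.of_wp ?_
    simp only [wp_progs_cons, wp_progs_nil, wp_block_cons, wp_block_nil]
    have h16 := h1.r16
    have h7 := h1.ctx.r7
    have e : (Instr.add 16 16 7).run σ₁ = ⟨Function.update σ₁.reg 16 (head + 1), σ₁.mem⟩ := by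
      simp [Instr.run, Instr.val, h16, h7]
    rw [e]
    refine ⟨by simp only [Instr.val, h16, h7]; omega, L₁, ?_, ?_, ?_, ?_⟩
    · refine ⟨h1.ctx.congr fun r hr => ?_, h1.arrays, h1.queue, h1.marks, h1.run, ?_, ?_, ?_⟩
      · simp only
        rw [Function.update_of_ne (by omega)]
      · simp
      · simp [h1.r17]
      · simpa using h1.found
    · exact hlt.trans_le hL₁.length_le
    · exact (hL₁.map Prod.fst).subset hS.2.1
    · intro i hi s₁ p₁ he s' hst
      have he' : L[i]? = some (s₁, p₁) := by
        obtain ⟨e, hLe⟩ : ∃ e, L[i]? = some e :=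
          ⟨_, List.getElem?_eq_getElem (by omega : i < L.length)⟩
        rw [← he, getElem?_of_prefix hL₁ hLe, hLe]
      rcases Nat.lt_succ_iff_lt_or_eq.1 hi with hi | rfl
      · exact (hL₁.map Prod.fst).subset (hS.2.2 i hi s₁ p₁ he' s' hst)
      · rw [hL] at he'
        obtain ⟨rfl, rfl⟩ := Prod.mk.inj (Option.some.inj he')
        -- Four cases: which path moves, and in which orientation the edge is listed.
        rcases hst with ⟨b, ⟨j, hj, ⟨e1, rfl⟩ | ⟨rfl, e1⟩⟩, hm, rfl⟩ |
          ⟨b, ⟨j, hj, ⟨e1, rfl⟩ | ⟨rfl, e1⟩⟩, hm, rfl⟩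
        · exact (hx j hj).1.1 e1.symm hm
        · exact (hx j hj).2.1 e1.symm hm
        · exact (hx j hj).1.2 e1.symm hm
        · exact (hx j hj).2.2 e1.symm hm
  · have : cost loadHeadP = 29 := by decide
    omega

/-- The result of the search. -/
structure Searched (I : Inst) (L : List (Conf × ℕ)) (σ : State) : Prop where
  ctx : Ctx I σ.reg
  arrays : Arrays I σ.mem
  queue : Queue I L σ.mem
  run : Run I L
  found : Found I L (σ.reg 18)
  start : I.start ∈ L.map Prod.fst
  closed : ∀ s ∈ L.map Prod.fst, ∀ s', I.Step s s' → s' ∈ L.map Prod.fst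

/-- Each queue entry is treated once, in `O(m + 1)` steps, so `4 * n ^ 2 - head` is a variant of the
main loop. When the head reaches the end of the queue, the queue is closed under steps. -/
theorem spec_searchP (hB : Bounds I W) (hI : I.Valid) (hctx : Ctx I σ.reg)
    (harr : Arrays I σ.mem) :
    Spec W searchP σ (5000 * (I.n * I.n * (I.m + 1))) fun σ' => ∃ L, Searched I L σ' := by
  have hn := hB.two_le
  have := hB.le_W
  have := hB.n_le
  have := hB.m_le
  have hs1 := hI.s₁_lt
  have hs2 := hI.s₂_lt
  refine Spec.mono (T := 2 + ((4 * (I.n * I.n) * (4 + 1) + 1) + (8 + (cost pushP +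
    ((4 * (I.n * I.n) * (1000 * (I.m + 1) + 1) + 1) + 1))))) (Spec.seq
    (Q := fun σ => Ctx I σ.reg ∧ Arrays I σ.mem ∧ σ.reg 19 = 0) (Spec.of_wp ?_)
    fun σ ⟨hctx, harr, h19⟩ => Spec.seq (Spec.for (N := 4 * (I.n * I.n)) (T := 4)
    (fun i σ => Ctx I σ.reg ∧ Arrays I σ.mem ∧ σ.reg 19 = i ∧
      ∀ c < i, σ.mem (c + (2 * I.m + 6 * I.n)) = 0) ?_ ?_ ⟨hctx, harr, h19, by simp⟩)
    fun σ ⟨hctx, harr, _, h0⟩ => Spec.seq (T := 8) (Q := fun σ => Search I [] 0 σ ∧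
      σ.reg 34 = I.s₁ ∧ σ.reg 35 = I.s₂ ∧ σ.reg 36 = 0 ∧ σ.reg 37 = 0) (Spec.of_wp ?_)
    fun σ ⟨h, h34, h35, h36, h37⟩ => Spec.seq (Spec.of_wp (wp_pushP (s := I.start) hB
      (fun _ => hI.s₁_ne_t₁) h ⟨hs1, hs2, by simp [Inst.start], by simp [Inst.start]⟩ le_rfl h34 h35
      h36 h37 (Or.inl ⟨rfl, rfl⟩))) fun σ ⟨L, _, h, hstart, _⟩ => Spec.seq (Spec.loop
      (fun k σ => ∃ L head, Search I L head σ ∧ head + k = 4 * (I.n * I.n) ∧ Searching I L head)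
      ?_ (4 * (I.n * I.n)) σ ⟨L, 0, h, by simp, by simp, hstart, by simp⟩)
      fun σ ⟨hc, k, hk, L, head, h, hhead, hS⟩ => Spec.of_wp ?_) ?_ fun σ h => h
  · simp [Instr.val, Instr.run]
    exact ⟨by omega, hctx.congr fun r hr => Function.update_of_ne (by omega) _ _, harr⟩
  · rintro i - σ ⟨hctx, -, h19, -⟩
    simp [Test.Holds, hctx.r15, h19]
  · rintro i hi σ ⟨hctx, harr, h19, h0⟩
    refine Spec.of_wp ?_
    simp [Instr.val, Instr.run, hctx.r6, hctx.r7, hctx.r12, h19]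
    refine ⟨by omega, by omega, by omega, hctx.congr fun r hr => ?_, harr.congr fun c hc => ?_,
      fun c hc => ?_⟩
    · rw [Function.update_of_ne (by omega), Function.update_of_ne (by omega)]
    · rw [Function.update_of_ne (by omega)]
    · by_cases hci : c = i
      · simp [hci]
      · rw [Function.update_of_ne (by omega), h0 c (by omega)]
  · simp [Instr.val, Instr.run, hctx.r2, hctx.r4]
    refine ⟨by omega, by omega, by omega, by omega, hctx.congr fun r hr => ?_, harr,
      ?_, ?_, ?_, ?_, ?_, ?_⟩
    · simp only
      repeat rw [Function.update_of_ne (by omega)]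
    · intro h s p he
      simp at he
    · exact fun s hs => Or.inr ⟨by simp, h0 _ (code_lt hs)⟩
    · exact ⟨by simp, by simp, fun h s p he => by simp at he⟩
    · simp
    · simp
    · exact Or.inl ⟨by simp, by simp⟩
  · rintro k σ ⟨L, head, h, hhead, hS⟩ hc
    simp only [Test.Holds, h.r16, h.r17] at hc
    have hlen := h.run.length_le
    refine (spec_searchP_body hB hI h hS hc).mono le_rfl ?_
    rintro σ' ⟨L', h', hS'⟩
    exact ⟨k - 1, by omega, L', head + 1, h', by omega, hS'⟩
  · simp only [Test.Holds, h.r16, h.r17] at hc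
    refine ⟨L, h.ctx, h.arrays, h.queue, h.run, h.found, hS.2.1, fun s hs => ?_⟩
    obtain ⟨⟨s, p⟩, he, rfl⟩ := List.mem_map.1 hs
    obtain ⟨i, hi⟩ := List.mem_iff_getElem?.1 he
    have hil := (List.getElem?_eq_some_iff.1 hi).1
    exact hS.2.2 i (by omega) s p hi
  · have : cost pushP ≤ 50 := by decide
    have h1 : 1 ≤ I.n * I.n := by omega
    have h2 : I.n * I.n ≤ I.n * I.n * (I.m + 1) := Nat.le_mul_of_pos_right _ (by omega)
    rw [show 4 * (I.n * I.n) * (1000 * (I.m + 1) + 1) =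
      4000 * (I.n * I.n * (I.m + 1)) + 4 * (I.n * I.n) by ring]
    omega

end

/-! ### The output -/

/-- `C` lists the configurations that lead to the one with number `h` in the queue. -/
inductive Trace (L : List (Conf × ℕ)) : ℕ → List Conf → Prop
  | nil {s : Conf} {p : ℕ} : L[0]? = some (s, p) → Trace L 0 [s]
  | cons {h p : ℕ} {s : Conf} {C : List Conf} : p < h → L[h]? = some (s, p) → Trace L p C →
      Trace L h (s :: C)

/-- Predecessors have smaller numbers, so following them ends at entry `0`. -/
theorem Run.exists_trace {I : Inst} {L : List (Conf × ℕ)} (h : Run I L) {i p : ℕ} {s : Conf}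
    (hi : L[i]? = some (s, p)) : ∃ C, Trace L i C ∧ I.Chain C s := by
  induction i using Nat.strong_induction_on generalizing s p with
  | _ i ih =>
    rcases h.parent i s p hi with ⟨rfl, rfl⟩ | ⟨hp, s₀, p₀, h1, h2⟩
    · exact ⟨_, .nil hi, .nil⟩
    · obtain ⟨C, h3, h4⟩ := ih p hp h1
      exact ⟨_, .cons hp hi h3, .cons h4 h2⟩

/-- Write the heads of the configuration whose number is in register `16` to the output. -/
def emitP : Prog :=
  block [.add 40 16 16, .add 40 40 40, .add 40 40 16, .add 40 40 13, .load 22 40, .add 40 40 7,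
    .load 23 40, .add 41 8 22, .load 42 41, .add 42 42 10, .store 42 22, .add 41 9 23, .load 42 41,
    .add 42 42 11, .store 42 23]

/-- Write the heads of all configurations that lead to the one whose number is in register
`18`. -/
def traceP : Prog := progs [
  block [.copy 16 18],
  .loop (.lt 6 16) (progs [emitP, block [.add 40 40 7, .add 40 40 7, .add 40 40 7, .load 16 40]]),
  emitP]

/-- Put the answer into the registers. -/
def finishP : Prog :=
  block [.add 41 8 3, .load 41 41, .add 42 9 5, .load 42 42, .copy 1 10, .copy 3 11, .copy 2 41,
    .copy 4 42, .const 0 1]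

def outputP : Prog := progs [traceP, finishP]

/-- The configurations in `C` are written to the output. -/
def Written (I : Inst) (C : List Conf) (μ : ℕ → ℕ) : Prop :=
  ∀ r ∈ C, μ (I.x r.u + (2 * I.m + 2 * I.n)) = r.u ∧ μ (I.y r.v + (2 * I.m + 4 * I.n)) = r.v

structure Tracing (I : Inst) (L : List (Conf × ℕ)) (h : ℕ) (σ : State) : Prop where
  ctx : Ctx I σ.reg
  arrays : Arrays I σ.mem
  queue : Queue I L σ.mem
  r16 : σ.reg 16 = h

/-- The heads of the configurations in `C` may be written to the output. -/
structure Writable (I : Inst) (C : List Conf) : Prop where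
  lt : ∀ r ∈ C, r.u < I.n ∧ r.v < I.n
  x_inj : ∀ r ∈ C, ∀ r' ∈ C, I.x r.u = I.x r'.u → r.u = r'.u
  y_inj : ∀ r ∈ C, ∀ r' ∈ C, I.y r.v = I.y r'.v → r.v = r'.v

section

variable {I : Inst} {W : ℕ} {σ : State}

/-- Each head is stored at the index given by its coordinate, so the paths come out in order
although the trace runs backwards and repeats heads: equal coordinates in `D` mean equal vertices,
and rewriting a cell changes nothing. -/
theorem wp_emitP {L : List (Conf × ℕ)} {D C : List Conf} {h p : ℕ} {s : Conf} (hB : Bounds I W)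
    (hx : ∀ v < I.n, I.x v ≤ I.n) (hy : ∀ v < I.n, I.y v ≤ I.n)
    (hlen : L.length ≤ 4 * (I.n * I.n)) (hs : Tracing I L h σ) (hL : L[h]? = some (s, p))
    (hD : Writable I D) (hC : Written I C σ.mem) (hCD : ∀ r ∈ C, r ∈ D) (hsD : s ∈ D) :
    wp W emitP (fun σ' => Tracing I L h σ' ∧ Written I (s :: C) σ'.mem ∧
      σ'.reg 40 = 5 * h + (2 * I.m + 6 * I.n + 4 * (I.n * I.n)) + 1) σ := by
  have := hB.two_le
  have := hB.le_W
  have := hB.n_le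
  have := hB.m_le
  have hlt := (List.getElem?_eq_some_iff.1 hL).1
  obtain ⟨s1, s2⟩ := hD.lt s hsD
  obtain ⟨q1, q2, -⟩ := hs.queue _ _ _ hL
  have a1 := hs.arrays.x _ s1
  have a2 := hs.arrays.y _ s2
  have b1 := hx _ s1
  have b2 := hy _ s2
  have hT : h + h + (h + h) + h + (2 * I.m + 6 * I.n + 4 * (I.n * I.n)) =
    5 * h + (2 * I.m + 6 * I.n + 4 * (I.n * I.n)) := by omega
  have hc := hs.ctx
  have a3 : Function.update σ.mem (I.x s.u + (2 * I.m + 2 * I.n)) s.u (2 * I.m + I.n + s.v) =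
      I.y s.v := by
    rw [Function.update_of_ne (by omega), a2]
  simp [emitP, Instr.val, Instr.run, hc.r7, hc.r8, hc.r9, hc.r10, hc.r11, hc.r13, hs.r16, hT, q1,
    q2, a1, a3]
  refine ⟨by omega, by omega, by omega, by omega, by omega, by omega, by omega, by omega, by omega,
    by omega, by omega, by omega, by omega, by omega, by omega, ⟨?_, ?_, ?_, ?_⟩, ?_⟩
  · refine hc.congr fun r hr => ?_
    simp only
    repeat rw [Function.update_of_ne (by omega)]
  · refine hs.arrays.congr fun c hc => ?_
    simp only
    repeat rw [Function.update_of_ne (by omega)]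
  · intro i s' p' he
    have h1 := hs.queue i s' p' he
    have hf : ∀ c, 2 * I.m + 6 * I.n ≤ c → (Function.update (Function.update σ.mem
        (I.x s.u + (2 * I.m + 2 * I.n)) s.u) (I.y s.v + (2 * I.m + 4 * I.n)) s.v) c = σ.mem c := by
      intro c hc
      repeat rw [Function.update_of_ne (by omega)]
    simp only
    rw [hf _ (by omega), hf _ (by omega), hf _ (by omega), hf _ (by omega), hf _ (by omega)]
    exact h1
  · simp [hs.r16]
  · have key : ∀ r ∈ D, (r = s ∨ r ∈ C) → (Function.update (Function.update σ.mem
        (I.x s.u + (2 * I.m + 2 * I.n)) s.u) (I.y s.v + (2 * I.m + 4 * I.n)) s.v)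
          (I.x r.u + (2 * I.m + 2 * I.n)) = r.u ∧ (Function.update (Function.update σ.mem
        (I.x s.u + (2 * I.m + 2 * I.n)) s.u) (I.y s.v + (2 * I.m + 4 * I.n)) s.v)
          (I.y r.v + (2 * I.m + 4 * I.n)) = r.v := by
      intro r hr hrC
      have c1 := hx _ (hD.lt r hr).1
      have c2 := hy _ (hD.lt r hr).2
      constructor
      · rw [Function.update_of_ne (by omega)]
        by_cases he : I.x r.u = I.x s.u
        · rw [he, Function.update_self, hD.x_inj r hr s hsD he]
        · rw [Function.update_of_ne (by omega)]
          rcases hrC with rfl | hrC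
          · exact absurd rfl he
          · exact (hC r hrC).1
      · by_cases he : I.y r.v = I.y s.v
        · rw [he, Function.update_self, hD.y_inj r hr s hsD he]
        · rw [Function.update_of_ne (by omega), Function.update_of_ne (by omega)]
          rcases hrC with rfl | hrC
          · exact absurd rfl he
          · exact (hC r hrC).2
    intro r hr
    rcases List.mem_cons.1 hr with rfl | hr
    · exact key r hsD (Or.inl rfl)
    · exact key r (hCD r hr) (Or.inr hr)

theorem spec_outputP {L : List (Conf × ℕ)} {D : List Conf} (hB : Bounds I W)
    (hx : ∀ v < I.n, I.x v ≤ I.n) (hy : ∀ v < I.n, I.y v ≤ I.n) (ht₁ : I.t₁ < I.n)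
    (ht₂ : I.t₂ < I.n) (hlen : L.length ≤ 4 * (I.n * I.n)) (hctx : Ctx I σ.reg)
    (harr : Arrays I σ.mem) (hq : Queue I L σ.mem) (hT : Trace L (σ.reg 18) D)
    (hD : Writable I D) :
    Spec W outputP σ (200 * (I.n * I.n)) fun σ' => Written I D σ'.mem ∧ σ'.reg 0 = 1 ∧
      σ'.reg 1 = 2 * I.m + 2 * I.n ∧ σ'.reg 2 = I.x I.t₁ ∧ σ'.reg 3 = 2 * I.m + 4 * I.n ∧
      σ'.reg 4 = I.y I.t₂ := by
  have := hB.two_le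
  have := hB.le_W
  have := hB.n_le
  have := hB.m_le
  have hltL : ∀ {h C}, Trace L h C → h < L.length := by
    intro h C hT
    cases hT with
    | nil he => exact (List.getElem?_eq_some_iff.1 he).1
    | cons _ he _ => exact (List.getElem?_eq_some_iff.1 he).1
  have h18 := hltL hT
  refine Spec.mono (T := (2 + ((σ.reg 18 * (30 + 1) + 1) + (cost emitP + 1))) + (cost finishP + 1))
    (Spec.seq (Q := fun σ' => Ctx I σ'.reg ∧ Arrays I σ'.mem ∧ Written I D σ'.mem) (Spec.seq
    (Q := fun σ' => Tracing I L (σ.reg 18) σ') (Spec.of_wp ?_) fun σ₁ h1 => Spec.seq (Spec.loop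
    -- `E` has been written and `C` is still to come; the variant `k` is the current queue number.
    (fun k σ' => ∃ C E, Tracing I L k σ' ∧ Trace L k C ∧ Written I E σ'.mem ∧ (∀ r ∈ E, r ∈ D) ∧
      (∀ r ∈ C, r ∈ D) ∧ ∀ r ∈ D, r ∈ C ∨ r ∈ E) ?_ (σ.reg 18) σ₁
      ⟨D, [], h1, hT, by simp [Written], by simp, by simp, fun r hr => Or.inl hr⟩)
      fun σ₂ ⟨hc, k, hk, C, E, h2, hTC, hE, hED, hCD, hDCE⟩ => Spec.of_wp ?_)
      fun σ₃ ⟨hctx, harr, hW⟩ => Spec.of_wp ?_) ?_ fun σ h => h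
  · simp [Instr.val, Instr.run]
    refine ⟨by omega, hctx.congr fun r hr => ?_, harr, hq, by simp⟩
    simp only
    rw [Function.update_of_ne (by omega)]
  · rintro k σ' ⟨C, E, h2, hTC, hE, hED, hCD, hDCE⟩ hc
    simp only [Test.Holds, h2.ctx.r6, h2.r16] at hc
    have hkL := hltL hTC
    cases hTC with
    | nil => omega
    | @cons _ p s C hp he hTC =>
      refine (Spec.of_wp (P := progs [emitP, block [.add 40 40 7, .add 40 40 7, .add 40 40 7,
        .load 16 40]]) ?_).mono (by decide) fun _ h => h
      rw [wp_progs_cons]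
      refine wp_mono (wp_emitP hB hx hy hlen h2 he hD hE hED (hCD s (by simp))) ?_
      rintro σ₃ ⟨h3, hW, h40⟩
      have h7 := h3.ctx.r7
      have hq5 : σ₃.mem (5 * k + (2 * I.m + 6 * I.n + 4 * (I.n * I.n)) + 1 + 1 + 1 + 1) = p :=
        (h3.queue _ _ _ he).2.2.2.2
      simp [Instr.val, Instr.run, h40, h7, hq5]
      refine ⟨by omega, by omega, by omega, by omega, p, hp,
        ⟨h3.ctx.congr fun r hr => ?_, h3.arrays, h3.queue, by simp⟩, C, hTC, s :: E, hW, ?_,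
        fun r hr => hCD r (by simp [hr]), fun r hr => ?_⟩
      · simp only
        repeat rw [Function.update_of_ne (by omega)]
      · rintro r hr
        rcases List.mem_cons.1 hr with rfl | hr
        · exact hCD r (by simp)
        · exact hED r hr
      · have := hDCE r hr
        simp only [List.mem_cons] at this ⊢
        tauto
  · simp only [Test.Holds, h2.ctx.r6, h2.r16] at hc
    obtain rfl : k = 0 := by omega
    cases hTC with
    | cons hp => omega
    | @nil s p he =>
      rw [wp_progs_cons]
      refine wp_mono (wp_emitP hB hx hy hlen h2 he hD hE hED (hCD s (by simp))) ?_
      rintro σ₃ ⟨h3, hW, -⟩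
      refine ⟨h3.ctx, h3.arrays, fun r hr => hW r ?_⟩
      simpa using hDCE r hr
  · have a1 := harr.x _ ht₁
    have a2 := harr.y _ ht₂
    have b1 := hx _ ht₁
    have b2 := hy _ ht₂
    simp [finishP, Instr.val, Instr.run, hctx.r3, hctx.r5, hctx.r8, hctx.r9, hctx.r10, hctx.r11, a1,
      a2, hW]
    omega
  · have e1 : cost emitP = 16 := by decide
    have e2 : cost finishP = 10 := by decide
    rw [e1, e2]
    omega

end

/-! ### Reversal of the second path -/

/-- The search problem where the second path is traversed in the opposite direction. -/
def Inst.flip (I : Inst) : Inst :=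
  { I with y := fun v => I.n - I.y v, s₂ := I.t₂, t₂ := I.s₂ }

def flipP : Prog := progs [
  block [.const 19 0],
  .loop (.lt 19 0)
    (block [.add 40 9 19, .load 41 40, .sub 41 0 41, .store 40 41, .add 19 19 7]),
  block [.copy 41 4, .copy 4 5, .copy 5 41]]

theorem Ctx.flip {I : Inst} {ρ : ℕ → ℕ} (h : Ctx I ρ) (y : ℕ) :
    Ctx I.flip (Function.update (Function.update (Function.update ρ 41 y) 4 I.t₂) 5 I.s₂) := by
  constructor <;> simp [Inst.flip]
  exacts [h.r0, h.r1, h.r2, h.r3, h.r6, h.r7, h.r8, h.r9, h.r10, h.r11, h.r12, h.r13, h.r14, h.r15]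

theorem spec_flipP {I : Inst} {W : ℕ} {σ : State} (hB : Bounds I W)
    (hy : ∀ v < I.n, I.y v ≤ I.n) (ht₁ : I.s₂ < I.n) (ht₂ : I.t₂ < I.n) (hctx : Ctx I σ.reg)
    (harr : Arrays I σ.mem) :
    Spec W flipP σ (30 * (I.n * I.n)) fun σ' => Ctx I.flip σ'.reg ∧ Arrays I.flip σ'.mem ∧
      σ'.reg 18 = σ.reg 18 ∧ ∀ c, 2 * I.m + 2 * I.n ≤ c → σ'.mem c = σ.mem c := by
  have := hB.two_le
  have := hB.le_W
  have := hB.n_le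
  have := hB.m_le
  refine Spec.mono (T := 2 + ((I.n * (6 + 1) + 1) + 5)) (Spec.seq
    (Q := fun σ' => Ctx I σ'.reg ∧ σ'.mem = σ.mem ∧ σ'.reg 18 = σ.reg 18 ∧ σ'.reg 19 = 0)
    (Spec.of_wp ?_) fun σ₁ ⟨hctx₁, hm₁, h18, h19⟩ => Spec.seq (Spec.for (N := I.n) (T := 6)
    (fun i σ' => Ctx I σ'.reg ∧ σ'.reg 18 = σ.reg 18 ∧ σ'.reg 19 = i ∧
      (∀ v < i, σ'.mem (2 * I.m + I.n + v) = I.n - I.y v) ∧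
      ∀ c, c < 2 * I.m + I.n ∨ 2 * I.m + I.n + i ≤ c → σ'.mem c = σ.mem c) ?_ ?_
      ⟨hctx₁, h18, h19, by simp, fun c _ => by rw [hm₁]⟩)
    fun σ₂ ⟨hctx₂, h18, _, hy₂, hf₂⟩ => Spec.of_wp ?_) ?_ fun σ h => h
  · simp [Instr.val, Instr.run]
    exact ⟨by omega, hctx.congr fun r hr => Function.update_of_ne (by omega) _ _⟩
  · rintro i - σ₂ ⟨h, -, h19, -⟩
    simp [Test.Holds, h.r0, h19]
  · rintro i hi σ₂ ⟨h, h18, h19, hy₂, hf₂⟩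
    refine Spec.of_wp ?_
    have e1 := harr.y i hi
    rw [← hf₂ _ (by omega)] at e1
    have e2 := hy i hi
    simp [Instr.val, Instr.run, h.r0, h.r7, h.r9, h19, e1, h18]
    refine ⟨by omega, by omega, by omega, by omega, h.congr fun r hr => ?_, fun v hv => ?_,
      fun c hc => ?_⟩
    · repeat rw [Function.update_of_ne (by omega)]
    · by_cases hvi : v = i
      · simp [hvi]
      · rw [Function.update_of_ne (by omega), hy₂ v (by omega)]
    · rw [Function.update_of_ne (by omega), hf₂ c (by omega)]
  · simp [Instr.val, Instr.run, hctx₂.r4, hctx₂.r5, h18]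
    refine ⟨by omega, by omega, by omega, hctx₂.flip _, ⟨fun j hj => ?_, fun v hv => ?_, hy₂⟩,
      fun c hc => hf₂ c (by omega)⟩
    · have hj : j < I.m := hj
      rw [hf₂ _ (by omega), hf₂ _ (by omega)]
      exact harr.edges j hj
    · have hv : v < I.n := hv
      exact (hf₂ (2 * I.m + v) (by omega)).trans (harr.x v hv)
  · omega

/-! ### The program -/

def noP : Prog := .instr (.const 0 0)

def setupP : Prog :=
  block [.add 8 1 1, .add 9 8 0, .add 14 0 0, .add 10 8 14, .add 11 10 14, .add 12 11 14,
    .add 14 14 14, .mul 15 0 0, .add 15 15 15, .add 15 15 15, .add 13 12 15, .copy 16 8,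
    .copy 17 2]

def distancesP : Prog := progs [setupP, distP, block [.copy 16 9, .copy 17 4], distP]

def decideP : Prog := progs [searchP,
  .branch (.lt 6 18) outputP (progs [flipP, searchP,
    .branch (.lt 6 18) (progs [flipP, outputP]) noP])]

/-- The program that solves `2`-Disjoint Shortest Paths. -/
def solveP : Prog := progs [
  block [.const 7 1],
  .branch (.eq 1 6) noP (.branch (.eq 2 4) noP (.branch (.eq 2 5) noP
    (progs [distancesP, decideP])))]

/-- The heads of the configurations in `D` are the vertices of two paths that solve the problem. -/
structure Solved (I : Inst) (D : List Conf) : Prop where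
  writable : Writable I D
  x_cov : ∀ i < I.x I.t₁, ∃ r ∈ D, ∃ r' ∈ D, I.x r.u = i ∧ I.x r'.u = i + 1 ∧ I.Adj r.u r'.u
  y_cov : ∀ i < I.y I.t₂, ∃ r ∈ D, ∃ r' ∈ D, I.y r.v = i ∧ I.y r'.v = i + 1 ∧ I.Adj r.v r'.v
  disj : ∀ r ∈ D, ∀ r' ∈ D, r.u ≠ r'.v
  s₁_mem : ∃ r ∈ D, r.u = I.s₁
  t₁_mem : ∃ r ∈ D, r.u = I.t₁
  s₂_mem : ∃ r ∈ D, r.v = I.s₂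
  t₂_mem : ∃ r ∈ D, r.v = I.t₂

/-- The search has failed. -/
def Hopeless (I : Inst) : Prop :=
  ∃ S : Conf → Prop, S I.start ∧ (∀ s s', S s → I.Step s s' → S s') ∧
    ∀ s, S s → ¬ (s.u = I.t₁ ∧ s.v = I.t₂)

/-- The result of the program. -/
def Answer (I : Inst) (σ : State) : Prop :=
  (σ.reg 0 = 1 ∧ σ.reg 1 = 2 * I.m + 2 * I.n ∧ σ.reg 2 = I.x I.t₁ ∧
    σ.reg 3 = 2 * I.m + 4 * I.n ∧ σ.reg 4 = I.y I.t₂ ∧ ∃ D, Written I D σ.mem ∧ Solved I D) ∨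
  (σ.reg 0 = 0 ∧ Hopeless I ∧ Hopeless I.flip)

theorem Inst.Chain.start_mem {I : Inst} {C : List Conf} {s : Conf} (h : I.Chain C s) :
    I.start ∈ C := by
  induction h with
  | nil => simp
  | cons _ _ ih => exact List.mem_cons_of_mem _ ih

theorem Bounds.flip {I : Inst} {W : ℕ} (h : Bounds I W) : Bounds I.flip W :=
  ⟨h.two_le, h.m_le, h.le_W, h.src_lt, h.dst_lt⟩

/-- The reversed second path starts at `t₂`, so `s₁` must avoid this vertex too. The Lipschitz
condition is symmetric because adjacency is. -/
theorem Inst.Valid.flip {I : Inst} (h : I.Valid) (hne : I.s₁ ≠ I.t₂) : I.flip.Valid := by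
  refine ⟨h.src_lt, h.dst_lt, h.x_le, fun v _ => Nat.sub_le _ _, h.x_lip, fun a b hab => ?_,
    h.s₁_lt, h.t₁_lt, h.t₂_lt, h.s₂_lt, h.s₁_ne_t₁, hne⟩
  have := h.y_lip _ _ (Inst.Adj.symm (I := I) hab)
  change I.n - I.y b ≤ I.n - I.y a + 1
  omega

theorem RunInv_solved {I : Inst} {D : List Conf} {s : Conf} (h : I.RunInv D s)
    (h0 : I.start ∈ D) (hx : I.x I.s₁ = 0) (hy : I.y I.s₂ = 0) (ht₁ : s.u = I.t₁)
    (ht₂ : s.v = I.t₂) : Solved I D :=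
  ⟨⟨h.lt, h.x_inj, h.y_inj⟩, fun i hi => h.x_cov i (by omega) (by rwa [ht₁]),
    fun i hi => h.y_cov i (by omega) (by rwa [ht₂]), h.disj, ⟨_, h0, rfl⟩, ⟨_, h.mem, ht₁⟩,
    ⟨_, h0, rfl⟩, ⟨_, h.mem, ht₂⟩⟩

theorem RunInv_flip_solved {I : Inst} (hI : I.Valid) {D : List Conf} {s : Conf}
    (h : I.flip.RunInv D s) (h0 : I.flip.start ∈ D) (hx : I.x I.s₁ = 0) (hy : I.y I.s₂ = 0)
    (ht₁ : s.u = I.t₁) (ht₂ : s.v = I.s₂) : Solved I D := by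
  refine ⟨⟨h.lt, h.x_inj, fun r hr r' hr' he => h.y_inj r hr r' hr' (congrArg (I.n - ·) he)⟩,
    fun i hi => h.x_cov i (Nat.le_of_eq hx |>.trans (Nat.zero_le i)) (by rwa [ht₁]), fun i hi => ?_,
    h.disj, ⟨_, h0, rfl⟩, ⟨_, h.mem, ht₁⟩, ⟨_, h.mem, ht₂⟩, ⟨_, h0, rfl⟩⟩
  have ht := hI.y_le _ hI.t₂_lt
  have e1 : I.flip.y I.flip.s₂ = I.n - I.y I.t₂ := rfl
  have e2 : I.flip.y s.v = I.n - I.y I.s₂ := by rw [ht₂]; rfl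
  -- The edge between heights `i` and `i + 1` of `y` joins the heights `n - 1 - i` and `n - i` of
  -- the reversed coordinate, in the opposite order.
  obtain ⟨r, hr, r', hr', k1, k2, k3⟩ := h.y_cov (I.n - 1 - i) (by omega) (by omega)
  have k1 : I.n - I.y r.v = I.n - 1 - i := k1
  have k2 : I.n - I.y r'.v = I.n - 1 - i + 1 := k2
  have := hI.y_le _ (h.lt r hr).2
  have := hI.y_le _ (h.lt r' hr').2
  exact ⟨r', hr', r, hr, by omega, by omega, Inst.Adj.symm (I := I) k3⟩

theorem Searched.hopeless {I : Inst} {L : List (Conf × ℕ)} {σ : State} (h : Searched I L σ)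
    (h0 : σ.reg 18 = 0) : Hopeless I := by
  refine ⟨(· ∈ L.map Prod.fst), h.start, fun s s' hs hst => h.closed s hs s' hst, fun s hs => ?_⟩
  rcases h.found with ⟨-, h1⟩ | ⟨h1, -⟩
  · obtain ⟨e, he, rfl⟩ := List.mem_map.1 hs
    exact h1 e he
  · omega

theorem Searched.exists_trace {I : Inst} (hI : I.Valid) {L : List (Conf × ℕ)} {σ : State}
    (h : Searched I L σ) (h0 : 0 < σ.reg 18) : ∃ D s, Trace L (σ.reg 18) D ∧ I.RunInv D s ∧
      I.start ∈ D ∧ s.u = I.t₁ ∧ s.v = I.t₂ := by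
  rcases h.found with ⟨h1, -⟩ | ⟨-, s, p, h1, h2, h3⟩
  · omega
  · obtain ⟨D, h4, h5⟩ := h.run.exists_trace h1
    exact ⟨D, s, h4, h5.runInv hI, h5.start_mem, h2, h3⟩

section

variable {I : Inst} {W : ℕ} {σ : State}

/-- After a successful second search the coordinates are flipped back before the output, so the
second path is written by distance from `s₂`, hence in the required direction. -/
theorem spec_decideP (hB : Bounds I W) (hI : I.Valid) (hne : I.s₁ ≠ I.t₂) (hx : I.x I.s₁ = 0)
    (hy : I.y I.s₂ = 0) (hctx : Ctx I σ.reg) (harr : Arrays I σ.mem) :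
    Spec W decideP σ (11000 * (I.n * I.n * (I.m + 1))) (Answer I) := by
  have := hB.two_le
  have := hB.le_W
  have := hB.n_le
  have hI' := hI.flip hne
  refine Spec.mono (T := 5000 * (I.n * I.n * (I.m + 1)) + ((1 + (30 * (I.n * I.n) +
    (5000 * (I.n * I.n * (I.m + 1)) + ((1 + (30 * (I.n * I.n) + (200 * (I.n * I.n) + 1))) + 1)))) +
    1)) (Spec.seq (spec_searchP hB hI hctx harr) fun σ₁ ⟨L, h⟩ => Spec.seq
    (Spec.branch (R := Answer I) (fun hc => ?_) fun hc => ?_) fun σ₂ h => Spec.of_wp h) ?_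
    fun σ h => h
  · simp only [Test.Holds, h.ctx.r6] at hc
    obtain ⟨D, s, hT, hR, h0, h1, h2⟩ := h.exists_trace hI hc
    have hS := RunInv_solved hR h0 hx hy h1 h2
    refine (spec_outputP hB hI.x_le hI.y_le hI.t₁_lt hI.t₂_lt h.run.length_le h.ctx h.arrays
      h.queue hT hS.writable).mono (by omega) ?_
    rintro σ₂ ⟨k1, k2, k3, k4, k5, k6⟩
    exact Or.inl ⟨k2, k3, k4, k5, k6, D, k1, hS⟩
  · simp only [Test.Holds, h.ctx.r6] at hc
    have hH := h.hopeless (by omega)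
    refine (spec_flipP hB hI.y_le hI.s₂_lt hI.t₂_lt h.ctx h.arrays).seq
      fun σ₂ ⟨hctx₂, harr₂, _, _⟩ => Spec.seq (spec_searchP (I := I.flip) hB.flip hI' hctx₂ harr₂)
      fun σ₃ ⟨L', h'⟩ => Spec.seq (Spec.branch (R := Answer I) (fun hc => ?_) fun hc => ?_)
      fun σ₄ h => Spec.of_wp h
    · simp only [Test.Holds, h'.ctx.r6] at hc
      obtain ⟨D, s, hT, hR, h0, h1, h2⟩ := h'.exists_trace hI' hc
      have hS := RunInv_flip_solved hI hR h0 hx hy h1 h2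
      refine (spec_flipP hB.flip hI'.y_le hI'.s₂_lt hI'.t₂_lt h'.ctx h'.arrays).seq
        fun σ₄ ⟨hctx₄, harr₄, h18, hf⟩ => Spec.seq (T' := 1) (Q := Answer I) ?_
        fun σ₅ h => Spec.of_wp h
      -- Flipping twice restores the terminals by definition, and the coordinates because `y` is at
      -- most `n`.
      have hctx₅ : Ctx I σ₄.reg := ⟨hctx₄.r0, hctx₄.r1, hctx₄.r2, hctx₄.r3, hctx₄.r4, hctx₄.r5,
        hctx₄.r6, hctx₄.r7, hctx₄.r8, hctx₄.r9, hctx₄.r10, hctx₄.r11, hctx₄.r12, hctx₄.r13,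
        hctx₄.r14, hctx₄.r15⟩
      have harr₅ : Arrays I σ₄.mem := by
        refine ⟨harr₄.edges, harr₄.x, fun v hv => (harr₄.y v hv).trans ?_⟩
        have := hI.y_le v hv
        change I.n - (I.n - I.y v) = I.y v
        omega
      have hq : Queue I L' σ₄.mem := by
        intro i s p he
        have h1 := h'.queue i s p he
        have hf' : ∀ c, 2 * I.m + 2 * I.n ≤ c → σ₄.mem c = σ₃.mem c := hf
        rw [hf' _ (by omega), hf' _ (by omega), hf' _ (by omega), hf' _ (by omega),
          hf' _ (by omega)]
        exact h1
      refine (spec_outputP hB hI.x_le hI.y_le hI.t₁_lt hI.t₂_lt h'.run.length_le hctx₅ harr₅ hq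
        (h18 ▸ hT) hS.writable).mono le_rfl ?_
      rintro σ₂ ⟨k1, k2, k3, k4, k5, k6⟩
      exact Or.inl ⟨k2, k3, k4, k5, k6, D, k1, hS⟩
    · simp only [Test.Holds, h'.ctx.r6] at hc
      have hH' := h'.hopeless (by omega)
      refine (Spec.of_wp (P := noP) (Q := Answer I) ?_).mono ?_ fun σ h => h
      · simp [noP, Instr.val, Instr.run]
        exact ⟨by omega, Or.inr ⟨by simp, hH, hH'⟩⟩
      · have : cost noP = 1 := rfl
        omega
  · have : I.n * I.n ≤ I.n * I.n * (I.m + 1) := Nat.le_mul_of_pos_right _ (by omega)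
    omega

theorem HasWalk.transfer {I J : Inst} (h : ∀ a b, I.Adj a b → J.Adj a b) {a b k : ℕ}
    (hw : HasWalk I a b k) : HasWalk J a b k := by
  induction hw with
  | nil => exact .nil
  | snoc _ hadj ih => exact .snoc ih (h _ _ hadj)

/-- The same graph and terminals with other coordinates. -/
def Inst.withCoords (I : Inst) (x y : ℕ → ℕ) : Inst := { I with x := x, y := y }

theorem hasWalk_withCoords {x y : ℕ → ℕ} {a b k : ℕ} :
    HasWalk (I.withCoords x y) a b k ↔ HasWalk I a b k :=
  ⟨HasWalk.transfer (I := I.withCoords x y) (J := I) fun _ _ h => h,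
    HasWalk.transfer (I := I) (J := I.withCoords x y) fun _ _ h => h⟩

theorem DistInv.withCoords {s r j : ℕ} {d : ℕ → ℕ} (h : DistInv I s r j d) (x y : ℕ → ℕ) :
    DistInv (I.withCoords x y) s r j d :=
  ⟨h.zero, h.le, fun v hv hlt => hasWalk_withCoords.2 (h.walk v hv hlt),
    fun v k hw hk => h.low v k (hasWalk_withCoords.1 hw) hk, fun i hi k hk =>
    ⟨fun hw => (h.edge i hi k hk).1 (hasWalk_withCoords.1 hw),
      fun hw => (h.edge i hi k hk).2 (hasWalk_withCoords.1 hw)⟩⟩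

theorem Bounds.withCoords (h : Bounds I W) (x y : ℕ → ℕ) : Bounds (I.withCoords x y) W :=
  ⟨h.two_le, h.m_le, h.le_W, h.src_lt, h.dst_lt⟩

/-- Needed since the computation of `y` preserves the array of `x` only at the indices below `n`; no
walk from `s` ends elsewhere. -/
theorem DistInv.congr {s r : ℕ} {d d' : ℕ → ℕ} (hB : Bounds I W) (h : DistInv I s r 0 d)
    (hs : s < I.n) (hd : ∀ v < I.n, d' v = d v) : DistInv I s r 0 d' := by
  refine ⟨(hd s hs).trans h.zero, fun v hv => (hd v hv).trans_le (h.le v hv), fun v hv hlt => ?_,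
    fun v k hw hk => ?_, by simp⟩
  · rw [hd v hv] at hlt ⊢
    exact h.walk v hv hlt
  · have hv : v < I.n := by
      cases hw with
      | nil => exact hs
      | snoc _ hadj =>
        obtain ⟨j, hj, ⟨-, rfl⟩ | ⟨rfl, -⟩⟩ := hadj
        · exact hB.dst_lt j hj
        · exact hB.src_lt j hj
    rw [hd v hv]
    exact h.low v k hw hk

theorem spec_distancesP (hB : Bounds I W) (hs₁ : I.s₁ < I.n) (hs₂ : I.s₂ < I.n)
    (ht₂ : I.t₂ < I.n) (hE : Edges I σ.mem)
    (h0 : σ.reg 0 = I.n) (h1 : σ.reg 1 = I.m) (h2 : σ.reg 2 = I.s₁) (h3 : σ.reg 3 = I.t₁)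
    (h4 : σ.reg 4 = I.s₂) (h5 : σ.reg 5 = I.t₂) (h6 : σ.reg 6 = 0) (h7 : σ.reg 7 = 1) :
    Spec W distancesP σ (300 * (I.n * (I.m + 1))) fun σ' => ∃ x y,
      DistInv (I.withCoords x y) I.s₁ I.n 0 x ∧ DistInv (I.withCoords x y) I.s₂ I.n 0 y ∧
      Ctx (I.withCoords x y) σ'.reg ∧ Arrays (I.withCoords x y) σ'.mem := by
  have := hB.two_le
  have := hB.le_W
  have := hB.n_le
  have := hB.m_le
  refine Spec.mono (T := 14 + (100 * (I.n * (I.m + 1)) + (3 + (100 * (I.n * (I.m + 1)) + 1))))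
    (Spec.seq (Q := fun σ' => Ctx I σ'.reg ∧ σ'.reg 16 = 2 * I.m ∧ σ'.reg 17 = I.s₁ ∧
      σ'.mem = σ.mem) (Spec.of_wp ?_) fun σ₁ ⟨hc, h16, h17, hm⟩ => Spec.seq
      (spec_distP hB le_rfl (by omega) hs₁ (hm ▸ hE) hc h16 h17)
      fun σ₂ ⟨hc₂, hd₂, hf₂⟩ => Spec.seq (Q := fun σ' => Ctx I σ'.reg ∧
        σ'.reg 16 = 2 * I.m + I.n ∧ σ'.reg 17 = I.s₂ ∧ σ'.mem = σ₂.mem) (Spec.of_wp ?_)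
      fun σ₃ ⟨hc₃, h16₃, h17₃, hm₃⟩ => Spec.seq
      (spec_distP hB (by omega) (by omega) hs₂ ?_ hc₃ h16₃ h17₃)
      fun σ₄ ⟨hc₄, hd₄, hf₄⟩ => Spec.of_wp ?_) ?_ fun σ h => h
  · simp [setupP, Instr.val, Instr.run, h0, h1, h2]
    refine ⟨by omega, by omega, by omega, by omega, by omega, by omega, by omega, by omega,
      by omega, by omega, by omega, by omega, by omega, ?_, by omega⟩
    constructor <;> simp [*] <;> omega
  · simp [Instr.val, Instr.run, hc₂.r9, hc₂.r4]
    refine ⟨by omega, by omega, hc₂.congr fun r hr => ?_⟩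
    repeat rw [Function.update_of_ne (by omega)]
  · intro j hj
    rw [hm₃, hf₂ _ (by omega), hf₂ _ (by omega), hm]
    exact hE j hj
  · refine ⟨fun v => σ₄.mem (2 * I.m + v), fun v => σ₄.mem (2 * I.m + I.n + v),
      (hd₂.congr hB hs₁ fun v hv => ?_).withCoords _ _, hd₄.withCoords _ _,
      ⟨hc₄.r0, hc₄.r1, hc₄.r2, hc₄.r3, hc₄.r4, hc₄.r5, hc₄.r6, hc₄.r7, hc₄.r8, hc₄.r9, hc₄.r10,
        hc₄.r11, hc₄.r12, hc₄.r13, hc₄.r14, hc₄.r15⟩, fun j hj => ?_, fun v hv => rfl,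
      fun v hv => rfl⟩
    · exact (hf₄ (2 * I.m + v) (by omega)).trans (by rw [hm₃])
    · have hj : j < I.m := hj
      rw [hf₄ _ (by omega), hf₄ _ (by omega), hm₃, hf₂ _ (by omega), hf₂ _ (by omega), hm]
      exact hE j hj
  · have : I.n ≤ I.n * (I.m + 1) := Nat.le_mul_of_pos_right _ (by omega)
    omega

theorem valid_of_distInv (hB : Bounds I W) (hx : DistInv I I.s₁ I.n 0 I.x)
    (hy : DistInv I I.s₂ I.n 0 I.y) (hs₁ : I.s₁ < I.n) (hs₂ : I.s₂ < I.n) (ht₁ : I.t₁ < I.n)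
    (ht₂ : I.t₂ < I.n) (h₁ : I.s₁ ≠ I.t₁) (h₂ : I.s₁ ≠ I.s₂) : I.Valid := by
  have hlt : ∀ a b, I.Adj a b → a < I.n ∧ b < I.n := by
    rintro a b ⟨j, hj, ⟨rfl, rfl⟩ | ⟨rfl, rfl⟩⟩
    · exact ⟨hB.src_lt j hj, hB.dst_lt j hj⟩
    · exact ⟨hB.dst_lt j hj, hB.src_lt j hj⟩
  exact ⟨hB.src_lt, hB.dst_lt, hx.le, hy.le,
    fun a b hab => hx.lip (hlt a b hab).1 (hlt a b hab).2 hab,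
    fun a b hab => hy.lip (hlt a b hab).1 (hlt a b hab).2 hab, hs₁, ht₁, hs₂, ht₂, h₁, h₂⟩

end

/-! ### Paths -/

/-- The instance describes the graph `G`. -/
def Describes {n : ℕ} (I : Inst) (G : SimpleGraph (Fin n)) : Prop :=
  I.n = n ∧ ∀ a b : ℕ, I.Adj a b ↔ ∃ (ha : a < n) (hb : b < n), G.Adj ⟨a, ha⟩ ⟨b, hb⟩

section

variable {n : ℕ} {G : SimpleGraph (Fin n)} {I : Inst}

theorem Describes.adj (hG : Describes I G) {a b : Fin n} : I.Adj a b ↔ G.Adj a b := by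
  simp [hG.2]

theorem HasWalk.exists_walk (hG : Describes I G) {a b : Fin n} {k : ℕ} (h : HasWalk I a b k) :
    ∃ w : G.Walk a b, w.length = k := by
  obtain ⟨b', hb'⟩ : ∃ b' : ℕ, b' = b := ⟨_, rfl⟩
  rw [← hb'] at h
  induction h generalizing b with
  | nil =>
    obtain rfl : a = b := Fin.ext hb'
    exact ⟨.nil, rfl⟩
  | @snoc b₁ c k hw hadj ih =>
    subst hb'
    obtain ⟨h1, h2, h3⟩ := (hG.2 _ _).1 hadj
    obtain ⟨w, hl⟩ := ih (b := ⟨b₁, h1⟩) rfl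
    exact ⟨w.concat h3, by simp [hl]⟩

theorem le_add_length (hG : Describes I G) {d : ℕ → ℕ}
    (hd : ∀ a b, I.Adj a b → d b ≤ d a + 1) {a b : Fin n} (w : G.Walk a b) :
    d b ≤ d a + w.length := by
  induction w with
  | nil => simp
  | cons h w ih =>
    have := hd _ _ (hG.adj.2 h)
    simp only [SimpleGraph.Walk.length_cons]
    omega

/-- The vertices of a shortest path have the expected distances from its start. -/
theorem dist_getVert (hG : Describes I G) {d : ℕ → ℕ} {a b : Fin n} {w : G.Walk a b}
    (hd : DistInv I a I.n 0 d) (hlip : ∀ a b, I.Adj a b → d b ≤ d a + 1)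
    (hw : IsShortestPath G w) {i : ℕ} (hi : i ≤ w.length) : d (w.getVert i) = i := by
  have h1 := le_add_length hG hlip (w.take i)
  have h2 : (w.take i).length = i := by simp [SimpleGraph.Walk.take_length, hi]
  have h3 := hd.zero
  have hn : w.length < n := by simpa using hw.1.length_lt
  have hdn : d (w.getVert i) < I.n := by rw [hG.1]; omega
  obtain ⟨w', hw'⟩ := (hd.walk _ (by rw [hG.1]; exact (w.getVert i).2) hdn).exists_walk hG
  -- A smaller value than `i` would come from a walk `w'` that shortens the path.
  have h4 := SimpleGraph.dist_le (w'.append (w.drop i))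
  rw [SimpleGraph.Walk.length_append, SimpleGraph.Walk.drop_length, ← hw.2] at h4
  omega

/-- A set of vertices that has, for every `i < K`, an edge from its vertex of height `i` to that of
height `i + 1` is the vertex set of a path. -/
theorem exists_walk_of_cover (hG : Describes I G) {S : ℕ → Prop} {d : ℕ → ℕ} {K : ℕ} {b : Fin n}
    (hb : S b) (hbK : d b = K) (hinj : ∀ v v', S v → S v' → d v = d v' → v = v')
    (hcov : ∀ i < K, ∃ v v', S v ∧ S v' ∧ d v = i ∧ d v' = i + 1 ∧ I.Adj v v') (k : ℕ) (a : Fin n)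
    (ha : S a) (hk : d a + k = K) :
    ∃ w : G.Walk a b, w.length = k ∧ ∀ i ≤ k, S (w.getVert i) ∧ d (w.getVert i) = d a + i := by
  induction k generalizing a with
  | zero =>
    obtain rfl : a = b := Fin.ext (hinj _ _ ha hb (by omega))
    exact ⟨.nil, rfl, by simp [ha]⟩
  | succ k ih =>
    obtain ⟨v, v', h1, h2, h3, h4, h5⟩ := hcov (d a) (by omega)
    obtain rfl := hinj _ _ h1 ha h3
    obtain ⟨_, hv', h6⟩ := (hG.2 _ _).1 h5
    obtain ⟨w, h7, h8⟩ := ih ⟨v', hv'⟩ h2 (by simp only; omega)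
    refine ⟨.cons h6 w, by simp [h7], fun i hi => ?_⟩
    cases i with
    | zero => simp [ha]
    | succ i =>
      have := h8 i (by omega)
      simp only at this
      simp only [SimpleGraph.Walk.getVert_cons_succ]
      exact ⟨this.1, by omega⟩

/-- The Lipschitz function `d` bounds the length of every walk from `a` to `b` from below by `d b`.
-/
theorem isShortestPath_of_length_eq (hG : Describes I G) {d : ℕ → ℕ} {a b : Fin n}
    {w : G.Walk a b} (hd : d a = 0) (hlip : ∀ a b, I.Adj a b → d b ≤ d a + 1)
    (hw : w.length = d b) : IsShortestPath G w := by
  obtain ⟨w', hw'⟩ := w.reachable.exists_walk_length_eq_dist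
  have h1 := le_add_length hG hlip w'
  have h2 := SimpleGraph.dist_le w
  have h3 : w.length = G.dist a b := by omega
  exact ⟨w.isPath_of_length_eq_dist h3, h3⟩

/-- Along a walk, a function changes by at most one in every step. -/
theorem lip_seq {p d : ℕ → ℕ} {K : ℕ} (hp : ∀ i < K, I.Adj (p i) (p (i + 1)))
    (hlip : ∀ a b, I.Adj a b → d b ≤ d a + 1) {i i' : ℕ} (hi : i ≤ K) (hi' : i' ≤ K) :
    d (p i') ≤ d (p i) + ((i' - i) + (i - i')) := by
  have key : ∀ k i, i + k ≤ K →
      d (p (i + k)) ≤ d (p i) + k ∧ d (p i) ≤ d (p (i + k)) + k := by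
    intro k
    induction k with
    | zero => simp
    | succ k ih =>
      intro i hik
      have h1 := ih i (by omega)
      have h2 := hp (i + k) (by omega)
      have h3 := hlip _ _ h2
      have h4 := hlip _ _ h2.symm
      rw [← add_assoc]
      omega
  rcases le_total i i' with h | h
  · obtain ⟨k, rfl⟩ := Nat.exists_eq_add_of_le h
    have := (key k i hi').1
    omega
  · obtain ⟨k, rfl⟩ := Nat.exists_eq_add_of_le h
    have := (key k i' hi).2
    omega

/-- Two paths pass each other along a common level for at most one of the two directions of the
second path. -/
theorem not_both_pass (hx : ∀ a b, I.Adj a b → I.x b ≤ I.x a + 1)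
    (hy : ∀ a b, I.Adj a b → I.y b ≤ I.y a + 1) {p q : ℕ → ℕ} {K L : ℕ}
    (hp : ∀ i < K, I.Adj (p i) (p (i + 1))) (hq : ∀ j < L, I.Adj (q j) (q (j + 1)))
    (hpx : ∀ i ≤ K, I.x (p i) = i) (hqy : ∀ j ≤ L, I.y (q j) = j)
    {i j i' j' : ℕ} (hi : i < K) (hj : j < L) (hi' : i' < K) (hj' : j' < L)
    (h : I.x (p i) = I.x (q (j + 1)) ∧ I.y (p i) = I.y (q (j + 1)) ∧
      I.x (p (i + 1)) = I.x (q j) ∧ I.y (p (i + 1)) = I.y (q j))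
    (h' : I.x (p i') = I.x (q j') ∧ I.y (p i') = I.y (q j') ∧
      I.x (p (i' + 1)) = I.x (q (j' + 1)) ∧ I.y (p (i' + 1)) = I.y (q (j' + 1))) : False := by
  obtain ⟨a1, a2, a3, a4⟩ := h
  obtain ⟨b1, b2, b3, b4⟩ := h'
  rw [hpx _ hi.le] at a1
  rw [hpx _ hi] at a3
  rw [hqy _ hj] at a2
  rw [hqy _ hj.le] at a4
  rw [hpx _ hi'.le] at b1
  rw [hpx _ hi'] at b3
  rw [hqy _ hj'.le] at b2
  rw [hqy _ hj'] at b4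
  -- In the `(x, y)`-plane both paths contain the ends of an antidiagonal unit edge and of a
  -- diagonal one. Between an end of the one and an end of the other, the first path gives `|Δy| ≤
  -- |Δx|` and the second `|Δx| ≤ |Δy|`, so equality holds. A point in such position to both ends of
  -- the diagonal edge lies on the diagonal line through it, but the ends of the antidiagonal edge
  -- differ by `2` in `x - y`.
  have c1 := lip_seq hq hx (i := j + 1) (i' := j') hj hj'.le
  have c2 := lip_seq hq hx (i := j') (i' := j + 1) hj'.le hj
  have c3 := lip_seq hq hx (i := j) (i' := j' + 1) hj.le hj'
  have c4 := lip_seq hq hx (i := j' + 1) (i' := j) hj' hj.le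
  have c5 := lip_seq hq hx (i := j) (i' := j') hj.le hj'.le
  have c6 := lip_seq hq hx (i := j') (i' := j) hj'.le hj.le
  have c7 := lip_seq hq hx (i := j + 1) (i' := j' + 1) hj hj'
  have c8 := lip_seq hq hx (i := j' + 1) (i' := j + 1) hj' hj
  have d1 := lip_seq hp hy (i := i) (i' := i') hi.le hi'.le
  have d2 := lip_seq hp hy (i := i') (i' := i) hi'.le hi.le
  have d3 := lip_seq hp hy (i := i) (i' := i' + 1) hi.le hi'
  have d4 := lip_seq hp hy (i := i' + 1) (i' := i) hi' hi.le
  have d5 := lip_seq hp hy (i := i + 1) (i' := i') hi hi'.le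
  have d6 := lip_seq hp hy (i := i') (i' := i + 1) hi'.le hi
  have d7 := lip_seq hp hy (i := i + 1) (i' := i' + 1) hi hi'
  have d8 := lip_seq hp hy (i := i' + 1) (i' := i + 1) hi' hi
  rw [a2, b2] at d1
  rw [a2, b2] at d2
  rw [a2, b4] at d3
  rw [a2, b4] at d4
  rw [a4, b2] at d5
  rw [a4, b2] at d6
  rw [a4, b4] at d7
  rw [a4, b4] at d8
  rw [← a1, ← b1] at c1
  rw [← a1, ← b1] at c2
  rw [← a3, ← b3] at c3
  rw [← a3, ← b3] at c4
  rw [← a3, ← b1] at c5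
  rw [← a3, ← b1] at c6
  rw [← a1, ← b3] at c7
  rw [← a1, ← b3] at c8
  omega

end

/-! ### Correctness of the answer -/

section

variable {n : ℕ} {G : SimpleGraph (Fin n)} {I : Inst}

theorem exists_isShortestPath (hG : Describes I G) {S : ℕ → Prop} {d : ℕ → ℕ} {a b : Fin n}
    (ha : S a) (hb : S b) (hd : d a = 0) (hlip : ∀ a b, I.Adj a b → d b ≤ d a + 1)
    (hinj : ∀ v v', S v → S v' → d v = d v' → v = v')
    (hcov : ∀ i < d b, ∃ v v', S v ∧ S v' ∧ d v = i ∧ d v' = i + 1 ∧ I.Adj v v') :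
    ∃ w : G.Walk a b, IsShortestPath G w ∧ w.length = d b ∧
      ∀ i ≤ w.length, S (w.getVert i) ∧ d (w.getVert i) = i := by
  obtain ⟨w, h1, h2⟩ := exists_walk_of_cover hG hb rfl hinj hcov (d b) a ha (by omega)
  refine ⟨w, isShortestPath_of_length_eq hG hd hlip h1, h1, fun i hi => ?_⟩
  have := h2 i (by omega)
  rwa [hd, zero_add] at this

theorem disjoint_support {a b a' b' : Fin n} {w : G.Walk a b} {w' : G.Walk a' b'}
    (h : ∀ i ≤ w.length, ∀ j ≤ w'.length, w.getVert i ≠ w'.getVert j) :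
    List.Disjoint w.support w'.support := by
  intro v hv hv'
  obtain ⟨i, rfl, hi⟩ := SimpleGraph.Walk.mem_support_iff_exists_getVert.1 hv
  obtain ⟨j, h1, hj⟩ := SimpleGraph.Walk.mem_support_iff_exists_getVert.1 hv'
  exact h i hi j hj h1.symm

/-- Two disjoint shortest paths never pass each other along a common level, at least after the
second one has been reversed. -/
theorem exists_sol (hG : Describes I G) (hI : I.Valid) (hx : DistInv I I.s₁ I.n 0 I.x)
    (hy : DistInv I I.s₂ I.n 0 I.y) {s t : Fin 2 → Fin n} (hs₁ : I.s₁ = s 0) (ht₁ : I.t₁ = t 0)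
    (hs₂ : I.s₂ = s 1) (ht₂ : I.t₂ = t 1) {P : ∀ i, G.Walk (s i) (t i)}
    (hP : IsDSPSolution G s t P) : ∃ p q K L, I.Sol p q K L ∨ I.flip.Sol p q K L := by
  obtain ⟨p, hp⟩ : ∃ p : ℕ → ℕ, ∀ i, p i = (P 0).getVert i := ⟨_, fun _ => rfl⟩
  obtain ⟨q, hq⟩ : ∃ q : ℕ → ℕ, ∀ j, q j = (P 1).getVert j := ⟨_, fun _ => rfl⟩
  obtain ⟨K, hK⟩ : ∃ K, K = (P 0).length := ⟨_, rfl⟩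
  obtain ⟨L, hL⟩ : ∃ L, L = (P 1).length := ⟨_, rfl⟩
  have hLn : L < I.n := by
    rw [hL, hG.1]
    simpa using (hP.1 1).1.length_lt
  have hpx : ∀ i ≤ K, I.x (p i) = i := fun i hi => by
    rw [hp]
    exact dist_getVert hG (hs₁ ▸ hx) hI.x_lip (hP.1 0) (hK ▸ hi)
  have hqy : ∀ j ≤ L, I.y (q j) = j := fun j hj => by
    rw [hq]
    exact dist_getVert hG (hs₂ ▸ hy) hI.y_lip (hP.1 1) (hL ▸ hj)
  have hpa : ∀ i < K, I.Adj (p i) (p (i + 1)) := fun i hi => by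
    rw [hp, hp]
    exact hG.adj.2 ((P 0).adj_getVert_succ (hK ▸ hi))
  have hqa : ∀ j < L, I.Adj (q j) (q (j + 1)) := fun j hj => by
    rw [hq, hq]
    exact hG.adj.2 ((P 1).adj_getVert_succ (hL ▸ hj))
  have hdisj : ∀ i ≤ K, ∀ j ≤ L, p i ≠ q j := fun i _ j _ he => by
    rw [hp, hq] at he
    exact hP.2 0 1 (by simp) ((P 0).getVert_mem_support i)
      (Fin.ext he ▸ (P 1).getVert_mem_support j)
  have p0 : p 0 = I.s₁ := by rw [hp, hs₁, SimpleGraph.Walk.getVert_zero]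
  have pK : p K = I.t₁ := by rw [hp, hK, ht₁, SimpleGraph.Walk.getVert_length]
  have q0 : q 0 = I.s₂ := by rw [hq, hs₂, SimpleGraph.Walk.getVert_zero]
  have qL : q L = I.t₂ := by rw [hq, hL, ht₂, SimpleGraph.Walk.getVert_length]
  by_cases hpass : ∀ i < K, ∀ j < L, ¬ (I.x (p i) = I.x (q (j + 1)) ∧
      I.y (p i) = I.y (q (j + 1)) ∧ I.x (p (i + 1)) = I.x (q j) ∧ I.y (p (i + 1)) = I.y (q j))
  · exact ⟨p, q, K, L, Or.inl ⟨p0, pK, q0, qL, hpa, hqa,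
      fun i hi => by rw [hpx i hi, hx.zero, zero_add],
      fun j hj => by rw [hqy j hj, hy.zero, zero_add], hdisj, hpass⟩⟩
  -- The paths pass for the given direction of the second one; hence they do not pass after its
  -- reversal.
  · push Not at hpass
    obtain ⟨i, hi, j, hj, h⟩ := hpass
    have hpn : ∀ i ≤ K, I.y (p i) ≤ I.n := fun i _ => hI.y_le _ (by
      rw [hp, hG.1]
      exact Fin.is_lt _)
    have hfy : ∀ v, I.flip.y v = I.n - I.y v := fun _ => rfl
    have hfx : ∀ v, I.flip.x v = I.x v := fun _ => rfl
    refine ⟨p, fun j => q (L - j), K, L, Or.inr ⟨p0, pK, qL, ?_, hpa, fun j hj => ?_,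
      fun i hi => ?_, fun j hj => ?_, fun i hi j _ => hdisj i hi _ (Nat.sub_le _ _),
      fun i' hi' j' hj' h' => ?_⟩⟩
    · exact (congrArg q (Nat.sub_self L)).trans q0
    · have := hqa (L - (j + 1)) (by omega)
      rw [show L - (j + 1) + 1 = L - j by omega] at this
      exact this.symm
    · exact (hpx i hi).trans (by rw [show I.flip.x I.flip.s₁ = 0 from hx.zero, zero_add])
    · have h1 := hqy L le_rfl
      rw [qL] at h1
      rw [hfy, hqy _ (Nat.sub_le _ _), show I.flip.s₂ = I.t₂ from rfl, hfy, h1]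
      omega
    · have h1 := hpn i' hi'.le
      have h2 := hpn (i' + 1) hi'
      rw [hfy, hfy, hfy, hfy, hfx, hfx, hfx, hfx, hqy _ (Nat.sub_le _ _),
        hqy _ (Nat.sub_le _ _)] at h'
      have h3 := hqy (L - (j' + 1) + 1) (by omega)
      have h4 := hqy (L - (j' + 1)) (by omega)
      -- Step `j'` of the reversed path is step `L - (j' + 1)` of `q`, traversed backwards.
      rw [show L - j' = L - (j' + 1) + 1 by omega] at h'
      exact not_both_pass hI.x_lip hI.y_lip hpa hqa hpx hqy hi hj hi'
        (show L - (j' + 1) < L by omega) h ⟨h'.1, by omega, h'.2.2.1, by omega⟩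

theorem Inst.Sol.not_hopeless {p q : ℕ → ℕ} {K L : ℕ} (hI : I.Valid) (h : I.Sol p q K L) :
    ¬ Hopeless I := by
  rintro ⟨S, h0, hS, hn⟩
  obtain ⟨s, hs, h1⟩ := h.exists_conf hI S h0 hS
  exact hn s hs h1

theorem Answer.isCorrectAnswer {σ : State} (h : Answer I σ) (hG : Describes I G) (hI : I.Valid)
    (hne : I.s₁ ≠ I.t₂) (hx : DistInv I I.s₁ I.n 0 I.x) (hy : DistInv I I.s₂ I.n 0 I.y)
    {s t : Fin 2 → Fin n} (hs₁ : I.s₁ = s 0) (ht₁ : I.t₁ = t 0) (hs₂ : I.s₂ = s 1)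
    (ht₂ : I.t₂ = t 1) : IsCorrectAnswer G s t σ := by
  rcases h with ⟨r0, r1, r2, r3, r4, D, hW, hD⟩ | ⟨r0, h1, h2⟩
  · left
    obtain ⟨w₁, a1, a2, a3⟩ := exists_isShortestPath hG (S := fun v => ∃ r ∈ D, r.u = v)
      (d := I.x) (a := s 0) (b := t 0) (hs₁ ▸ hD.s₁_mem) (ht₁ ▸ hD.t₁_mem) (hs₁ ▸ hx.zero)
      hI.x_lip (by
        rintro _ _ ⟨r, hr, rfl⟩ ⟨r', hr', rfl⟩ he
        exact hD.writable.x_inj r hr r' hr' he) (by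
        intro i hi
        obtain ⟨r, hr, r', hr', h⟩ := hD.x_cov i (ht₁ ▸ hi)
        exact ⟨_, _, ⟨r, hr, rfl⟩, ⟨r', hr', rfl⟩, h⟩)
    obtain ⟨w₂, b1, b2, b3⟩ := exists_isShortestPath hG (S := fun v => ∃ r ∈ D, r.v = v)
      (d := I.y) (a := s 1) (b := t 1) (hs₂ ▸ hD.s₂_mem) (ht₂ ▸ hD.t₂_mem) (hs₂ ▸ hy.zero)
      hI.y_lip (by
        rintro _ _ ⟨r, hr, rfl⟩ ⟨r', hr', rfl⟩ he
        exact hD.writable.y_inj r hr r' hr' he) (by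
        intro i hi
        obtain ⟨r, hr, r', hr', h⟩ := hD.y_cov i (ht₂ ▸ hi)
        exact ⟨_, _, ⟨r, hr, rfl⟩, ⟨r', hr', rfl⟩, h⟩)
    have hdisj : ∀ i ≤ w₁.length, ∀ j ≤ w₂.length, w₁.getVert i ≠ w₂.getVert j := by
      intro i hi j hj he
      obtain ⟨⟨r, hr, h1⟩, -⟩ := a3 i hi
      obtain ⟨⟨r', hr', h2⟩, -⟩ := b3 j hj
      exact hD.disj r hr r' hr' (by rw [h1, h2, he])
    refine ⟨r0, Fin.cons w₁ (Fin.cons w₂ fun i => i.elim0), ⟨?_, ?_⟩, ?_⟩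
    · exact Fin.forall_fin_two.2 ⟨a1, b1⟩
    · refine Fin.forall_fin_two.2 ⟨Fin.forall_fin_two.2 ⟨fun h => absurd rfl h, fun _ => ?_⟩,
        Fin.forall_fin_two.2 ⟨fun _ => ?_, fun h => absurd rfl h⟩⟩
      · exact disjoint_support hdisj
      · exact (disjoint_support hdisj).symm
    · refine Fin.forall_fin_two.2 ⟨⟨fun i hi => ?_, ?_⟩, fun i hi => ?_, ?_⟩
      · obtain ⟨⟨r, hr, h1⟩, h2⟩ := a3 i hi
        have h3 := (hW r hr).1
        rw [h1, h2] at h3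
        change σ.mem (σ.reg 1 + i) = w₁.getVert i
        rw [r1, add_comm, h3]
      · change σ.reg 2 = w₁.length
        rw [r2, a2, ht₁]
      · obtain ⟨⟨r, hr, h1⟩, h2⟩ := b3 i hi
        have h3 := (hW r hr).2
        rw [h1, h2] at h3
        change σ.mem (σ.reg 3 + i) = w₂.getVert i
        rw [r3, add_comm, h3]
      · change σ.reg 4 = w₂.length
        rw [r4, b2, ht₂]
  · refine Or.inr ⟨r0, ?_⟩
    rintro ⟨P, hP⟩
    obtain ⟨p, q, K, L, hS | hS⟩ := exists_sol hG hI hx hy hs₁ ht₁ hs₂ ht₂ hP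
    · exact hS.not_hopeless hI h1
    · exact hS.not_hopeless (hI.flip hne) h2

end

/-! ### The whole program -/

section

variable {n m : ℕ} {G : SimpleGraph (Fin n)} {src dst : Fin m → Fin n} {s t : Fin 2 → Fin n}

/-- The instance given by a list of edges and two pairs of terminals. -/
def inputInst (src dst : Fin m → Fin n) (s t : Fin 2 → Fin n) : Inst where
  n := n
  m := m
  src j := if h : j < m then src ⟨j, h⟩ else 0
  dst j := if h : j < m then dst ⟨j, h⟩ else 0
  x _ := 0
  y _ := 0
  s₁ := s 0
  t₁ := t 0
  s₂ := s 1
  t₂ := t 1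

theorem describes_inputInst (hG : IsEdgeList G src dst) (s t : Fin 2 → Fin n) :
    Describes (inputInst src dst s t) G := by
  refine ⟨rfl, fun a b => ⟨?_, ?_⟩⟩
  · rintro ⟨j, hj, h⟩
    have hj : j < m := hj
    have hadj : G.Adj (src ⟨j, hj⟩) (dst ⟨j, hj⟩) := by
      rw [← SimpleGraph.mem_edgeSet, ← hG.2]
      exact ⟨_, rfl⟩
    simp only [inputInst, hj, dif_pos] at h
    obtain ⟨rfl, rfl⟩ | ⟨rfl, rfl⟩ := h
    · exact ⟨Fin.is_lt _, Fin.is_lt _, hadj⟩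
    · exact ⟨Fin.is_lt _, Fin.is_lt _, hadj.symm⟩
  · rintro ⟨ha, hb, h⟩
    rw [← SimpleGraph.mem_edgeSet, ← hG.2] at h
    obtain ⟨⟨j, hj⟩, h⟩ := h
    refine ⟨j, hj, ?_⟩
    simp only [inputInst, hj, dif_pos]
    simp only [Sym2.eq_iff] at h
    rcases h with ⟨h1, h2⟩ | ⟨h1, h2⟩
    · exact Or.inl ⟨congrArg Fin.val h1, congrArg Fin.val h2⟩
    · exact Or.inr ⟨congrArg Fin.val h1, congrArg Fin.val h2⟩

theorem edgeList_le_mul (hG : IsEdgeList G src dst) : m ≤ n * n := by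
  have h : Function.Injective fun j => (src j, dst j) := fun i j hij =>
    hG.1 (congrArg (fun e : Fin n × Fin n => s(e.1, e.2)) hij)
  simpa using Fintype.card_le_of_injective _ h

theorem bounds_inputInst (hG : IsEdgeList G src dst) (s t : Fin 2 → Fin n) (hn : 2 ≤ n) :
    Bounds (inputInst src dst s t) (n ^ 8) := by
  refine ⟨hn, edgeList_le_mul hG, ?_, fun j hj => ?_, fun j hj => ?_⟩
  -- The word bound `n ^ 8` absorbs the constant `64` because `n` is at least `2`.
  · calc 64 * (n * n) = 2 ^ 6 * n ^ 2 := by ring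
      _ ≤ n ^ 6 * n ^ 2 := Nat.mul_le_mul_right _ (Nat.pow_le_pow_left hn 6)
      _ = n ^ 8 := by ring
  · have hj : j < m := hj
    simp [inputInst, hj]
  · have hj : j < m := hj
    simp [inputInst, hj]

theorem edges_inputInst (src dst : Fin m → Fin n) (s t : Fin 2 → Fin n) :
    Edges (inputInst src dst s t) (inputState src dst s t).mem := by
  intro j hj
  have hj : j < m := hj
  have h1 : 2 * j / 2 = j := by omega
  have h2 : (2 * j + 1) / 2 = j := by omega
  have h3 : (2 * j + 1) % 2 = 1 := by omega
  simp [inputState, inputInst, h1, h2, h3, hj]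

/-- The first path of a solution does not start at a terminal of the second one. -/
theorem source_ne {P : ∀ i, G.Walk (s i) (t i)} (hP : IsDSPSolution G s t P) :
    s 0 ≠ s 1 ∧ s 0 ≠ t 1 :=
  ⟨fun h => hP.2 0 1 (by simp) (P 0).start_mem_support (by
    rw [h]
    exact (P 1).start_mem_support), fun h => hP.2 0 1 (by simp) (P 0).start_mem_support (by
    rw [h]
    exact (P 1).end_mem_support)⟩

/-- This justifies the immediate negative answer for `m = 0`, where the time bound is a constant. -/
theorem edgeList_pos (hG : IsEdgeList G src dst) {a b : Fin n} (hab : a ≠ b) (w : G.Walk a b) :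
    0 < m := by
  cases w with
  | nil => exact absurd rfl hab
  | cons h _ =>
    rw [← SimpleGraph.mem_edgeSet, ← hG.2] at h
    obtain ⟨j, -⟩ := h
    exact j.pos

theorem spec_noP {W : ℕ} {σ : State} (hW : 0 < W)
    (h : ¬ ∃ P : ∀ i, G.Walk (s i) (t i), IsDSPSolution G s t P) :
    Spec W noP σ 1 (IsCorrectAnswer G s t) :=
  Spec.of_wp ⟨hW, Or.inr ⟨by simp [Instr.run, Instr.val], h⟩⟩

theorem spec_solveP (hG : IsEdgeList G src dst) (hst : ∀ i, s i ≠ t i) :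
    Spec (n ^ 8) solveP (inputState src dst s t) (30000 * (n ^ 2 * m + 1))
      (IsCorrectAnswer G s t) := by
  have hn : 2 ≤ n := by
    have := (s 0).2
    have := (t 0).2
    have := Fin.val_ne_of_ne (hst 0)
    omega
  have hW : 1 < n ^ 8 := Nat.one_lt_pow (by omega) hn
  have hB := bounds_inputInst hG s t hn
  have hD := describes_inputInst hG s t
  have hE := edges_inputInst src dst s t
  set I := inputInst src dst s t with hI
  have e0 : I.n = n := rfl
  have e1 : I.m = m := rfl
  obtain ⟨T, hT⟩ : ∃ T, T = 300 * (n * (m + 1)) + (11000 * (n * n * (m + 1)) + 1) := ⟨_, rfl⟩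
  -- The search is charged only if `0 < m`; then `n ^ 2 * (m + 1)` is at most `2 * n ^ 2 * m`.
  refine Spec.mono (T := 2 + ((1 + (1 + (1 + if 0 < m then T else 1))) + 1))
    (Spec.seq (Q := fun σ => σ = (Instr.const 7 1).run (inputState src dst s t))
      (Spec.of_wp (P := block [.const 7 1]) ⟨hW, rfl⟩) fun σ hσ => Spec.seq
      (Spec.branch (R := IsCorrectAnswer G s t) (fun hc => ?_) fun hc =>
        Spec.branch (fun hc1 => ?_) fun hc1 => Spec.branch (fun hc2 => ?_) fun hc2 => ?_)
      fun σ h => Spec.of_wp h) ?_ fun σ h => h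
  case refine_5 =>
    split_ifs with h
    · have h2 : n * (m + 1) ≤ n * n * (m + 1) :=
        Nat.mul_le_mul_right _ (Nat.le_mul_of_pos_right _ (by omega))
      have h3 : n * n * (m + 1) = n ^ 2 * m + n ^ 2 := by ring
      have h4 : n ^ 2 ≤ n ^ 2 * m := Nat.le_mul_of_pos_right _ h
      omega
    · omega
  all_goals
    have hr : ∀ r, r ≠ 7 → σ.reg r = (inputState src dst s t).reg r := fun r hr => by
      rw [hσ]
      exact Function.update_of_ne hr _ _
    have r1 : σ.reg 1 = m := (hr 1 (by omega)).trans (by simp [inputState])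
    have r2 : σ.reg 2 = s 0 := (hr 2 (by omega)).trans (by simp [inputState])
    have r4 : σ.reg 4 = s 1 := (hr 4 (by omega)).trans (by simp [inputState])
    have r5 : σ.reg 5 = t 1 := (hr 5 (by omega)).trans (by simp [inputState])
    have r6 : σ.reg 6 = 0 := (hr 6 (by omega)).trans (by simp [inputState])
  · refine (spec_noP (by omega) ?_).mono (by omega) fun σ h => h
    rintro ⟨P, -⟩
    have := edgeList_pos hG (hst 0) (P 0)
    simp only [Test.Holds] at hc
    omega
  all_goals
    have hm : 0 < m := by
      simp only [Test.Holds] at hc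
      omega
    rw [if_pos hm]
  · refine (spec_noP (by omega) ?_).mono (by omega) fun σ h => h
    rintro ⟨P, hP⟩
    simp only [Test.Holds, r2, r4] at hc1
    exact (source_ne hP).1 (Fin.ext hc1)
  · refine (spec_noP (by omega) ?_).mono (by omega) fun σ h => h
    rintro ⟨P, hP⟩
    simp only [Test.Holds, r2, r5] at hc2
    exact (source_ne hP).2 (Fin.ext hc2)
  · simp only [Test.Holds, r2, r4] at hc1
    simp only [Test.Holds, r2, r5] at hc2
    have r0 : σ.reg 0 = n := (hr 0 (by omega)).trans (by simp [inputState])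
    have r3 : σ.reg 3 = t 0 := (hr 3 (by omega)).trans (by simp [inputState])
    have r7 : σ.reg 7 = 1 := by
      rw [hσ]
      simp [Instr.run, Instr.val]
    have hmem : σ.mem = (inputState src dst s t).mem := by
      rw [hσ]
      rfl
    rw [hT]
    refine (spec_distancesP hB (s 0).2 (s 1).2 (t 1).2 (hmem ▸ hE) r0 r1 r2 r3 r4 r5 r6 r7).seq
      fun σ₁ ⟨x, y, hx, hy, hctx, harr⟩ => Spec.seq ?_ fun σ h => Spec.of_wp h
    have hB' := hB.withCoords x y
    have hV : (I.withCoords x y).Valid := valid_of_distInv hB' hx hy (s 0).2 (s 1).2 (t 0).2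
      (t 1).2 (Fin.val_ne_of_ne (hst 0)) hc1
    exact (spec_decideP hB' hV hc2 hx.zero hy.zero hctx harr).mono le_rfl fun σ h =>
      h.isCorrectAnswer hD hV hc2 hx hy rfl rfl rfl rfl

end

end TwoDSP

/-- `2`-Disjoint Shortest Paths can be solved in `O(n ^ 2 * m)` time (on a unit-cost random access
machine with words of `O(log n)` bits). -/
theorem proposition2 :
    ∃ (prog : RAM.Prog) (C c : ℕ),
      ∀ (n m : ℕ) (G : SimpleGraph (Fin n)) (src dst : Fin m → Fin n) (s t : Fin 2 → Fin n),
        IsEdgeList G src dst →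
        (∀ i, s i ≠ t i) →
        ∃ (σ : RAM.State) (τ : ℕ),
          RAM.Exec (n ^ c) prog (inputState src dst s t) σ τ ∧
          τ ≤ C * (n ^ 2 * m + 1) ∧
          IsCorrectAnswer G s t σ :=
  ⟨TwoDSP.solveP, 30000, 8, fun _ _ _ _ _ _ _ hG hst => TwoDSP.spec_solveP hG hst⟩
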